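/- For $x\in\mathbb R^5$ write $x=(x_1,\bar x)$ and $\langle x\rangle=(1+|x|^2)^{1/2}$. Denote by $\fint_{|y-x|=r} h\,d\omega$ the average of $h$ over the sphere of center $x$ and radius $r$ with respect to surface measure, and for smooth $h$ and $s>0$ let $$\frac{\sin(s\sqrt{-\Delta})}{\sqrt{-\Delta}}h(x)=\frac13\,\frac1s\frac{\partial}{\partial s}\Big(s^3\fint_{|y-x|=s}h(y)\,d\omega(y)\Big)$$ be the wave propagator of $\mathbb R^5$. Let $-1<\ell<1$ and set $$x_\ell=\Big(\frac{x_1-\ell t}{\sqrt{1-\ell^2}},\bar x\Big),\qquad A_\ell=\partial_t+\ell\,\partial_{x_1},$$ $$f^\sharp_\ell(t,x)=t^{-3}\langle x_\ell\rangle^{-3},\qquad g^\sharp_\ell(t,x)=\ell\,t^{-2}\,\partial_{x_1}\langle x_\ell\rangle^{-3}\qquad(t>0),$$ $$v^\sharp_\ell(t)=\int_0^\infty\frac{\sin(s\sqrt{-\Delta})}{\sqrt{-\Delta}}\,(f^\sharp_\ell+g^\sharp_\ell)(t+s)\,ds\qquad(t>0).$$ Then this integral converges absolutely for all $t>0$ and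 $x\in\mathbb R^5$, and $v^\sharp_\ell$ is smooth on $(0,\infty)\times\mathbb R^5$. For every $0<\delta<1$, every integer $m\ge0$ and all spatial multi-indices $\alpha,\alpha'\in\mathbb N^5$ with $|\alpha|=1$, $|\alpha'|\ge2$, there is a constant $C$ (depending only on $\ell,\delta,m,\alpha,\alpha'$) such that for all $t>1$ and $x\in\mathbb R^5$, $$|A_\ell^m v^\sharp_\ell(t,x)|\le C\,(t+\langle x_\ell\rangle)^{-1}t^{-(1+m)}\langle x_\ell\rangle^{-2+\delta},$$ $$|A_\ell^m\partial^\alpha v^\sharp_\ell(t,x)|\le C\,(t+\langle x_\ell\rangle)^{-1}t^{-(1+m)}\langle x_\ell\rangle^{-3+\delta},$$ $$|A_\ell^m\partial^{\alpha'} v^\sharp_\ell(t,x)|\le C\,(t+\langle x_\ell\rangle)^{-1}t^{-(1+m)}\langle x_\ell\rangle^{-4+\delta}.$$ Moreover, for $r>0$ and $t>1$ let $$V^\sharp_\ell(t,r)=\fint_{|x|=r}v^\sharp_\ell(t,x)\,d\omega(x),\qquad \phi_\ell(t,r)=r^2\,\partial_rV^\sharp_\ell(t,r)+3r\,V^\sharp_\ell(t,r),$$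 where $V^\sharp_\ell(t,\cdot)$ is differentiable on $(0,\infty)$. Then there are constants $T>1$ and $C$, depending only on $\ell$, such that for all $t\ge T$ and $r>0$ with $t<r^{11/12}$, $$\big|\phi_\ell(t,r)-(1-\ell^2)^{1/2}r^{-3}\big|\le C\,r^{-1}t^{-9/4}.$$ -/

import Mathlib

open MeasureTheory Set
open scoped ContDiff

noncomputable section

/-- The Euclidean space `ℝ⁵`; the coordinate `x₁` has index `0`. -/
abbrev R5 : Type := EuclideanSpace ℝ (Fin 5)

/-- The Japanese bracket `⟨x⟩ = (1 + |x|²)^{1/2}`. -/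
def bracket (x : R5) : ℝ := Real.sqrt (1 + ‖x‖ ^ 2)

/-- `x_ℓ = ((x₁ - ℓ t) / √(1 - ℓ²), x₂, …, x₅)`. -/
def xl (l t : ℝ) (x : R5) : R5 :=
  WithLp.toLp 2 (fun i => if i = 0 then (x 0 - l * t) / Real.sqrt (1 - l ^ 2) else x i)

/-- The partial derivative `∂_{x_i}` of a function of `(t, x)`. -/
def partialX (i : Fin 5) (u : ℝ → R5 → ℝ) : ℝ → R5 → ℝ :=
  fun t x => fderiv ℝ (u t) x (EuclideanSpace.single i 1)

/-- The time derivative `∂_t` of a function of `(t, x)`. -/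
def partialT (u : ℝ → R5 → ℝ) : ℝ → R5 → ℝ :=
  fun t x => deriv (fun τ => u τ x) t

/-- The operator `A_ℓ = ∂_t + ℓ ∂_{x₁}`. -/
def opA (l : ℝ) (u : ℝ → R5 → ℝ) : ℝ → R5 → ℝ :=
  fun t x => partialT u t x + l * partialX 0 u t x

/-- The spatial derivative `∂^α = ∂_{x₁}^{α₁} ⋯ ∂_{x₅}^{α₅}` for a multi-index `α ∈ ℕ⁵`. -/
def partialAlpha (α : Fin 5 → ℕ) (u : ℝ → R5 → ℝ) : ℝ → R5 → ℝ :=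
  (partialX 0)^[α 0] ((partialX 1)^[α 1] ((partialX 2)^[α 2]
    ((partialX 3)^[α 3] ((partialX 4)^[α 4] u))))

/-- The average of `h` over the sphere of center `x` and radius `r` of `ℝ⁵`, with respect to
the surface measure. -/
def sphMean (h : R5 → ℝ) (x : R5) (r : ℝ) : ℝ :=
  ⨍ y : Metric.sphere (0 : R5) 1, h (x + r • (y : R5)) ∂(volume : Measure R5).toSphere

/-- The wave propagator `sin(s√-Δ)/√-Δ` of `ℝ⁵` at time `s > 0`, by Kirchhoff's formula
`(1/3) (1/s ∂_s) (s³ ⨍_{|y-x|=s} h(y) dω(y))`. -/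
def sinePropagator (s : ℝ) (h : R5 → ℝ) (x : R5) : ℝ :=
  (1 / 3) * ((1 / s) * deriv (fun σ => σ ^ 3 * sphMean h x σ) s)

/-- `f♯_ℓ(t,x) = t⁻³ ⟨x_ℓ⟩⁻³`. -/
def fSharp (l t : ℝ) (x : R5) : ℝ := (t ^ 3)⁻¹ * (bracket (xl l t x) ^ 3)⁻¹

/-- `g♯_ℓ(t,x) = ℓ t⁻² ∂_{x₁} ⟨x_ℓ⟩⁻³`. -/
def gSharp (l t : ℝ) (x : R5) : ℝ :=
  l * (t ^ 2)⁻¹ * partialX 0 (fun τ y => (bracket (xl l τ y) ^ 3)⁻¹) t x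

/-- The integrand `s ↦ (sin(s√-Δ)/√-Δ (f♯_ℓ + g♯_ℓ)(t+s))(x)` of the Duhamel formula. -/
def duhamelIntegrand (l t : ℝ) (x : R5) (s : ℝ) : ℝ :=
  sinePropagator s (fun y => fSharp l (t + s) y + gSharp l (t + s) y) x

/-- `v♯_ℓ(t) = ∫₀^∞ sin(s√-Δ)/√-Δ (f♯_ℓ + g♯_ℓ)(t+s) ds`. -/
def vSharp (l t : ℝ) (x : R5) : ℝ := ∫ s in Ioi (0 : ℝ), duhamelIntegrand l t x s

/-- `V♯_ℓ(t,r) = ⨍_{|x|=r} v♯_ℓ(t,x) dω(x)`. -/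
def VSharp (l t r : ℝ) : ℝ := sphMean (vSharp l t) 0 r

/-- `φ_ℓ(t,r) = r² ∂_r V♯_ℓ(t,r) + 3 r V♯_ℓ(t,r)`. -/
def phiSharp (l t r : ℝ) : ℝ :=
  r ^ 2 * deriv (fun ρ => VSharp l t ρ) r + 3 * r * VSharp l t r

end

open Filter Topology Metric



/-! Kirchhoff's formula turns the Duhamel integral at `(t, x)` into an integral over the light cone
`(t + |y|, x + y)`, parametrised by `y ∈ ℝ⁵`. Along that cone `x_ℓ` moves by the space part of a
Lorentz boost of the null vector `(|y|, y)` (`xl_add`). A radial integration by parts removes the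
radial derivative in Kirchhoff's formula (`integral_coneIntegrand`). Taking the boosted vector as
the new variable and integrating by parts once more in `y₁` removes the remaining derivative
(`integral_coneIntegrand'`). A source `t⁻ᵏ h(x_ℓ)` thus produces, up to the factor `(3|S⁴|)⁻¹`, the
integral `∫ K_k(t, y) h(x_ℓ + y) dy`, where `K_k = |y|⁻³ a⁻ᵏ + kγ |y|⁻² a⁻ᵏ⁻¹`, `γ = (1 -
ℓ²)^{-1/2}` and `a = t + γ(|y| + ℓ y₁)` is comparable to `t + |y|`. Hence `vSharp_eq`.

Decay: `A_ℓ` annihilates `x_ℓ` and `∂_t K_k = -k K_{k+1}`, so each `A_ℓ` costs one power of `t`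
(`IsBoostComb.opA`), while space derivatives fall on the profile. The bounds then follow from one
weighted convolution estimate, `integral_convKernel_le`. From order two on, one derivative of the
second source is moved back to the kernel (`boostInt_pd`), because the convolution estimate cannot
exploit decay of `h` beyond `⟨z⟩⁻⁵`.

Asymptotics: `Δ⟨z⟩⁻³ = -15⟨z⟩⁻⁷`. Green's identity against `K₁` rewrites `v♯` as `½ t⁻¹ ⟨x_ℓ⟩⁻³`
minus a multiple of the potential of `⟨z⟩⁻⁷` (`green_identity`, `vSharp_eq_profile`). The quantity
`φ_ℓ` is `r` times the spherical mean of `3v + x·∇v`. In that combination the `t⁻¹⟨x_ℓ⟩⁻³` terms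
cancel, and the integrable density `⟨z⟩⁻⁷` acts to leading order like a point mass, so `3v + x·∇v`
equals a time-independent function homogeneous of degree `-4`, up to `O(t|x|⁻⁵)`. The even part of
that function is exactly `γ⁻¹|x|⁻⁴` (`leadingTerm_add_neg`), and odd parts have zero spherical mean.
This gives an error `O(t r⁻⁴)` for `φ_ℓ` (`abs_phiSharp_sub_le`), and `t < r^{11/12}` converts it to
the stated form. -/

/-! ### Polar coordinates and integration by parts across the origin -/

lemma finrank_R5 : Module.finrank ℝ R5 = 5 := by simp [R5]

/-- The surface measure of the unit sphere of `ℝ⁵`. -/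
noncomputable abbrev sphMeasure : Measure (sphere (0 : R5) 1) := (volume : Measure R5).toSphere

/-- The surface area of the unit sphere of `ℝ⁵`. -/
noncomputable def sphArea : ℝ := sphMeasure.real univ

lemma sphArea_pos : 0 < sphArea := by
  have h : sphMeasure ≠ 0 := Measure.toSphere_ne_zero _
  rw [sphArea, measureReal_def]
  exact ENNReal.toReal_pos (by rwa [Ne, Measure.measure_univ_eq_zero]) (measure_ne_top _ _)

lemma norm_sphere (θ : sphere (0 : R5) 1) : ‖(θ : R5)‖ = 1 := by simp

lemma norm_smul_sphere {r : ℝ} (hr : 0 < r) (θ : sphere (0 : R5) 1) : ‖r • (θ : R5)‖ = r := by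
  rw [norm_smul, norm_sphere, mul_one, Real.norm_of_nonneg hr.le]

lemma integrable_volumeIoiPow_iff {g : ℝ → ℝ} :
    Integrable (fun r : Ioi (0 : ℝ) => g r) (Measure.volumeIoiPow 4) ↔
      IntegrableOn (fun r => r ^ 4 * g r) (Ioi 0) := by
  rw [integrableOn_iff_comap_subtypeVal measurableSet_Ioi, Measure.volumeIoiPow,
    integrable_withDensity_iff_integrable_smul' (by fun_prop) (by simp), integrable_congr]
  refine .of_forall ?_
  rintro ⟨x, hx : 0 < x⟩
  simp (disch := positivity) [ENNReal.toReal_ofReal]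

lemma integral_volumeIoiPow (g : ℝ → ℝ) :
    ∫ r : Ioi (0 : ℝ), g r ∂(Measure.volumeIoiPow 4) = ∫ r in Ioi (0 : ℝ), r ^ 4 * g r := by
  simp only [Measure.volumeIoiPow, ENNReal.ofReal]
  rw [integral_withDensity_eq_integral_smul,
    integral_subtype_comap measurableSet_Ioi fun a => Real.toNNReal (a ^ 4) • g a,
    setIntegral_congr_fun measurableSet_Ioi fun x hx => ?_]
  · rw [NNReal.smul_def, Real.coe_toNNReal _ (pow_nonneg hx.out.le _), smul_eq_mul]
  · exact (measurable_subtype_coe.pow_const _).real_toNNReal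

lemma integrable_polar_iff {f : R5 → ℝ} :
    Integrable (fun p : sphere (0 : R5) 1 × Ioi (0 : ℝ) => f ((p.2 : ℝ) • (p.1 : R5)))
      (sphMeasure.prod (Measure.volumeIoiPow 4)) ↔ Integrable f := by
  have h := (volume : Measure R5).measurePreserving_homeomorphUnitSphereProd
  rw [finrank_R5] at h
  have h2 := h.integrable_comp_emb
    (g := fun p : sphere (0 : R5) 1 × Ioi (0 : ℝ) => f ((p.2 : ℝ) • (p.1 : R5)))
    (Homeomorph.measurableEmbedding _)
  have h3 : Integrable f ↔ Integrable (f ∘ (Subtype.val : ({0}ᶜ : Set R5) → R5))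
      (Measure.comap Subtype.val volume) := by
    rw [← integrableOn_iff_comap_subtypeVal (by measurability), IntegrableOn,
      restrict_compl_singleton]
  rw [← h2, h3]
  apply iff_of_eq
  congr 1
  ext x
  simp only [Function.comp]
  congr 1
  exact congrArg Subtype.val ((homeomorphUnitSphereProd R5).symm_apply_apply x)

lemma integral_polar_prod (f : R5 → ℝ) :
    ∫ p : sphere (0 : R5) 1 × Ioi (0 : ℝ), f ((p.2 : ℝ) • (p.1 : R5))
      ∂(sphMeasure.prod (Measure.volumeIoiPow 4)) = ∫ x, f x := by
  have h := (volume : Measure R5).measurePreserving_homeomorphUnitSphereProd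
  rw [finrank_R5] at h
  have h2 := h.integral_comp (Homeomorph.measurableEmbedding _)
    (fun p : sphere (0 : R5) 1 × Ioi (0 : ℝ) => f ((p.2 : ℝ) • (p.1 : R5)))
  have h3 : ∫ x, f x = ∫ x : ({0}ᶜ : Set R5), f x ∂(Measure.comap Subtype.val volume) := by
    rw [integral_subtype_comap (measurableSet_singleton _).compl f, restrict_compl_singleton]
  rw [← h2, h3]
  apply integral_congr_ae
  refine .of_forall fun x => ?_
  exact congrArg f (congrArg Subtype.val ((homeomorphUnitSphereProd R5).symm_apply_apply x))

lemma integral_polar {f : R5 → ℝ} (hf : Integrable f) :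
    ∫ x, f x = ∫ θ, (∫ r in Ioi (0 : ℝ), r ^ 4 * f (r • (θ : R5))) ∂sphMeasure := by
  rw [← integral_polar_prod, integral_prod _ (integrable_polar_iff.2 hf)]
  congr 1
  ext θ
  exact integral_volumeIoiPow (fun r => f (r • (θ : R5)))

lemma integrable_polar_ae {f : R5 → ℝ} (hf : Integrable f) :
    ∀ᵐ θ : sphere (0 : R5) 1 ∂sphMeasure, IntegrableOn (fun r : ℝ => r ^ 4 * f (r • (θ : R5))) (Ioi 0) := by
  filter_upwards [(integrable_polar_iff.2 hf).prod_right_ae] with θ h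
  exact integrable_volumeIoiPow_iff.1 h

lemma integral_polar' {f : R5 → ℝ} (hf : Integrable f) :
    ∫ x, f x = ∫ r in Ioi (0 : ℝ), r ^ 4 * ∫ θ, f (r • (θ : R5)) ∂sphMeasure := by
  rw [← integral_polar_prod, integral_prod_symm _ (integrable_polar_iff.2 hf)]
  exact integral_volumeIoiPow (fun r => ∫ θ, f (r • (θ : R5)) ∂sphMeasure)

lemma integrable_polar' {f : R5 → ℝ} (hf : Integrable f) :
    IntegrableOn (fun r : ℝ => r ^ 4 * ∫ θ, f (r • (θ : R5)) ∂sphMeasure) (Ioi 0) :=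
  (integrable_volumeIoiPow_iff (g := fun r => ∫ θ, f (r • (θ : R5)) ∂sphMeasure)).1
    (integrable_polar_iff.2 hf).integral_prod_right

lemma ae_ne_zero : ∀ᵐ y : R5, y ≠ 0 := by
  have := (Set.countable_singleton (0 : R5)).ae_notMem volume
  filter_upwards [this] with y hy using by simpa using hy

/-- Radial integration by parts: the integral of `|y|⁻⁵ (y·∇) Q` is `-|S⁴| Q(0)`. -/
lemma integral_euler {Q Q' : R5 → ℝ}
    (hd : ∀ y : R5, y ≠ 0 → HasDerivAt (fun s : ℝ => Q (s • y)) (Q' y) 1)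
    (hQ : Integrable fun y => (‖y‖ ^ 4)⁻¹ * Q y)
    (hQ' : Integrable fun y => (‖y‖ ^ 5)⁻¹ * Q' y)
    (h0 : ContinuousAt Q 0) :
    ∫ y, (‖y‖ ^ 5)⁻¹ * Q' y = -(sphArea * Q 0) := by
  rw [integral_polar hQ']
  have key : ∀ᵐ θ : sphere (0 : R5) 1 ∂sphMeasure, (∫ r in Ioi (0 : ℝ),
      r ^ 4 * ((‖r • (θ : R5)‖ ^ 5)⁻¹ * Q' (r • (θ : R5)))) = -Q 0 := by
    filter_upwards [integrable_polar_ae hQ, integrable_polar_ae hQ'] with θ h1 h2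
    -- The polar weight `r⁴` against `|y|⁻⁵` leaves `r⁻¹ Q'(rθ)`, which is the derivative of `Q`
    -- along the ray.
    have h3 : ∀ r ∈ Ioi (0 : ℝ), HasDerivAt (fun s : ℝ => Q (s • (θ : R5)))
        (r ^ 4 * ((‖r • (θ : R5)‖ ^ 5)⁻¹ * Q' (r • (θ : R5)))) r := by
      intro r hr
      have hr' : (0 : ℝ) < r := hr
      have hne : r • (θ : R5) ≠ 0 := by
        rw [← norm_ne_zero_iff, norm_smul_sphere hr']; exact hr'.ne'
      have h := hd _ hne
      have h5 : HasDerivAt (fun s : ℝ => s / r) (1 / r) r := (hasDerivAt_id r).div_const r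
      have h6 := HasDerivAt.comp_of_eq r h h5 (div_self hr'.ne').symm
      rw [norm_smul_sphere hr']
      convert! h6 using 1
      · ext s
        simp only [Function.comp, smul_smul]
        congr 2
        field_simp
      · field_simp
    have h1' : IntegrableOn (fun s : ℝ => Q (s • (θ : R5))) (Ioi 0) := by
      refine h1.congr_fun ?_ measurableSet_Ioi
      intro r hr
      have hr' : (0 : ℝ) < r := hr
      simp only [norm_smul_sphere hr']
      field_simp
    -- Along almost every ray both `Q` and its derivative are integrable, so the boundary term at
    -- infinity vanishes and no decay hypothesis on `Q` is needed.
    have hlim := tendsto_zero_of_hasDerivAt_of_integrableOn_Ioi h3 h2 h1'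
    have hc : ContinuousAt (fun s : ℝ => Q (s • (θ : R5))) 0 :=
      ContinuousAt.comp_of_eq h0 (by fun_prop) (by simp)
    rw [integral_Ioi_of_hasDerivAt_of_tendsto hc.continuousWithinAt h3 h2 hlim]
    simp
  rw [integral_congr_ae key]
  simp [sphArea, mul_comm]

/-- An integrable function with an integrable directional derivative away from the origin has
a derivative with vanishing integral. -/
lemma integral_lineDeriv_eq_zero {Q Q' : R5 → ℝ} {v : R5} (hv : v ≠ 0)
    (hd : ∀ y : R5, y ≠ 0 → HasLineDerivAt ℝ Q (Q' y) y v)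
    (hQ : Integrable Q) (hQ' : Integrable Q') : ∫ y, Q' y = 0 := by
  obtain ⟨L, hL⟩ : ∃ L : R5 ≃L[ℝ] ((Fin 4 → ℝ) × ℝ), L v = (0, 1) := by
    have : Module.finrank ℝ ((Fin 4 → ℝ) × ℝ) = Module.finrank ℝ R5 := by simp
    have L₀ : R5 ≃L[ℝ] ((Fin 4 → ℝ) × ℝ) := (ContinuousLinearEquiv.ofFinrankEq this).symm
    obtain ⟨M, hM⟩ : ∃ M : ((Fin 4 → ℝ) × ℝ) ≃L[ℝ] ((Fin 4 → ℝ) × ℝ), M (L₀ v) = (0, 1) := by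
      apply SeparatingDual.exists_continuousLinearEquiv_apply_eq
      · simpa using hv
      · simp
    exact ⟨L₀.trans M, by simp [hM]⟩
  have hLs : L.symm (0, 1) = v := by rw [← hL]; simp
  let ν := Measure.map L (volume : Measure R5)
  have L_emb : MeasurableEmbedding L := L.toHomeomorph.measurableEmbedding
  have hQ1 : Integrable (fun p => Q (L.symm p)) ν := by
    simpa [ν, L_emb.integrable_map_iff, Function.comp_def] using hQ
  have hQ1' : Integrable (fun p => Q' (L.symm p)) ν := by
    simpa [ν, L_emb.integrable_map_iff, Function.comp_def] using hQ'
  have hI : ∫ y, Q' y = ∫ p, Q' (L.symm p) ∂ν := by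
    simp [ν, L_emb.integral_map]
  have : Measure.IsAddHaarMeasure ν := by
    exact L.isAddHaarMeasure_map volume
  have A : ((volume : Measure (Fin 4 → ℝ)).prod (volume : Measure ℝ)) =
      (Measure.addHaarScalarFactor ((volume : Measure (Fin 4 → ℝ)).prod volume) ν) • ν :=
    Measure.isAddLeftInvariant_eq_smul _ _
  have B : ν = (Measure.addHaarScalarFactor ν ((volume : Measure (Fin 4 → ℝ)).prod volume)) •
      ((volume : Measure (Fin 4 → ℝ)).prod volume) := Measure.isAddLeftInvariant_eq_smul _ _
  have hQ2 : Integrable (fun p => Q (L.symm p))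
      ((volume : Measure (Fin 4 → ℝ)).prod volume) := by
    rw [A]; exact hQ1.smul_measure_nnreal
  have hQ2' : Integrable (fun p => Q' (L.symm p))
      ((volume : Measure (Fin 4 → ℝ)).prod volume) := by
    rw [A]; exact hQ1'.smul_measure_nnreal
  have hzero : ∫ p, Q' (L.symm p) ∂((volume : Measure (Fin 4 → ℝ)).prod volume) = 0 := by
    rw [integral_prod _ hQ2']
    -- Among the lines parallel to `v`, only the one over `x = 0` meets the origin, where no
    -- derivative is assumed. It is negligible in Fubini.
    have hne : ∀ᵐ x : Fin 4 → ℝ, x ≠ 0 := by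
      have := (Set.countable_singleton (0 : Fin 4 → ℝ)).ae_notMem volume
      filter_upwards [this] with y hy using by simpa using hy
    have : ∀ᵐ x : Fin 4 → ℝ, ∫ t, Q' (L.symm (x, t)) = 0 := by
      filter_upwards [hQ2.prod_right_ae, hQ2'.prod_right_ae, hne] with x h1 h2 hx
      refine integral_eq_zero_of_hasDerivAt_of_integrable (f := fun t => Q (L.symm (x, t)))
        (fun t => ?_) h2 h1
      have hne' : L.symm (x, t) ≠ 0 := by
        intro h
        have : (x, t) = (0, 0) := by
          have := congrArg L h
          simpa using this
        exact hx (congrArg Prod.fst this)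
      have h3 := hd _ hne'
      have h4 : HasDerivAt (fun s : ℝ => Q (L.symm (x, t) + s • v)) (Q' (L.symm (x, t))) (t - t) := by
        rw [sub_self]; exact h3
      have h5 := h4.comp_sub_const t t
      convert! h5 using 1
      ext s
      rw [← hLs, ← map_smul, ← map_add]
      simp
    rw [integral_congr_ae this]; simp
  rw [hI, B, integral_smul_nnreal_measure, hzero, smul_zero]



/-! ### Lorentz boosts acting on the light cone -/

/-- The `i`-th vector of the standard basis of `ℝ⁵`. -/
noncomputable abbrev basisVec (i : Fin 5) : R5 := EuclideanSpace.single i (1 : ℝ)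

/-- The Lorentz factor `(1 - ℓ²)^{-1/2}`. -/
noncomputable def lorentzFactor (l : ℝ) : ℝ := (Real.sqrt (1 - l ^ 2))⁻¹

/-- The time component of the boost of the null vector `(|y|, y)`. -/
noncomputable def boostTime (l : ℝ) (y : R5) : ℝ := lorentzFactor l * (‖y‖ + l * y 0)

/-- The space component of the boost of the null vector `(|y|, y)`. -/
noncomputable def boostSpace (l : ℝ) (y : R5) : R5 :=
  y + ((lorentzFactor l - 1) * y 0 + lorentzFactor l * l * ‖y‖) • basisVec 0

section Boost

variable {l : ℝ}

lemma one_sub_sq_pos (hl : |l| < 1) : 0 < 1 - l ^ 2 := by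
  have := (sq_lt_one_iff_abs_lt_one l).2 hl
  linarith

lemma lorentzFactor_pos (hl : |l| < 1) : 0 < lorentzFactor l :=
  inv_pos.2 (Real.sqrt_pos.2 (one_sub_sq_pos hl))

lemma lorentzFactor_sq (hl : |l| < 1) : lorentzFactor l ^ 2 * (1 - l ^ 2) = 1 := by
  rw [lorentzFactor, inv_pow, Real.sq_sqrt (one_sub_sq_pos hl).le,
    inv_mul_cancel₀ (one_sub_sq_pos hl).ne']

lemma lorentzFactor_neg (l : ℝ) : lorentzFactor (-l) = lorentzFactor l := by
  simp [lorentzFactor]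

lemma abs_coord_le_norm (y : R5) (i : Fin 5) : |y i| ≤ ‖y‖ := by
  simpa using EuclideanSpace.norm_eq y ▸ Real.abs_le_sqrt (by
    have := Finset.single_le_sum (f := fun j => ‖y j‖ ^ 2) (fun j _ => by positivity)
      (Finset.mem_univ i)
    simpa using this)

lemma norm_sq_add_smul_basisVec (y : R5) (c : ℝ) (i : Fin 5) :
    ‖y + c • basisVec i‖ ^ 2 = ‖y‖ ^ 2 + 2 * c * y i + c ^ 2 := by
  rw [norm_add_sq_real, real_inner_smul_right, EuclideanSpace.inner_single_right, norm_smul]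
  simp
  ring

lemma boostTime_lower (hl : |l| < 1) (y : R5) :
    lorentzFactor l * (1 - |l|) * ‖y‖ ≤ boostTime l y := by
  rw [boostTime, mul_assoc]
  refine mul_le_mul_of_nonneg_left ?_ (lorentzFactor_pos hl).le
  have h : |l * y 0| ≤ |l| * ‖y‖ := by
    rw [abs_mul]; exact mul_le_mul_of_nonneg_left (abs_coord_le_norm y 0) (abs_nonneg l)
  have := neg_abs_le (l * y 0)
  linarith

lemma boostTime_upper (hl : |l| < 1) (y : R5) :
    boostTime l y ≤ lorentzFactor l * 2 * ‖y‖ := by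
  rw [boostTime, mul_assoc]
  refine mul_le_mul_of_nonneg_left ?_ (lorentzFactor_pos hl).le
  have h : |l * y 0| ≤ 1 * ‖y‖ := by
    rw [abs_mul]
    exact mul_le_mul hl.le (abs_coord_le_norm y 0) (abs_nonneg _) zero_le_one
  have := le_abs_self (l * y 0)
  linarith

lemma boostTime_nonneg (hl : |l| < 1) (y : R5) : 0 ≤ boostTime l y :=
  le_trans (mul_nonneg (mul_nonneg (lorentzFactor_pos hl).le (by linarith)) (norm_nonneg _))
    (boostTime_lower hl y)

lemma boostTime_pos (hl : |l| < 1) {y : R5} (hy : y ≠ 0) : 0 < boostTime l y :=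
  lt_of_lt_of_le (mul_pos (mul_pos (lorentzFactor_pos hl) (by linarith)) (norm_pos_iff.2 hy))
    (boostTime_lower hl y)

lemma boostSpace_zero_coord (l : ℝ) (y : R5) :
    boostSpace l y 0 = lorentzFactor l * (y 0 + l * ‖y‖) := by
  simp [boostSpace]; ring

/-- A boost preserves the Minkowski form, so the image of the null vector `(|y|, y)` is null.
Algebraically this is `γ²(1 - ℓ²) = 1`. -/
lemma norm_boostSpace (hl : |l| < 1) (y : R5) : ‖boostSpace l y‖ = boostTime l y := by
  rw [← abs_of_nonneg (norm_nonneg _), ← abs_of_nonneg (boostTime_nonneg hl y),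
    ← sq_eq_sq_iff_abs_eq_abs, boostSpace, norm_sq_add_smul_basisVec, boostTime]
  linear_combination (‖y‖ ^ 2 - y 0 ^ 2) * (-lorentzFactor_sq hl)

lemma boostSpace_neg_boostSpace (hl : |l| < 1) (y : R5) :
    boostSpace (-l) (boostSpace l y) = y := by
  rw [boostSpace, norm_boostSpace hl, boostSpace_zero_coord, lorentzFactor_neg, boostTime,
    boostSpace, add_assoc, ← add_smul]
  convert add_zero y using 2
  convert zero_smul ℝ _ using 2
  linear_combination (y 0) * lorentzFactor_sq hl

/-- The derivative of `boostSpace`. -/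
noncomputable def boostDeriv (l : ℝ) (y : R5) : R5 →L[ℝ] R5 :=
  ContinuousLinearMap.id ℝ R5 + ((lorentzFactor l - 1) • (EuclideanSpace.proj (0 : Fin 5) : R5 →L[ℝ] ℝ) +
    (lorentzFactor l * l * ‖y‖⁻¹) • innerSL ℝ y).smulRight (basisVec 0)

lemma hasFDerivAt_norm {y : R5} (hy : y ≠ 0) :
    HasFDerivAt (fun x : R5 => ‖x‖) (‖y‖⁻¹ • innerSL ℝ y) y := by
  have h := (hasStrictFDerivAt_norm_sq y).hasFDerivAt.sqrt (by positivity)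
  convert! h using 1
  · ext x; simp [Real.sqrt_sq]
  · rw [Real.sqrt_sq (norm_nonneg _)]
    ext x
    simp
    field_simp

lemma hasFDerivAt_boostSpace {y : R5} (hy : y ≠ 0) :
    HasFDerivAt (boostSpace l) (boostDeriv l y) y := by
  have h0 : HasFDerivAt (fun x : R5 => x 0) (EuclideanSpace.proj (0 : Fin 5) : R5 →L[ℝ] ℝ) y :=
    (EuclideanSpace.proj (0 : Fin 5) : R5 →L[ℝ] ℝ).hasFDerivAt
  have h := (hasFDerivAt_id y).add (((h0.const_mul (lorentzFactor l - 1)).add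
    ((hasFDerivAt_norm hy).const_mul (lorentzFactor l * l))).smul_const (basisVec 0))
  convert! h using 1
  rw [boostDeriv, smul_smul]

/-- The differential is the identity plus a rank one map `f ⊗ e₁`, with determinant `1 + f(e₁) = γ(1
+ ℓ y₁/|y|)`. -/
lemma det_boostDeriv {y : R5} (hy : y ≠ 0) : (boostDeriv l y).det = boostTime l y / ‖y‖ := by
  have : ((boostDeriv l y : R5 →L[ℝ] R5) : R5 →ₗ[ℝ] R5) = LinearMap.transvection
      (((lorentzFactor l - 1) • (EuclideanSpace.proj (0 : Fin 5) : R5 →L[ℝ] ℝ) +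
    (lorentzFactor l * l * ‖y‖⁻¹) • innerSL ℝ y : R5 →L[ℝ] ℝ) : R5 →ₗ[ℝ] ℝ) (basisVec 0) := by
    ext x i
    simp [boostDeriv, LinearMap.transvection.apply]
  have hy' : ‖y‖ ≠ 0 := norm_ne_zero_iff.2 hy
  rw [ContinuousLinearMap.det, this, LinearMap.transvection.det]
  simp [EuclideanSpace.inner_single_right, boostTime]
  field_simp
  ring

lemma boostSpace_image (hl : |l| < 1) : boostSpace l '' {0}ᶜ = {0}ᶜ := by
  have key : ∀ {l : ℝ}, |l| < 1 → ∀ y : R5, y ≠ 0 → boostSpace l y ≠ 0 := by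
    intro l hl y hy
    rw [← norm_ne_zero_iff, norm_boostSpace hl]
    exact (boostTime_pos hl hy).ne'
  ext y
  constructor
  · rintro ⟨x, hx, rfl⟩
    exact key hl x hx
  · intro hy
    refine ⟨boostSpace (-l) y, key (by rwa [abs_neg]) y hy, ?_⟩
    have := boostSpace_neg_boostSpace (l := -l) (by rwa [abs_neg]) y
    rwa [neg_neg] at this

lemma boostSpace_injOn (hl : |l| < 1) (s : Set R5) : InjOn (boostSpace l) s := by
  intro x _ y _ h
  rw [← boostSpace_neg_boostSpace hl x, h, boostSpace_neg_boostSpace hl]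

lemma integrable_boost_iff (hl : |l| < 1) {f : R5 → ℝ} :
    Integrable f ↔ Integrable fun y => boostTime l y / ‖y‖ * f (boostSpace l y) := by
  have h := integrableOn_image_iff_integrableOn_abs_det_fderiv_smul (volume : Measure R5)
    (measurableSet_singleton (0 : R5)).compl
    (fun x hx => (hasFDerivAt_boostSpace (l := l) hx).hasFDerivWithinAt)
    (boostSpace_injOn hl _) f
  rw [boostSpace_image hl, IntegrableOn, IntegrableOn, restrict_compl_singleton] at h
  rw [h]
  apply integrable_congr
  filter_upwards [ae_ne_zero] with y hy
  rw [det_boostDeriv hy, abs_of_nonneg (div_nonneg (boostTime_nonneg hl y) (norm_nonneg y)),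
    smul_eq_mul]

/-- This is the Lorentz invariance of the measure `dy/|y|` on the cone. The boost is a bijection of
`ℝ⁵ \ {0}` with inverse the opposite boost, and it is differentiable there. -/
lemma integral_boost (hl : |l| < 1) (f : R5 → ℝ) :
    ∫ y, f y = ∫ y, boostTime l y / ‖y‖ * f (boostSpace l y) := by
  have h := integral_image_eq_integral_abs_det_fderiv_smul (volume : Measure R5)
    (measurableSet_singleton (0 : R5)).compl
    (fun x hx => (hasFDerivAt_boostSpace (l := l) hx).hasFDerivWithinAt)
    (boostSpace_injOn hl _) f
  rw [boostSpace_image hl, restrict_compl_singleton] at h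
  rw [h]
  apply integral_congr_ae
  filter_upwards [ae_ne_zero] with y hy
  rw [det_boostDeriv hy, abs_of_nonneg (div_nonneg (boostTime_nonneg hl y) (norm_nonneg y)),
    smul_eq_mul]

end Boost



/-! ### The Japanese bracket and symbols built from it -/

section Bracket

lemma one_le_bracket (z : R5) : 1 ≤ bracket z := by
  rw [bracket, Real.one_le_sqrt]
  have := sq_nonneg ‖z‖
  linarith

lemma bracket_pos (z : R5) : 0 < bracket z := zero_lt_one.trans_le (one_le_bracket z)

lemma bracket_sq (z : R5) : bracket z ^ 2 = 1 + ‖z‖ ^ 2 := Real.sq_sqrt (by positivity)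

lemma norm_le_bracket (z : R5) : ‖z‖ ≤ bracket z := Real.le_sqrt_of_sq_le (by linarith)

lemma bracket_le (z : R5) : bracket z ≤ 1 + ‖z‖ := sqrt_one_add_norm_sq_le z

lemma one_add_norm_le_bracket (z : R5) : 1 + ‖z‖ ≤ 2 * bracket z := by
  linarith [one_le_bracket z, norm_le_bracket z]

lemma bracket_le_add (z w : R5) : bracket z ≤ bracket w + ‖z - w‖ := by
  rw [bracket]
  refine Real.sqrt_le_iff.2 ⟨add_nonneg (bracket_pos w).le (norm_nonneg _), ?_⟩
  have h : ‖z‖ ≤ ‖w‖ + ‖z - w‖ := norm_le_norm_add_norm_sub' z w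
  have h1 : ‖z‖ ^ 2 ≤ (‖w‖ + ‖z - w‖) ^ 2 := pow_le_pow_left₀ (norm_nonneg _) h 2
  nlinarith [bracket_sq w, norm_le_bracket w, norm_nonneg (z - w)]

lemma contDiff_bracket : ContDiff ℝ ∞ bracket :=
  (contDiff_const.add (contDiff_norm_sq ℝ)).sqrt fun z => by positivity

@[fun_prop]
lemma continuous_bracket : Continuous bracket := contDiff_bracket.continuous

/-- The partial derivative in the `i`-th variable. -/
noncomputable def pd (i : Fin 5) (h : R5 → ℝ) : R5 → ℝ := fun z => fderiv ℝ h z (basisVec i)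

lemma hasFDerivAt_bracket_pow_inv (n : ℕ) (z : R5) :
    HasFDerivAt (fun z => (bracket z ^ n)⁻¹)
      ((-(n : ℝ) * (bracket z ^ (n + 2))⁻¹) • innerSL ℝ z) z := by
  have h0 : HasFDerivAt (fun x : R5 => 1 + ‖x‖ ^ 2) (2 • innerSL ℝ z) z :=
    (hasStrictFDerivAt_norm_sq z).hasFDerivAt.const_add 1
  have h1 := h0.sqrt (by positivity : 1 + ‖z‖ ^ 2 ≠ 0)
  have h2 : HasFDerivAt bracket ((bracket z)⁻¹ • innerSL ℝ z) z := by
    convert! h1 using 1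
    ext x
    simp [bracket]
    ring
  have hb := (bracket_pos z).ne'
  have h3 : HasDerivAt (fun s : ℝ => (s ^ n)⁻¹) (-(n : ℝ) * (bracket z ^ (n + 1))⁻¹)
      (bracket z) := by
    convert! (hasDerivAt_pow n (bracket z)).fun_inv (pow_ne_zero n hb) using 1
    rcases n with _ | n
    · simp
    · simp only [Nat.add_sub_cancel]
      field_simp
      ring
  convert! h3.comp_hasFDerivAt z h2 using 1
  rw [smul_smul]
  congr 1
  field_simp
  ring

/-- The functions generated by the powers of the bracket and the coordinates; a function of
order `n` is `O(⟨z⟩⁻ⁿ)`. -/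
inductive BrSym : ℕ → (R5 → ℝ) → Prop
  | pow (n : ℕ) : BrSym n fun z => (bracket z ^ n)⁻¹
  | coord_mul {n : ℕ} {h : R5 → ℝ} (i : Fin 5) : BrSym (n + 1) h → BrSym n fun z => z i * h z
  | const_mul {n : ℕ} {h : R5 → ℝ} (c : ℝ) : BrSym n h → BrSym n fun z => c * h z
  | add {n : ℕ} {h k : R5 → ℝ} : BrSym n h → BrSym n k → BrSym n fun z => h z + k z

namespace BrSym

variable {n : ℕ} {h : R5 → ℝ}

lemma contDiff (H : BrSym n h) : ContDiff ℝ ∞ h := by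
  induction H with
  | pow n => exact (contDiff_bracket.pow n).inv fun z => pow_ne_zero n (bracket_pos z).ne'
  | coord_mul i _ ih => exact (by fun_prop : ContDiff ℝ ∞ fun z : R5 => z i).mul ih
  | const_mul c _ ih => exact contDiff_const.mul ih
  | add _ _ ih₁ ih₂ => exact ih₁.add ih₂

lemma continuous (H : BrSym n h) : Continuous h := H.contDiff.continuous

lemma differentiable (H : BrSym n h) : Differentiable ℝ h :=
  H.contDiff.differentiable (by simp)

lemma hasFDerivAt (H : BrSym n h) (z : R5) :
    HasFDerivAt h (∑ i, pd i h z • (EuclideanSpace.proj i : R5 →L[ℝ] ℝ)) z := by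
  convert! (H.differentiable z).hasFDerivAt using 1
  refine ContinuousLinearMap.coe_injective
    ((EuclideanSpace.basisFun (Fin 5) ℝ).toBasis.ext fun j => ?_)
  simp [pd, EuclideanSpace.basisFun_apply]

lemma bound (H : BrSym n h) : ∃ C, 0 ≤ C ∧ ∀ z, |h z| ≤ C * (bracket z ^ n)⁻¹ := by
  induction H with
  | pow n =>
    refine ⟨1, zero_le_one, fun z => ?_⟩
    have := bracket_pos z
    rw [one_mul, abs_of_nonneg (by positivity)]
  | @coord_mul n h i _ ih =>
    obtain ⟨C, hC, h⟩ := ih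
    refine ⟨C, hC, fun z => ?_⟩
    have hb := bracket_pos z
    rw [abs_mul]
    calc |z i| * |_| ≤ bracket z * (C * (bracket z ^ (n + 1))⁻¹) :=
          mul_le_mul ((abs_coord_le_norm z i).trans (norm_le_bracket z)) (h z) (abs_nonneg _) hb.le
      _ = C * (bracket z ^ n)⁻¹ := by field_simp; ring
  | const_mul c _ ih =>
    obtain ⟨C, hC, h⟩ := ih
    refine ⟨|c| * C, by positivity, fun z => ?_⟩
    rw [abs_mul, mul_assoc]
    exact mul_le_mul_of_nonneg_left (h z) (abs_nonneg c)
  | add _ _ ih₁ ih₂ =>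
    obtain ⟨C₁, hC₁, h₁⟩ := ih₁
    obtain ⟨C₂, hC₂, h₂⟩ := ih₂
    refine ⟨C₁ + C₂, by positivity, fun z => ?_⟩
    rw [add_mul]
    exact (abs_add_le _ _).trans (add_le_add (h₁ z) (h₂ z))

/-- A derivative either removes a coordinate factor, or lowers a power of the bracket by two while
creating one coordinate. In both cases the order rises by exactly one, so the class is stable under
differentiation. -/
lemma pd (H : BrSym n h) (i : Fin 5) : BrSym (n + 1) (pd i h) := by
  induction H with
  | pow n =>
    convert! (BrSym.pow (n + 2)).coord_mul i |>.const_mul (-(n : ℝ)) using 1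
    ext z
    simp [_root_.pd, (hasFDerivAt_bracket_pow_inv n z).fderiv, EuclideanSpace.inner_single_right]
    ring
  | @coord_mul n h j H ih =>
    have h1 : BrSym (n + 1) fun z => (if j = i then 1 else 0) * h z := H.const_mul _
    convert! h1.add (ih.coord_mul j) using 1
    ext z
    have h0 : HasFDerivAt (fun x : R5 => x j) (EuclideanSpace.proj j : R5 →L[ℝ] ℝ) z :=
      (EuclideanSpace.proj j : R5 →L[ℝ] ℝ).hasFDerivAt
    have h2 : HasFDerivAt (fun z => z j * h z) _ z := h0.mul (H.differentiable z).hasFDerivAt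
    simp [_root_.pd, h2.fderiv, eq_comm (a := j)]
    ring
  | const_mul c H ih =>
    convert! ih.const_mul c using 1
    ext z
    simp [_root_.pd, fderiv_const_mul (H.differentiable z)]
  | add H₁ H₂ ih₁ ih₂ =>
    convert! ih₁.add ih₂ using 1
    ext z
    simp [_root_.pd, fderiv_fun_add (H₁.differentiable z) (H₂.differentiable z)]

end BrSym

end Bracket

/-! ### A weighted convolution estimate -/

section Convolution

/-- Both factors are dominated by the same power of the smaller of `p` and `q`. This replaces a
product centred at two points by a sum of functions each centred at one. -/
lemma rpow_mul_rpow_le_add {p q α β : ℝ} (hp : 0 < p) (hq : 0 < q) (hα : 0 ≤ α) (hβ : 0 ≤ β) :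
    p ^ (-α) * q ^ (-β) ≤ p ^ (-(α + β)) + q ^ (-(α + β)) := by
  have e : -(α + β) = -α + -β := by ring
  rw [e, Real.rpow_add hp, Real.rpow_add hq]
  rcases le_total p q with h | h
  · have : q ^ (-β) ≤ p ^ (-β) := Real.rpow_le_rpow_of_nonpos hp h (by linarith)
    have h1 : p ^ (-α) * q ^ (-β) ≤ p ^ (-α) * p ^ (-β) :=
      mul_le_mul_of_nonneg_left this (by positivity)
    have h2 : 0 ≤ q ^ (-α) * q ^ (-β) := by positivity
    linarith
  · have : p ^ (-α) ≤ q ^ (-α) := Real.rpow_le_rpow_of_nonpos hq h (by linarith)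
    have h1 : p ^ (-α) * q ^ (-β) ≤ q ^ (-α) * q ^ (-β) :=
      mul_le_mul_of_nonneg_right this (by positivity)
    have h2 : 0 ≤ p ^ (-α) * p ^ (-β) := by positivity
    linarith

/-- The integral of a negative power of the norm over a ball. -/
lemma integral_ball_norm_rpow {s : ℝ} (hs : s < 5) : ∃ C, 0 ≤ C ∧ ∀ R : ℝ, 0 < R →
    Integrable (fun y : R5 => if ‖y‖ < R then ‖y‖ ^ (-s) else 0) ∧
    ∫ y : R5, (if ‖y‖ < R then ‖y‖ ^ (-s) else 0) = C * R ^ (5 - s) := by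
  refine ⟨5 * (volume : Measure R5).real (ball 0 1) * (5 - s)⁻¹,
    mul_nonneg (by positivity) (inv_nonneg.2 (by linarith)), fun R hR => ?_⟩
  have hf : ∀ r ∈ Ioi (0 : ℝ), r ^ (5 - 1) • (if r < R then r ^ (-s) else 0) =
      (Iio R).indicator (fun r => r ^ (4 - s)) r := by
    intro r hr
    by_cases h : r < R
    · simp only [h, if_true, indicator, mem_Iio, smul_eq_mul]
      rw [sub_eq_add_neg, Real.rpow_add hr]
      norm_cast
    · simp [h, indicator]
  have hI : IntegrableOn (fun r : ℝ => r ^ (4 - s)) (Ioc 0 R) :=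
    (intervalIntegrable_iff_integrableOn_Ioc_of_le hR.le).1
      (intervalIntegral.intervalIntegrable_rpow' (by linarith))
  have hset : Ioi (0 : ℝ) ∩ Iio R = Ioo 0 R := rfl
  constructor
  · rw [integrable_fun_norm_addHaar (volume : Measure R5)
      (f := fun r => if r < R then r ^ (-s) else 0), finrank_R5,
      integrableOn_congr_fun hf measurableSet_Ioi, IntegrableOn,
      integrable_indicator_iff measurableSet_Iio, IntegrableOn,
      Measure.restrict_restrict measurableSet_Iio, inter_comm, hset]
    exact hI.mono_set Ioo_subset_Ioc_self
  · rw [integral_fun_norm_addHaar (volume : Measure R5)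
      (fun r => if r < R then r ^ (-s) else 0), finrank_R5,
      setIntegral_congr_fun measurableSet_Ioi hf, setIntegral_indicator measurableSet_Iio, hset,
      ← integral_Ioc_eq_integral_Ioo, ← intervalIntegral.integral_of_le hR.le,
      integral_rpow (Or.inl (by linarith))]
    have e : 4 - s + 1 = 5 - s := by ring
    rw [e, Real.zero_rpow (by linarith)]
    simp
    ring

lemma integrable_bracket_rpow {δ : ℝ} (hδ : 0 < δ) :
    Integrable fun y : R5 => (1 + ‖y‖) ^ (-(5 + δ)) :=
  integrable_one_add_norm (by rw [finrank_R5]; push_cast; linarith)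

/-- The integrand of the convolution estimates. -/
noncomputable def convKernel (a b : ℕ) (t : ℝ) (z y : R5) : ℝ :=
  (‖y‖ ^ a)⁻¹ * (t + ‖y‖)⁻¹ * (bracket (z + y) ^ b)⁻¹

lemma convKernel_nonneg (a b : ℕ) {t : ℝ} (ht : 0 < t) (z y : R5) : 0 ≤ convKernel a b t z y := by
  have := bracket_pos (z + y)
  unfold convKernel; positivity

lemma measurable_convKernel (a b : ℕ) (t : ℝ) (z : R5) : Measurable (convKernel a b t z) := by
  unfold convKernel
  have := continuous_bracket.measurable
  fun_prop

/-- Here `|y|` is at least comparable to `⟨z⟩`, so `a + b - 5 - δ` powers of `|y|⁻¹` are traded for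
`⟨z⟩⁻¹`. The total remaining weight is `5 + δ`, just enough to be integrable on `ℝ⁵`; `b ≤ 5` keeps
the exponent left on `|y|` nonnegative. -/
lemma convKernel_le_far {a b : ℕ} (hb : b ≤ 5) (hab : 7 ≤ a + b) {δ : ℝ}
    (hδ : 0 < δ) (hδ' : δ < 1) {t : ℝ} (ht : 1 ≤ t) {z y : R5} (hy : bracket z / 2 ≤ ‖y‖) :
    convKernel a b t z y ≤ (t + bracket z)⁻¹ * bracket z ^ (5 - a - b + δ : ℝ) *
      (2 * 2 ^ (a + b - 5 - δ : ℝ) * 3 ^ (5 + δ) *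
      ((1 + ‖y‖) ^ (-(5 + δ)) + (1 + ‖z + y‖) ^ (-(5 + δ)))) := by
  set X := bracket z with hX
  set p := ‖y‖ with hp
  set q := bracket (z + y) with hq
  have hX1 : 1 ≤ X := one_le_bracket z
  have hq1 : 1 ≤ q := one_le_bracket _
  have hp1 : 1 / 2 ≤ p := by linarith
  have hp0 : 0 < p := by linarith
  have hq0 : 0 < q := by linarith
  have hb' : (b : ℝ) ≤ 5 := by exact_mod_cast hb
  have hab' : (7 : ℝ) ≤ a + b := by exact_mod_cast hab
  have h1 : (t + p)⁻¹ ≤ 2 * (t + X)⁻¹ := by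
    rw [← one_div, ← div_eq_mul_inv, div_le_div_iff₀ (by linarith) (by linarith)]
    linarith
  have h2 : (p ^ a)⁻¹ * (q ^ b)⁻¹ =
      p ^ (-(a + b - 5 - δ : ℝ)) * (p ^ (-(5 + δ - b : ℝ)) * q ^ (-(b : ℝ))) := by
    rw [← mul_assoc, ← Real.rpow_add hp0, Real.rpow_neg hq0.le, Real.rpow_natCast,
      ← Real.rpow_natCast p a, ← Real.rpow_neg hp0.le]
    congr 2
    ring
  have h3 : p ^ (-(a + b - 5 - δ : ℝ)) ≤ 2 ^ (a + b - 5 - δ : ℝ) * X ^ (5 - a - b + δ : ℝ) := by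
    calc p ^ (-(a + b - 5 - δ : ℝ)) ≤ (X / 2) ^ (-(a + b - 5 - δ : ℝ)) :=
          Real.rpow_le_rpow_of_nonpos (by linarith) hy (by linarith)
      _ = 2 ^ (a + b - 5 - δ : ℝ) * X ^ (5 - a - b + δ : ℝ) := by
          rw [Real.div_rpow (by linarith) (by norm_num), Real.rpow_neg (by norm_num : (0:ℝ) ≤ 2),
            div_inv_eq_mul, mul_comm]
          congr 2
          ring
  have h4 : p ^ (-(5 + δ - b : ℝ)) * q ^ (-(b : ℝ)) ≤
      3 ^ (5 + δ) * ((1 + p) ^ (-(5 + δ)) + (1 + ‖z + y‖) ^ (-(5 + δ))) := by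
    have := rpow_mul_rpow_le_add hp0 hq0 (α := 5 + δ - b) (β := b) (by linarith) (by positivity)
    have e : -(5 + δ - (b : ℝ) + b) = -(5 + δ) := by ring
    rw [e] at this
    have aux : ∀ u v : ℝ, 0 < v → v / 3 ≤ u → u ^ (-(5 + δ)) ≤ 3 ^ (5 + δ) * v ^ (-(5 + δ)) := by
      intro u v hv huv
      calc u ^ (-(5 + δ)) ≤ (v / 3) ^ (-(5 + δ)) :=
            Real.rpow_le_rpow_of_nonpos (by linarith) huv (by linarith)
        _ = _ := by
            rw [Real.div_rpow hv.le (by norm_num), Real.rpow_neg (by norm_num : (0:ℝ) ≤ 3),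
              div_inv_eq_mul, mul_comm]
    have h5 := aux p (1 + p) (by linarith) (by linarith)
    have h6 := aux q (1 + ‖z + y‖) (by positivity) (by
      linarith [one_add_norm_le_bracket (z + y), norm_nonneg (z + y)])
    linarith
  calc convKernel a b t z y = (t + p)⁻¹ * ((p ^ a)⁻¹ * (q ^ b)⁻¹) := by
        rw [convKernel]; ring
    _ ≤ (2 * (t + X)⁻¹) * ((2 ^ (a + b - 5 - δ : ℝ) * X ^ (5 - a - b + δ : ℝ)) *
        (3 ^ (5 + δ) * ((1 + p) ^ (-(5 + δ)) + (1 + ‖z + y‖) ^ (-(5 + δ))))) := by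
        rw [h2]
        refine mul_le_mul h1 (mul_le_mul h3 h4 (by positivity) (by positivity)) (by positivity) ?_
        have : 0 < t + X := by linarith
        positivity
    _ = _ := by ring

/-- Here `⟨z + y⟩ ≥ ⟨z⟩/2`. Extracting `(t + ⟨z⟩)⁻¹` from `(t + |y|)⁻¹` costs a factor `1 + ⟨z⟩
|y|^{-(1-δ)}`; giving up `δ` keeps `|y|^{-(a+1-δ)}` locally integrable even for `a = 4`. -/
lemma convKernel_le_near {a b : ℕ} {δ : ℝ}
    (hδ : 0 < δ) (hδ' : δ < 1) {t : ℝ} (ht : 1 ≤ t) {z y : R5} (hy0 : y ≠ 0)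
    (hy : ‖y‖ < bracket z / 2) :
    convKernel a b t z y ≤ (t + bracket z)⁻¹ * (2 ^ b * (bracket z ^ b)⁻¹ *
      (‖y‖ ^ (-(a : ℝ)) + bracket z * ‖y‖ ^ (-(a + 1 - δ : ℝ)))) := by
  set X := bracket z with hX
  set p := ‖y‖ with hp
  set q := bracket (z + y) with hq
  have hX1 : 1 ≤ X := one_le_bracket z
  have hq1 : 1 ≤ q := one_le_bracket _
  have hp0 : 0 < p := norm_pos_iff.2 hy0
  have hqX : X / 2 ≤ q := by
    have := bracket_le_add z (z + y)
    rw [sub_add_cancel_left, norm_neg] at this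
    linarith
  have h1 : (q ^ b)⁻¹ ≤ 2 ^ b * (X ^ b)⁻¹ := by
    calc (q ^ b)⁻¹ ≤ ((X / 2) ^ b)⁻¹ := by gcongr
      _ = _ := by rw [div_pow, inv_div, div_eq_mul_inv]
  -- For `p ≤ 1` the bound comes from `t ≥ 1`, for `p ≥ 1` from the exponent being less than one.
  have h2 : p ^ (1 - δ) ≤ t + p := by
    rcases le_total p 1 with h | h
    · have := Real.rpow_le_one hp0.le h (by linarith : 0 ≤ 1 - δ)
      linarith
    · have := Real.rpow_le_rpow_of_exponent_le h (by linarith : 1 - δ ≤ 1)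
      rw [Real.rpow_one] at this
      linarith
  have h3 : (t + p)⁻¹ ≤ (t + X)⁻¹ * (1 + X * p ^ (-(1 - δ))) := by
    rw [Real.rpow_neg hp0.le]
    have h5 : 0 < p ^ (1 - δ) := by positivity
    rw [← div_eq_inv_mul, ← one_div, div_le_div_iff₀ (by linarith) (by linarith)]
    have : X ≤ X * (p ^ (1 - δ))⁻¹ * (t + p) := by
      rw [mul_assoc]
      refine le_mul_of_one_le_right (by linarith) ?_
      rw [← div_eq_inv_mul, one_le_div h5]
      exact h2
    nlinarith
  calc convKernel a b t z y = (p ^ a)⁻¹ * (t + p)⁻¹ * (q ^ b)⁻¹ := rfl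
    _ ≤ (p ^ a)⁻¹ * ((t + X)⁻¹ * (1 + X * p ^ (-(1 - δ)))) * (2 ^ b * (X ^ b)⁻¹) := by
        have : 0 < t + X := by linarith
        gcongr
    _ = _ := by
        have e : -((a : ℝ) + 1 - δ) = -a + -(1 - δ) := by ring
        rw [e, Real.rpow_add hp0, Real.rpow_neg hp0.le (a : ℝ), Real.rpow_natCast]
        ring

/-- The convolution estimate. -/
lemma integral_convKernel_le {a b : ℕ} (ha : a ≤ 4) (hb : b ≤ 5) (hab : 7 ≤ a + b) {δ : ℝ}
    (hδ : 0 < δ) (hδ' : δ < 1) : ∃ C, 0 ≤ C ∧ ∀ t : ℝ, 1 ≤ t → ∀ z : R5,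
    Integrable (convKernel a b t z) ∧
    ∫ y, convKernel a b t z y ≤ C * ((t + bracket z)⁻¹ * bracket z ^ (5 - a - b + δ : ℝ)) := by
  have ha' : (a : ℝ) ≤ 4 := by exact_mod_cast ha
  obtain ⟨C₁, hC₁, H₁⟩ := integral_ball_norm_rpow (s := (a : ℝ)) (by linarith)
  obtain ⟨C₂, hC₂, H₂⟩ := integral_ball_norm_rpow (s := (a + 1 - δ : ℝ)) (by linarith)
  set G : R5 → ℝ := fun y => (1 + ‖y‖) ^ (-(5 + δ)) with hG
  have hGi : Integrable G := integrable_bracket_rpow hδ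
  have hG0 : ∀ y, 0 ≤ G y := fun y => by positivity
  set K : ℝ := 2 * 2 ^ (a + b - 5 - δ : ℝ) * 3 ^ (5 + δ) with hK
  have hK0 : 0 ≤ K := by positivity
  refine ⟨K * (2 * ∫ y, G y) + 2 ^ b * (C₁ + C₂), by
    have : 0 ≤ ∫ y, G y := integral_nonneg hG0
    positivity, fun t ht z => ?_⟩
  set X := bracket z with hX
  have hX1 : 1 ≤ X := one_le_bracket z
  have hX0 : 0 < X := by linarith
  have htX : 0 < t + X := by linarith
  set n₁ : R5 → ℝ := fun y => if ‖y‖ < X then ‖y‖ ^ (-(a : ℝ)) else 0 with hn₁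
  set n₂ : R5 → ℝ := fun y => if ‖y‖ < X then ‖y‖ ^ (-(a + 1 - δ : ℝ)) else 0 with hn₂
  have hn₁0 : ∀ y, 0 ≤ n₁ y := fun y => by
    simp only [hn₁]; split_ifs <;> positivity
  have hn₂0 : ∀ y, 0 ≤ n₂ y := fun y => by
    simp only [hn₂]; split_ifs <;> positivity
  obtain ⟨i₁, e₁⟩ := H₁ X hX0
  obtain ⟨i₂, e₂⟩ := H₂ X hX0
  have hGz : Integrable fun y => G (z + y) := hGi.comp_add_left z
  set D : R5 → ℝ := fun y => (t + X)⁻¹ * X ^ (5 - a - b + δ : ℝ) * (K * (G y + G (z + y))) +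
    (t + X)⁻¹ * (2 ^ b * (X ^ b)⁻¹ * (n₁ y + X * n₂ y)) with hD
  have j₁ : Integrable fun y => (t + X)⁻¹ * X ^ (5 - a - b + δ : ℝ) * (K * (G y + G (z + y))) :=
    ((hGi.add hGz).const_mul K).const_mul _
  have j₂ : Integrable fun y => (t + X)⁻¹ * (2 ^ b * (X ^ b)⁻¹ * (n₁ y + X * n₂ y)) :=
    ((i₁.add (i₂.const_mul X)).const_mul _).const_mul _
  have hDi : Integrable D := j₁.add j₂
  have hle : ∀ᵐ y, convKernel a b t z y ≤ D y := by
    filter_upwards [ae_ne_zero] with y hy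
    have q1 : 0 ≤ (t + X)⁻¹ * X ^ (5 - a - b + δ : ℝ) * (K * (G y + G (z + y))) := by
      have := hG0 y
      have := hG0 (z + y)
      positivity
    have q2 : 0 ≤ (t + X)⁻¹ * (2 ^ b * (X ^ b)⁻¹ * (n₁ y + X * n₂ y)) := by
      have := hn₁0 y
      have := hn₂0 y
      positivity
    rcases le_or_gt (X / 2) ‖y‖ with h | h
    · have := convKernel_le_far hb hab hδ hδ' ht h
      simp only [hD]
      linarith
    · have := convKernel_le_near (a := a) (b := b) hδ hδ' ht hy h
      have hlt : ‖y‖ < X := by linarith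
      have e1 : n₁ y = ‖y‖ ^ (-(a : ℝ)) := if_pos hlt
      have e2 : n₂ y = ‖y‖ ^ (-(a + 1 - δ : ℝ)) := if_pos hlt
      rw [← e1, ← e2] at this
      simp only [hD]
      linarith
  have hint : Integrable (convKernel a b t z) :=
    hDi.mono' (measurable_convKernel a b t z).aestronglyMeasurable (by
      filter_upwards [hle] with y hy
      rwa [Real.norm_of_nonneg (convKernel_nonneg a b (by linarith) z y)])
  refine ⟨hint, (integral_mono_ae hint hDi hle).trans ?_⟩
  have hIG : ∫ y, G (z + y) = ∫ y, G y := integral_add_left_eq_self G z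
  have hI : ∫ y, D y = (t + X)⁻¹ * X ^ (5 - a - b + δ : ℝ) * (K * (2 * ∫ y, G y)) +
      (t + X)⁻¹ * (2 ^ b * (X ^ b)⁻¹ * (C₁ * X ^ (5 - a : ℝ) +
        X * (C₂ * X ^ (5 - (a + 1 - δ) : ℝ)))) := by
    simp only [hD]
    rw [integral_add j₁ j₂, integral_const_mul,
      integral_const_mul, integral_add hGi hGz, hIG, integral_const_mul, integral_const_mul,
      integral_add i₁ (i₂.const_mul X), integral_const_mul, e₁, e₂, two_mul]
  rw [hI]
  -- The two near contributions: the first is better than needed by a factor `⟨z⟩^{-δ}`, the second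
  -- is exactly of the claimed size.
  have f1 : (X ^ b)⁻¹ * X ^ (5 - a : ℝ) ≤ X ^ (5 - a - b + δ : ℝ) := by
    rw [← Real.rpow_natCast X b, ← Real.rpow_neg hX0.le, ← Real.rpow_add hX0]
    exact Real.rpow_le_rpow_of_exponent_le hX1 (by linarith)
  have f2 : (X ^ b)⁻¹ * (X * X ^ (5 - (a + 1 - δ) : ℝ)) = X ^ (5 - a - b + δ : ℝ) := by
    rw [← Real.rpow_natCast X b, ← Real.rpow_neg hX0.le]
    nth_rewrite 2 [← Real.rpow_one X]
    rw [← Real.rpow_add hX0, ← Real.rpow_add hX0]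
    congr 1
    ring
  have hm := mul_le_mul_of_nonneg_left f1 hC₁
  calc _ = (t + X)⁻¹ * (X ^ (5 - a - b + δ : ℝ) * (K * (2 * ∫ y, G y)) +
      2 ^ b * (C₁ * ((X ^ b)⁻¹ * X ^ (5 - a : ℝ)) +
        C₂ * ((X ^ b)⁻¹ * (X * X ^ (5 - (a + 1 - δ) : ℝ))))) := by ring
    _ ≤ (t + X)⁻¹ * (X ^ (5 - a - b + δ : ℝ) * (K * (2 * ∫ y, G y)) +
      2 ^ b * (C₁ * X ^ (5 - a - b + δ : ℝ) + C₂ * X ^ (5 - a - b + δ : ℝ))) := by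
        rw [f2]; gcongr
    _ = _ := by ring

/-- The quantitative estimate is stated for `t ≥ 1`; this comparison transfers integrability to
every positive time. -/
lemma convKernel_le_one {a b : ℕ} {t : ℝ} (ht : 0 < t) (z y : R5) :
    convKernel a b t z y ≤ (1 + t⁻¹) * convKernel a b 1 z y := by
  have hb := bracket_pos (z + y)
  have h : (t + ‖y‖)⁻¹ ≤ (1 + t⁻¹) * (1 + ‖y‖)⁻¹ := by
    rw [← div_eq_mul_inv, ← one_div, div_le_div_iff₀ (by positivity) (by positivity)]
    have : (1 + t⁻¹) * (t + ‖y‖) = t + ‖y‖ + 1 + t⁻¹ * ‖y‖ := by field_simp; ring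
    have h2 : 0 ≤ t⁻¹ * ‖y‖ := by positivity
    rw [this]; linarith
  calc convKernel a b t z y = (‖y‖ ^ a)⁻¹ * (t + ‖y‖)⁻¹ * (bracket (z + y) ^ b)⁻¹ := rfl
    _ ≤ (‖y‖ ^ a)⁻¹ * ((1 + t⁻¹) * (1 + ‖y‖)⁻¹) * (bracket (z + y) ^ b)⁻¹ := by gcongr
    _ = _ := by rw [convKernel]; ring

lemma convKernel_anti {a b c : ℕ} (hbc : b ≤ c) {t : ℝ} (ht : 0 < t) (z y : R5) :
    convKernel a c t z y ≤ convKernel a b t z y := by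
  have hb := bracket_pos (z + y)
  unfold convKernel
  gcongr
  exact one_le_bracket _

lemma integrable_convKernel {a b : ℕ} (ha : 3 ≤ a) (ha' : a ≤ 4) (hab : 7 ≤ a + b) {t : ℝ}
    (ht : 0 < t) (z : R5) : Integrable (convKernel a b t z) := by
  -- The estimate needs an exponent at most `5`. Truncating `b` there is harmless because the
  -- bracket is at least one, and `3 ≤ a` keeps `a + min b 5 ≥ 7`.
  obtain ⟨C, -, H⟩ := integral_convKernel_le (a := a) (b := min b 5) (δ := 1 / 2) ha'
    (min_le_right _ _) (by omega) (by norm_num) (by norm_num)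
  refine ((H 1 le_rfl z).1.const_mul (1 + t⁻¹)).mono'
    (measurable_convKernel a b t z).aestronglyMeasurable (.of_forall fun y => ?_)
  rw [Real.norm_of_nonneg (convKernel_nonneg a b ht z y)]
  exact (convKernel_anti (min_le_left b 5) ht z y).trans (convKernel_le_one ht z y)

end Convolution



/-! ### The boosted Duhamel kernel and its derivatives -/

/-- The retarded time `t + γ(|y| + ℓ y₁)` in boosted coordinates. -/
noncomputable def phase (l t : ℝ) (y : R5) : ℝ := t + boostTime l y

/-- The building blocks `|y|⁻ᵖ a⁻ⁿ` of the kernels, with `a` the retarded time. -/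
noncomputable def blockKer (l : ℝ) (p n : ℕ) (t : ℝ) (y : R5) : ℝ :=
  (‖y‖ ^ p)⁻¹ * (phase l t y ^ n)⁻¹

/-- The kernel of the Duhamel operator applied to `t⁻ᵏ h(x_ℓ)`. -/
noncomputable def boostKer (l : ℝ) (k : ℕ) (t : ℝ) (y : R5) : ℝ :=
  blockKer l 3 k t y + k * lorentzFactor l * blockKer l 2 (k + 1) t y

/-- The space derivative of `blockKer`. -/
noncomputable def blockDeriv (l : ℝ) (p n : ℕ) (t : ℝ) (y : R5) : R5 →L[ℝ] ℝ :=
  (-(p : ℝ) * blockKer l (p + 2) n t y -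
    n * lorentzFactor l * blockKer l (p + 1) (n + 1) t y) • innerSL ℝ y -
  (n * lorentzFactor l * l * blockKer l p (n + 1) t y) •
    (EuclideanSpace.proj (0 : Fin 5) : R5 →L[ℝ] ℝ)

/-- The space derivative of `boostKer`. -/
noncomputable def boostKerDeriv (l : ℝ) (k : ℕ) (t : ℝ) (y : R5) : R5 →L[ℝ] ℝ :=
  blockDeriv l 3 k t y + (k * lorentzFactor l) • blockDeriv l 2 (k + 1) t y

/-- The boosted Duhamel operator. -/
noncomputable def boostInt (l : ℝ) (k : ℕ) (h : R5 → ℝ) (t : ℝ) (z : R5) : ℝ :=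
  ∫ y, boostKer l k t y * h (z + y)

section Kernel

variable {l : ℝ}

lemma phase_pos (hl : |l| < 1) {t : ℝ} (ht : 0 < t) (y : R5) : 0 < phase l t y :=
  add_pos_of_pos_of_nonneg ht (boostTime_nonneg hl y)

lemma phase_lower (hl : |l| < 1) : ∃ c, 0 < c ∧ ∀ t, 0 ≤ t → ∀ y, c * (t + ‖y‖) ≤ phase l t y := by
  have h0 : 0 < lorentzFactor l * (1 - |l|) := mul_pos (lorentzFactor_pos hl) (by linarith)
  refine ⟨min 1 (lorentzFactor l * (1 - |l|)), lt_min one_pos h0, fun t ht y => ?_⟩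
  rw [mul_add, phase]
  refine add_le_add ?_ (le_trans ?_ (boostTime_lower hl y))
  · simpa using mul_le_mul_of_nonneg_right (min_le_left 1 (lorentzFactor l * (1 - |l|))) ht
  · exact mul_le_mul_of_nonneg_right (min_le_right _ _) (norm_nonneg _)

lemma blockKer_nonneg (hl : |l| < 1) (p n : ℕ) {t : ℝ} (ht : 0 < t) (y : R5) :
    0 ≤ blockKer l p n t y := by
  have := phase_pos hl ht y
  unfold blockKer; positivity

lemma measurable_phase (l t : ℝ) : Measurable (phase l t) := by
  unfold phase boostTime; fun_prop

lemma measurable_blockKer (l : ℝ) (p n : ℕ) (t : ℝ) : Measurable (blockKer l p n t) := by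
  have := measurable_phase l t
  unfold blockKer; fun_prop

lemma measurable_boostKer (l : ℝ) (k : ℕ) (t : ℝ) : Measurable (boostKer l k t) := by
  have h1 := measurable_blockKer l 3 k t
  have h2 := measurable_blockKer l 2 (k + 1) t
  unfold boostKer; fun_prop

/-- The `n` powers of the retarded time, which dominates `t + |y|`, are distributed freely: `m` to
decay in time, `j` to the singularity in `|y|`, and one kept as `(t + |y|)⁻¹` for the convolution
estimate. -/
lemma blockKer_le (hl : |l| < 1) (n : ℕ) : ∃ C, 0 ≤ C ∧ ∀ p m j : ℕ, n = m + j + 1 →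
    ∀ t, 0 < t → ∀ y : R5, y ≠ 0 →
    blockKer l p n t y ≤ C * ((t ^ m)⁻¹ * ((‖y‖ ^ (p + j))⁻¹ * (t + ‖y‖)⁻¹)) := by
  obtain ⟨c, hc, H⟩ := phase_lower hl
  refine ⟨(c ^ n)⁻¹, by positivity, fun p m j hn t ht y hy => ?_⟩
  have hy0 : 0 < ‖y‖ := norm_pos_iff.2 hy
  have h1 : (phase l t y ^ n)⁻¹ ≤ (c ^ n)⁻¹ * ((t + ‖y‖) ^ n)⁻¹ := by
    rw [← mul_inv, ← mul_pow]
    have := H t ht.le y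
    gcongr
  have h2 : ((t + ‖y‖) ^ n)⁻¹ ≤ (t ^ m)⁻¹ * ((‖y‖ ^ j)⁻¹ * (t + ‖y‖)⁻¹) := by
    rw [hn, pow_succ, pow_add, mul_inv, mul_inv, mul_assoc]
    gcongr
    · linarith
    · linarith
  calc blockKer l p n t y = (‖y‖ ^ p)⁻¹ * (phase l t y ^ n)⁻¹ := rfl
    _ ≤ (‖y‖ ^ p)⁻¹ * ((c ^ n)⁻¹ * ((t ^ m)⁻¹ * ((‖y‖ ^ j)⁻¹ * (t + ‖y‖)⁻¹))) := by
        gcongr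
        exact h1.trans (by gcongr)
    _ = _ := by rw [pow_add, mul_inv]; ring

/-- Size of the kernel. -/
lemma abs_boostKer_le (hl : |l| < 1) (k : ℕ) : ∃ C, 0 ≤ C ∧ ∀ m j : ℕ, k = m + j + 1 →
    ∀ t, 0 < t → ∀ y : R5, y ≠ 0 →
    |boostKer l k t y| ≤ C * ((t ^ m)⁻¹ * ((‖y‖ ^ (3 + j))⁻¹ * (t + ‖y‖)⁻¹)) := by
  obtain ⟨C₁, hC₁, H₁⟩ := blockKer_le hl k
  obtain ⟨C₂, hC₂, H₂⟩ := blockKer_le hl (k + 1)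
  have hγ := lorentzFactor_pos hl
  refine ⟨C₁ + k * lorentzFactor l * C₂, by positivity, fun m j hk t ht y hy => ?_⟩
  have h1 := H₁ 3 m j hk t ht y hy
  have h2 := H₂ 2 m (j + 1) (by omega) t ht y hy
  have e : 2 + (j + 1) = 3 + j := by ring
  rw [e] at h2
  have n1 := blockKer_nonneg hl 3 k ht y
  have n2 := blockKer_nonneg hl 2 (k + 1) ht y
  rw [boostKer, abs_of_nonneg (by positivity), add_mul, mul_assoc (k * lorentzFactor l)]
  exact add_le_add h1 (mul_le_mul_of_nonneg_left h2 (by positivity))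

lemma hasDerivAt_blockKer (hl : |l| < 1) (p n : ℕ) {t : ℝ} (ht : 0 < t) (y : R5) :
    HasDerivAt (fun t => blockKer l p n t y) (-(n : ℝ) * blockKer l p (n + 1) t y) t := by
  have h0 := (phase_pos hl ht y).ne'
  have h1 : HasDerivAt (fun t => phase l t y) 1 t := (hasDerivAt_id t).add_const _
  have h2 := ((h1.pow n).fun_inv (pow_ne_zero n h0)).const_mul ((‖y‖ ^ p)⁻¹)
  convert! h2 using 1
  unfold blockKer
  rcases n with _ | n
  · simp
  · simp only [Nat.add_sub_cancel]
    simp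
    field_simp
    ring

/-- The retarded time has unit derivative in `t`, so differentiating in time moves along the family
of kernels. This is what makes iterating `A_ℓ` trivial. -/
lemma hasDerivAt_boostKer (hl : |l| < 1) (k : ℕ) {t : ℝ} (ht : 0 < t) (y : R5) :
    HasDerivAt (fun t => boostKer l k t y) (-(k : ℝ) * boostKer l (k + 1) t y) t := by
  have h := (hasDerivAt_blockKer hl 3 k ht y).add
    ((hasDerivAt_blockKer hl 2 (k + 1) ht y).const_mul (k * lorentzFactor l))
  convert! h using 1
  unfold boostKer
  push_cast
  ring

lemma hasFDerivAt_boostTime {y : R5} (hy : y ≠ 0) :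
    HasFDerivAt (boostTime l) ((lorentzFactor l * ‖y‖⁻¹) • innerSL ℝ y +
      (lorentzFactor l * l) • (EuclideanSpace.proj (0 : Fin 5) : R5 →L[ℝ] ℝ)) y := by
  have h0 : HasFDerivAt (fun x : R5 => x 0) (EuclideanSpace.proj (0 : Fin 5) : R5 →L[ℝ] ℝ) y :=
    (EuclideanSpace.proj (0 : Fin 5) : R5 →L[ℝ] ℝ).hasFDerivAt
  have h := ((hasFDerivAt_norm hy).add (h0.const_mul l)).const_mul (lorentzFactor l)
  convert! h using 1
  rw [smul_add, smul_smul, smul_smul]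

lemma hasFDerivAt_blockKer (hl : |l| < 1) (p n : ℕ) {t : ℝ} (ht : 0 < t) {y : R5} (hy : y ≠ 0) :
    HasFDerivAt (blockKer l p n t) (blockDeriv l p n t y) y := by
  have hy' : ‖y‖ ≠ 0 := norm_ne_zero_iff.2 hy
  have h0 := (phase_pos hl ht y).ne'
  have hinv : ∀ (q : ℕ) (s : ℝ), s ≠ 0 →
      HasDerivAt (fun s : ℝ => (s ^ q)⁻¹) (-(q : ℝ) * (s ^ (q + 1))⁻¹) s := by
    intro q s hs
    convert! (hasDerivAt_pow q s).fun_inv (pow_ne_zero q hs) using 1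
    rcases q with _ | q
    · simp
    · simp only [Nat.add_sub_cancel]
      field_simp
      ring
  have h1 := (hinv p _ hy').comp_hasFDerivAt y (hasFDerivAt_norm hy)
  have hph : HasFDerivAt (phase l t) _ y := (hasFDerivAt_boostTime (l := l) hy).const_add t
  have h2 := (hinv n _ h0).comp_hasFDerivAt y hph
  have h3 := h1.mul h2
  convert! h3 using 1
  ext x
  simp [blockDeriv, blockKer]
  field_simp
  ring

lemma hasFDerivAt_boostKer (hl : |l| < 1) (k : ℕ) {t : ℝ} (ht : 0 < t) {y : R5} (hy : y ≠ 0) :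
    HasFDerivAt (boostKer l k t) (boostKerDeriv l k t y) y := by
  exact (hasFDerivAt_blockKer hl 3 k ht hy).add
    ((hasFDerivAt_blockKer hl 2 (k + 1) ht hy).const_mul (k * lorentzFactor l))

lemma blockDeriv_basisVec (p n : ℕ) (t : ℝ) (y : R5) (i : Fin 5) :
    blockDeriv l p n t y (basisVec i) = -(p : ℝ) * (y i * blockKer l (p + 2) n t y) -
      n * lorentzFactor l * (y i * blockKer l (p + 1) (n + 1) t y) -
      n * lorentzFactor l * l * (if i = 0 then 1 else 0) * blockKer l p (n + 1) t y := by
  simp [blockDeriv, EuclideanSpace.inner_single_right, eq_comm (a := (0 : Fin 5))]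
  ring

lemma abs_coord_mul_blockKer_le (hl : |l| < 1) (p n : ℕ) {t : ℝ} (ht : 0 < t) (y : R5)
    (i : Fin 5) : |y i * blockKer l (p + 1) n t y| ≤ blockKer l p n t y := by
  rw [abs_mul, abs_of_nonneg (blockKer_nonneg hl (p + 1) n ht y)]
  have h := phase_pos hl ht y
  refine (mul_le_mul_of_nonneg_right (abs_coord_le_norm y i)
    (blockKer_nonneg hl (p + 1) n ht y)).trans ?_
  unfold blockKer
  rw [← mul_assoc]
  gcongr
  rcases eq_or_ne ‖y‖ 0 with h0 | h0
  · rw [h0]; simp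
  · rw [pow_succ]; field_simp; rfl

lemma abs_blockDeriv_le (hl : |l| < 1) (p n : ℕ) : ∃ C, 0 ≤ C ∧ ∀ m j : ℕ, n = m + j + 1 →
    ∀ t, 0 < t → ∀ y : R5, y ≠ 0 → ∀ i : Fin 5,
    |blockDeriv l p n t y (basisVec i)| ≤
      C * ((t ^ m)⁻¹ * ((‖y‖ ^ (p + j + 1))⁻¹ * (t + ‖y‖)⁻¹)) := by
  obtain ⟨C₁, hC₁, H₁⟩ := blockKer_le hl n
  obtain ⟨C₂, hC₂, H₂⟩ := blockKer_le hl (n + 1)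
  have hγ := lorentzFactor_pos hl
  refine ⟨p * C₁ + n * lorentzFactor l * C₂ + n * lorentzFactor l * C₂, by positivity,
    fun m j hn t ht y hy i => ?_⟩
  have h1 := H₁ (p + 1) m j hn t ht y hy
  have h2 := H₂ p m (j + 1) (by omega) t ht y hy
  have e1 : p + 1 + j = p + j + 1 := by ring
  rw [e1] at h1
  rw [← add_assoc] at h2
  have a1 := abs_coord_mul_blockKer_le hl (p + 1) n ht y i
  have a2 := abs_coord_mul_blockKer_le hl p (n + 1) ht y i
  have n2 := blockKer_nonneg hl p (n + 1) ht y
  have b1 : |-(p : ℝ) * (y i * blockKer l (p + 2) n t y)| ≤ p * blockKer l (p + 1) n t y := by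
    rw [abs_mul, abs_neg, abs_of_nonneg (Nat.cast_nonneg p)]
    gcongr
  have b2 : |n * lorentzFactor l * (y i * blockKer l (p + 1) (n + 1) t y)| ≤
      n * lorentzFactor l * blockKer l p (n + 1) t y := by
    rw [abs_mul, abs_of_nonneg (by positivity : 0 ≤ n * lorentzFactor l)]
    gcongr
  have b3 : |n * lorentzFactor l * l * (if i = 0 then 1 else 0) * blockKer l p (n + 1) t y| ≤
      n * lorentzFactor l * blockKer l p (n + 1) t y := by
    rw [abs_mul, abs_of_nonneg n2]
    gcongr
    rw [mul_assoc, abs_mul, abs_of_nonneg (by positivity : 0 ≤ n * lorentzFactor l)]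
    refine mul_le_of_le_one_right (by positivity) ?_
    split_ifs <;> simp [hl.le]
  rw [blockDeriv_basisVec]
  set R := (t ^ m)⁻¹ * ((‖y‖ ^ (p + j + 1))⁻¹ * (t + ‖y‖)⁻¹)
  have c1 : p * blockKer l (p + 1) n t y ≤ p * (C₁ * R) := by gcongr
  have c2 : n * lorentzFactor l * blockKer l p (n + 1) t y ≤ n * lorentzFactor l * (C₂ * R) := by
    gcongr
  refine (abs_sub _ _).trans ?_
  have := abs_sub (-(p : ℝ) * (y i * blockKer l (p + 2) n t y))
    (n * lorentzFactor l * (y i * blockKer l (p + 1) (n + 1) t y))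
  linarith

/-- Size of the derivative of the kernel. -/
lemma abs_boostKerDeriv_le (hl : |l| < 1) (k : ℕ) : ∃ C, 0 ≤ C ∧ ∀ m j : ℕ, k = m + j + 1 →
    ∀ t, 0 < t → ∀ y : R5, y ≠ 0 → ∀ i : Fin 5,
    |boostKerDeriv l k t y (basisVec i)| ≤
      C * ((t ^ m)⁻¹ * ((‖y‖ ^ (4 + j))⁻¹ * (t + ‖y‖)⁻¹)) := by
  obtain ⟨C₁, hC₁, H₁⟩ := abs_blockDeriv_le hl 3 k
  obtain ⟨C₂, hC₂, H₂⟩ := abs_blockDeriv_le hl 2 (k + 1)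
  have hγ := lorentzFactor_pos hl
  refine ⟨C₁ + k * lorentzFactor l * C₂, by positivity, fun m j hk t ht y hy i => ?_⟩
  have h1 := H₁ m j hk t ht y hy i
  have h2 := H₂ m (j + 1) (by omega) t ht y hy i
  have e1 : 3 + j + 1 = 4 + j := by ring
  have e2 : 2 + (j + 1) + 1 = 4 + j := by ring
  rw [e1] at h1
  rw [e2] at h2
  have e : boostKerDeriv l k t y (basisVec i) = blockDeriv l 3 k t y (basisVec i) +
    k * lorentzFactor l * blockDeriv l 2 (k + 1) t y (basisVec i) := rfl
  rw [e, add_mul, mul_assoc (k * lorentzFactor l)]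
  refine (abs_add_le _ _).trans (add_le_add h1 ?_)
  rw [abs_mul, abs_of_nonneg (by positivity : 0 ≤ k * lorentzFactor l)]
  gcongr

lemma measurable_boostKerDeriv (l : ℝ) (k : ℕ) (t : ℝ) (i : Fin 5) :
    Measurable fun y => boostKerDeriv l k t y (basisVec i) := by
  have e : (fun y => boostKerDeriv l k t y (basisVec i)) = fun y =>
    blockDeriv l 3 k t y (basisVec i) +
      k * lorentzFactor l * blockDeriv l 2 (k + 1) t y (basisVec i) := rfl
  rw [e]
  simp only [blockDeriv_basisVec]
  have h := measurable_blockKer l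
  have h1 := h 5 k t
  have h2 := h 4 (k + 1) t
  have h3 := h 3 (k + 1) t
  have h4 := h 3 (k + 1 + 1) t
  have h5 := h 2 (k + 1 + 1) t
  fun_prop

end Kernel

/-! ### Integrability, differentiation and smoothness of the boosted potentials -/

section BoostInt

variable {l : ℝ} {k b : ℕ} {h : R5 → ℝ}

lemma inv_bracket_add_le {z w : R5} (hzw : ‖w - z‖ ≤ 1) (n : ℕ) (y : R5) :
    (bracket (w + y) ^ n)⁻¹ ≤ 2 ^ n * (bracket (z + y) ^ n)⁻¹ := by
  have h1 := bracket_pos (w + y)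
  have h2 := bracket_pos (z + y)
  have h3 : bracket (z + y) ≤ 2 * bracket (w + y) := by
    have := bracket_le_add (z + y) (w + y)
    rw [add_sub_add_right_eq_sub, norm_sub_rev] at this
    linarith [one_le_bracket (w + y)]
  calc (bracket (w + y) ^ n)⁻¹ = 2 ^ n * ((2 * bracket (w + y)) ^ n)⁻¹ := by
        rw [mul_pow]; field_simp
    _ ≤ _ := by gcongr

lemma abs_boostKer_mul_le (hl : |l| < 1) (k : ℕ) (H : BrSym b h) : ∃ C, 0 ≤ C ∧
    ∀ m j : ℕ, k = m + j + 1 → ∀ t, 0 < t → ∀ z y : R5, y ≠ 0 →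
    |boostKer l k t y * h (z + y)| ≤ C * ((t ^ m)⁻¹ * convKernel (3 + j) b t z y) := by
  obtain ⟨C₁, hC₁, H₁⟩ := abs_boostKer_le hl k
  obtain ⟨C₂, hC₂, H₂⟩ := H.bound
  refine ⟨C₁ * C₂, by positivity, fun m j hk t ht z y hy => ?_⟩
  rw [abs_mul]
  calc _ ≤ (C₁ * ((t ^ m)⁻¹ * ((‖y‖ ^ (3 + j))⁻¹ * (t + ‖y‖)⁻¹))) *
        (C₂ * (bracket (z + y) ^ b)⁻¹) :=
        mul_le_mul (H₁ m j hk t ht y hy) (H₂ _) (abs_nonneg _) (by positivity)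
    _ = _ := by rw [convKernel]; ring

lemma abs_boostKerDeriv_mul_le (hl : |l| < 1) (k : ℕ) (H : BrSym b h) : ∃ C, 0 ≤ C ∧
    ∀ m j : ℕ, k = m + j + 1 → ∀ t, 0 < t → ∀ z y : R5, y ≠ 0 → ∀ i : Fin 5,
    |boostKerDeriv l k t y (basisVec i) * h (z + y)| ≤
      C * ((t ^ m)⁻¹ * convKernel (4 + j) b t z y) := by
  obtain ⟨C₁, hC₁, H₁⟩ := abs_boostKerDeriv_le hl k
  obtain ⟨C₂, hC₂, H₂⟩ := H.bound
  refine ⟨C₁ * C₂, by positivity, fun m j hk t ht z y hy i => ?_⟩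
  rw [abs_mul]
  calc _ ≤ (C₁ * ((t ^ m)⁻¹ * ((‖y‖ ^ (4 + j))⁻¹ * (t + ‖y‖)⁻¹))) *
        (C₂ * (bracket (z + y) ^ b)⁻¹) :=
        mul_le_mul (H₁ m j hk t ht y hy i) (H₂ _) (abs_nonneg _) (by positivity)
    _ = _ := by rw [convKernel]; ring

/-- With `a = 3 + j` these conditions are `a ≤ 4` and `a + b ≥ 7`, as required by the convolution
estimate. Only when `b = 3` must one power of the retarded time be spent on the singularity, which
needs `k ≥ 2`. -/
lemma exists_split (hk : 1 ≤ k) (hb : 3 ≤ b) (hkb : 5 ≤ k + b) :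
    ∃ m j : ℕ, k = m + j + 1 ∧ j ≤ 1 ∧ 4 ≤ j + b := by
  rcases Nat.lt_or_ge 3 b with h | h
  · exact ⟨k - 1, 0, by omega, by omega, by omega⟩
  · exact ⟨k - 2, 1, by omega, by omega, by omega⟩

lemma integrable_boostKer_mul (hl : |l| < 1) (H : BrSym b h) (hk : 1 ≤ k) (hb : 3 ≤ b)
    (hkb : 5 ≤ k + b) {t : ℝ} (ht : 0 < t) (z : R5) :
    Integrable fun y => boostKer l k t y * h (z + y) := by
  obtain ⟨m, j, hm, hj, hjb⟩ := exists_split hk hb hkb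
  obtain ⟨C, hC, hle⟩ := abs_boostKer_mul_le hl k H
  have hc := H.continuous.measurable
  refine ((integrable_convKernel (a := 3 + j) (b := b) (by omega) (by omega) (by omega) ht
    z).const_mul (C * (t ^ m)⁻¹)).mono' ?_ ?_
  · have := measurable_boostKer l k t
    exact Measurable.aestronglyMeasurable (by fun_prop)
  · filter_upwards [ae_ne_zero] with y hy
    rw [mul_assoc]
    exact hle m j hm t ht z y hy

lemma integrable_boostKerDeriv_mul (hl : |l| < 1) (H : BrSym b h) (hk : 1 ≤ k) (hb : 3 ≤ b)
    {t : ℝ} (ht : 0 < t) (z : R5) (i : Fin 5) :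
    Integrable fun y => boostKerDeriv l k t y (basisVec i) * h (z + y) := by
  obtain ⟨C, hC, hle⟩ := abs_boostKerDeriv_mul_le hl k H
  have hc := H.continuous.measurable
  refine ((integrable_convKernel (a := 4) (b := b) (by omega) (by omega) (by omega) ht
    z).const_mul (C * (t ^ (k - 1))⁻¹)).mono' ?_ ?_
  · have := measurable_boostKerDeriv l k t i
    exact Measurable.aestronglyMeasurable (by fun_prop)
  · filter_upwards [ae_ne_zero] with y hy
    rw [mul_assoc]
    exact hle (k - 1) 0 (by omega) t ht z y hy i

/-- Integration by parts for the boosted Duhamel operator. -/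
lemma boostInt_pd (hl : |l| < 1) (H : BrSym b h) (hk : 1 ≤ k) (hb : 3 ≤ b)
    (hkb : 5 ≤ k + b) {t : ℝ} (ht : 0 < t) (z : R5) (i : Fin 5) :
    boostInt l k (pd i h) t z = -∫ y, boostKerDeriv l k t y (basisVec i) * h (z + y) := by
  have i0 := integrable_boostKer_mul hl H hk hb hkb ht z
  have i1 := integrable_boostKer_mul hl (H.pd i) hk (by omega) (by omega) ht z
  have i2 := integrable_boostKerDeriv_mul hl H hk hb ht z i
  have key := integral_lineDeriv_eq_zero (v := basisVec i) (by simp)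
    (Q' := fun y => boostKer l k t y * pd i h (z + y) +
      boostKerDeriv l k t y (basisVec i) * h (z + y)) (fun y hy => ?_) i0 (i1.add i2)
  · rw [integral_add i1 i2] at key
    rw [boostInt]
    linarith
  · have h1 := hasFDerivAt_boostKer hl k ht hy
    have h2 : HasFDerivAt (fun y => h (z + y)) (fderiv ℝ h (z + y)) y :=
      ((H.differentiable (z + y)).hasFDerivAt.comp y ((hasFDerivAt_id y).const_add z))
    have h3 := (h1.mul h2).hasLineDerivAt (basisVec i)
    convert! h3 using 1
    simp [pd]
    ring

/-- The derivative of the boosted Duhamel operator in `(t, z)`. -/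
lemma hasFDerivAt_boostInt (hl : |l| < 1) (H : BrSym b h) (hk : 1 ≤ k) (hb : 3 ≤ b)
    (hkb : 5 ≤ k + b) {p : ℝ × R5} (hp : 0 < p.1) :
    HasFDerivAt (fun p : ℝ × R5 => boostInt l k h p.1 p.2)
      ((-(k : ℝ) * boostInt l (k + 1) h p.1 p.2) • ContinuousLinearMap.fst ℝ ℝ R5 +
        ∑ i, boostInt l k (pd i h) p.1 p.2 •
          ((EuclideanSpace.proj i : R5 →L[ℝ] ℝ) ∘L ContinuousLinearMap.snd ℝ ℝ R5)) p := by
  obtain ⟨m, j, hm, hj, hjb⟩ := exists_split hk hb hkb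
  obtain ⟨C₀, hC₀, hle₀⟩ := abs_boostKer_mul_le hl (k + 1) H
  choose C hC hle using fun i => abs_boostKer_mul_le hl k (H.pd i)
  set P : Fin 5 → (ℝ × R5 →L[ℝ] ℝ) := fun i =>
    (EuclideanSpace.proj i : R5 →L[ℝ] ℝ) ∘L ContinuousLinearMap.snd ℝ ℝ R5 with hP
  set F' : ℝ × R5 → R5 → (ℝ × R5 →L[ℝ] ℝ) := fun q y =>
    (-(k : ℝ) * (boostKer l (k + 1) q.1 y * h (q.2 + y))) • ContinuousLinearMap.fst ℝ ℝ R5 +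
      ∑ i, (boostKer l k q.1 y * pd i h (q.2 + y)) • P i with hF'
  have hi0 := integrable_boostKer_mul hl H (k := k + 1) (by omega) hb (by omega) hp p.2
  have hi1 := fun i => integrable_boostKer_mul hl (H.pd i) hk (by omega) (by omega) hp p.2
  have hs : ∀ i ∈ Finset.univ,
      Integrable fun y => (boostKer l k p.1 y * pd i h (p.2 + y)) • P i :=
    fun i _ => (hi1 i).smul_const (P i)
  have hsum : Integrable fun y => ∑ i, (boostKer l k p.1 y * pd i h (p.2 + y)) • P i :=
    integrable_finsetSum (ε' := (ℝ × R5 →L[ℝ] ℝ))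
      (f := fun i y => (boostKer l k p.1 y * pd i h (p.2 + y)) • P i) Finset.univ hs
  have hI : ∫ y, F' p y = (-(k : ℝ) * boostInt l (k + 1) h p.1 p.2) •
      ContinuousLinearMap.fst ℝ ℝ R5 + ∑ i, boostInt l k (pd i h) p.1 p.2 • P i := by
    simp only [hF']
    rw [integral_add ((hi0.const_mul _).smul_const _)
      hsum,
      integral_finsetSum _ hs, integral_smul_const,
      integral_const_mul]
    congr 1
    refine Finset.sum_congr rfl fun i _ => ?_
    rw [integral_smul_const]
    rfl
  rw [← hI]
  set t₀ := p.1 / 2 with ht₀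
  have ht₀pos : 0 < t₀ := by positivity
  -- In this ball times stay above `t₀ = p.1 / 2` and space shifts stay below one, so all brackets
  -- are comparable to those at the centre and one dominating function serves.
  set ε := min 1 t₀ with hε
  have hεpos : 0 < ε := lt_min one_pos ht₀pos
  set M : ℝ := k * (C₀ * (t₀ ^ (m + 1))⁻¹) * ‖ContinuousLinearMap.fst ℝ ℝ R5‖ +
    ∑ i, (C i * (t₀ ^ m)⁻¹) * ‖P i‖ with hM
  refine hasFDerivAt_integral_of_dominated_of_fderiv_le
    (bound := fun y => M * (2 ^ b * convKernel (3 + j) b t₀ p.2 y))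
    (ball_mem_nhds p hεpos) ?_ (integrable_boostKer_mul hl H hk hb hkb hp p.2) ?_ ?_ ?_ ?_
  · refine .of_forall fun q => Measurable.aestronglyMeasurable ?_
    have := measurable_boostKer l k q.1
    have := H.continuous.measurable
    fun_prop
  · exact ((hi0.const_mul _).smul_const _).aestronglyMeasurable.add hsum.aestronglyMeasurable
  · filter_upwards [ae_ne_zero] with y hy q hq
    have hq' : dist q p < ε := hq
    rw [Prod.dist_eq, max_lt_iff, Real.dist_eq, dist_eq_norm] at hq'
    have hq1 : t₀ ≤ q.1 := by
      have := (abs_lt.1 (hq'.1.trans_le (min_le_right _ _))).1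
      linarith
    have hq1' : 0 < q.1 := ht₀pos.trans_le hq1
    have hq2 : ‖q.2 - p.2‖ ≤ 1 := (hq'.2.trans_le (min_le_left _ _)).le
    have hbr := bracket_pos (q.2 + y)
    have hbr' := bracket_pos (p.2 + y)
    have hconv : convKernel (3 + j) b q.1 q.2 y ≤ 2 ^ b * convKernel (3 + j) b t₀ p.2 y := by
      have := inv_bracket_add_le hq2 b y
      unfold convKernel
      calc (‖y‖ ^ (3 + j))⁻¹ * (q.1 + ‖y‖)⁻¹ * (bracket (q.2 + y) ^ b)⁻¹ ≤
          (‖y‖ ^ (3 + j))⁻¹ * (t₀ + ‖y‖)⁻¹ * (2 ^ b * (bracket (p.2 + y) ^ b)⁻¹) := by gcongr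
        _ = _ := by ring
    have hcn := convKernel_nonneg (3 + j) b hq1' q.2 y
    have hpow : ∀ n : ℕ, (q.1 ^ n)⁻¹ ≤ (t₀ ^ n)⁻¹ := fun n => by gcongr
    set D := 2 ^ b * convKernel (3 + j) b t₀ p.2 y with hD
    have e0 : |boostKer l (k + 1) q.1 y * h (q.2 + y)| ≤ C₀ * (t₀ ^ (m + 1))⁻¹ * D := by
      refine (hle₀ (m + 1) j (by omega) q.1 hq1' q.2 y hy).trans ?_
      rw [mul_assoc]
      exact mul_le_mul_of_nonneg_left (mul_le_mul (hpow _) hconv hcn (by positivity)) hC₀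
    have e1 : ∀ i, |boostKer l k q.1 y * pd i h (q.2 + y)| ≤ C i * (t₀ ^ m)⁻¹ * D := by
      intro i
      refine (hle i m j hm q.1 hq1' q.2 y hy).trans ?_
      rw [mul_assoc]
      exact mul_le_mul_of_nonneg_left (mul_le_mul (hpow _)
        ((convKernel_anti (Nat.le_succ b) hq1' q.2 y).trans hconv)
        (convKernel_nonneg _ _ hq1' _ _) (by positivity)) (hC i)
    calc ‖F' q y‖ ≤ ‖(-(k : ℝ) * (boostKer l (k + 1) q.1 y * h (q.2 + y))) •
          ContinuousLinearMap.fst ℝ ℝ R5‖ +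
          ∑ i, ‖(boostKer l k q.1 y * pd i h (q.2 + y)) • P i‖ :=
        (norm_add_le _ _).trans (add_le_add le_rfl (norm_sum_le _ _))
      _ ≤ k * (C₀ * (t₀ ^ (m + 1))⁻¹ * D) * ‖ContinuousLinearMap.fst ℝ ℝ R5‖ +
          ∑ i, (C i * (t₀ ^ m)⁻¹ * D) * ‖P i‖ := by
        refine add_le_add ?_ (Finset.sum_le_sum fun i _ => ?_)
        · rw [norm_smul, norm_mul, norm_neg, Real.norm_natCast]
          gcongr
          exact e0
        · rw [norm_smul]
          gcongr
          exact e1 i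
      _ = M * D := by
        rw [hM, add_mul, Finset.sum_mul]
        congr 1
        · ring
        · exact Finset.sum_congr rfl fun i _ => by ring
  · exact ((integrable_convKernel (by omega) (by omega) (by omega) ht₀pos p.2).const_mul
      _).const_mul _
  · refine .of_forall fun y q hq => ?_
    have hq' : dist q p < ε := hq
    rw [Prod.dist_eq, max_lt_iff, Real.dist_eq] at hq'
    have hq1 : 0 < q.1 := by
      have := (abs_lt.1 (hq'.1.trans_le (min_le_right _ _))).1
      linarith
    have h1 : HasFDerivAt (fun q : ℝ × R5 => boostKer l k q.1 y) _ q :=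
      HasDerivAt.comp_hasFDerivAt (f := Prod.fst) (f' := ContinuousLinearMap.fst ℝ ℝ R5) q
        (hasDerivAt_boostKer hl k hq1 y) hasFDerivAt_fst
    have h2 : HasFDerivAt (fun q : ℝ × R5 => h (q.2 + y)) _ q :=
      (H.hasFDerivAt (q.2 + y)).comp q ((hasFDerivAt_snd (p := q)).add_const y)
    convert! h1.mul h2 using 1
    ext x
    · simp [hF', hP]
      ring
    · simp [hF', hP, Finset.mul_sum]
      exact Finset.sum_congr rfl fun i _ => by ring

/-- The boosted Duhamel operator produces smooth functions. -/
lemma contDiffOn_boostInt (hl : |l| < 1) (H : BrSym b h) (hk : 1 ≤ k) (hb : 3 ≤ b)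
    (hkb : 5 ≤ k + b) :
    ContDiffOn ℝ ∞ (fun p : ℝ × R5 => boostInt l k h p.1 p.2) (Ioi (0 : ℝ) ×ˢ univ) := by
  have hopen : IsOpen (Ioi (0 : ℝ) ×ˢ (univ : Set R5)) := isOpen_Ioi.prod isOpen_univ
  refine contDiffOn_infty.2 fun n => ?_
  -- The derivative consists of potentials with data `(k + 1, h)` and `(k, ∂ᵢh)`, which satisfy the
  -- same hypotheses.
  induction n generalizing k b h with
  | zero =>
    refine contDiffOn_zero.2 fun p hp => ?_
    exact (hasFDerivAt_boostInt hl H hk hb hkb hp.1).continuousAt.continuousWithinAt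
  | succ n ih =>
    refine (contDiffOn_succ_iff_hasFDerivWithinAt (n := (n : WithTop ℕ∞)) (by simp)).2 fun p hp => ?_
    refine ⟨Ioi (0 : ℝ) ×ˢ univ, ?_, by simp, _,
      fun q hq => (hasFDerivAt_boostInt hl H hk hb hkb hq.1).hasFDerivWithinAt, ?_⟩
    · rw [insert_eq_of_mem hp]; exact self_mem_nhdsWithin
    · refine ContDiffOn.add ?_ (ContDiffOn.sum fun i _ => ?_)
      · exact (contDiffOn_const.mul (ih H (k := k + 1) (by omega) hb (by omega))).smul
          contDiffOn_const
      · exact (ih (H.pd i) hk (by omega) (by omega)).smul contDiffOn_const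

end BoostInt



/-! ### Differentiating spherical means, and Kirchhoff's formula without an outer derivative -/

section SphericalMeans

lemma sphMean_eq (g : R5 → ℝ) (x : R5) (r : ℝ) :
    sphMean g x r = sphArea⁻¹ * ∫ θ, g (x + r • (θ : R5)) ∂sphMeasure := by
  rw [sphMean, average_eq, smul_eq_mul, sphArea]

lemma hasDerivAt_sphMean {g : R5 → ℝ} (hg : ContDiff ℝ 1 g) (x : R5) (r : ℝ) :
    HasDerivAt (fun σ => sphMean g x σ)
      (sphArea⁻¹ * ∫ θ, fderiv ℝ g (x + r • (θ : R5)) (θ : R5) ∂sphMeasure) r := by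
  simp only [sphMean_eq]
  refine HasDerivAt.const_mul _ ?_
  have hg' : Continuous (fderiv ℝ g) := hg.continuous_fderiv (by simp)
  obtain ⟨C, hC⟩ := (isCompact_closedBall x (|r| + 1)).exists_bound_of_continuousOn
    hg'.continuousOn
  refine (hasDerivAt_integral_of_dominated_loc_of_deriv_le (bound := fun _ => C)
    (F := fun σ (θ : sphere (0 : R5) 1) => g (x + σ • (θ : R5)))
    (F' := fun σ (θ : sphere (0 : R5) 1) => fderiv ℝ g (x + σ • (θ : R5)) (θ : R5))
    (ball_mem_nhds r one_pos) ?_ ?_ ?_ ?_ (integrable_const C) ?_).2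
  · refine .of_forall fun σ => Continuous.aestronglyMeasurable ?_
    have := hg.continuous
    fun_prop
  · refine Continuous.integrable_of_hasCompactSupport ?_ (HasCompactSupport.of_compactSpace _)
    have := hg.continuous
    fun_prop
  · refine Continuous.aestronglyMeasurable ?_
    have h1 : Continuous fun θ : sphere (0 : R5) 1 => fderiv ℝ g (x + r • (θ : R5)) :=
      hg'.comp (by fun_prop)
    exact h1.clm_apply continuous_subtype_val
  · refine .of_forall fun θ σ hσ => ?_
    have h1 : |σ - r| < 1 := hσ
    have h2 : |σ| ≤ |r| + 1 := by
      have := abs_sub_abs_le_abs_sub σ r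
      linarith
    have h3 : x + σ • (θ : R5) ∈ closedBall x (|r| + 1) := by
      rw [mem_closedBall, dist_eq_norm, add_sub_cancel_left, norm_smul, norm_sphere, mul_one]
      exact h2
    refine (ContinuousLinearMap.le_opNorm _ _).trans ?_
    rw [norm_sphere, mul_one]
    exact hC _ h3
  · refine .of_forall fun θ σ _ => ?_
    have h1 : HasDerivAt (fun σ : ℝ => x + σ • (θ : R5)) (θ : R5) σ := by
      simpa using ((hasDerivAt_id σ).smul_const (θ : R5)).const_add x
    exact ((hg.differentiable (by simp)) _).hasFDerivAt.comp_hasDerivAt σ h1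

lemma integrable_sphere_of_continuous {f : sphere (0 : R5) 1 → ℝ} (hf : Continuous f) :
    Integrable f sphMeasure :=
  hf.integrable_of_hasCompactSupport (HasCompactSupport.of_compactSpace _)

lemma sinePropagator_eq {g : R5 → ℝ} (hg : ContDiff ℝ 1 g) (x : R5) {s : ℝ} (hs : 0 < s) :
    sinePropagator s g x = sphArea⁻¹ * ∫ θ, (s * g (x + s • (θ : R5)) +
      s ^ 2 / 3 * fderiv ℝ g (x + s • (θ : R5)) (θ : R5)) ∂sphMeasure := by
  have h1 := ((hasDerivAt_pow 3 s).mul (hasDerivAt_sphMean hg x s)).deriv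
  have hg' : Continuous (fderiv ℝ g) := hg.continuous_fderiv (by simp)
  have i1 : Integrable (fun θ : sphere (0 : R5) 1 => s * g (x + s • (θ : R5))) sphMeasure :=
    integrable_sphere_of_continuous (by have := hg.continuous; fun_prop)
  have i2 : Integrable (fun θ : sphere (0 : R5) 1 =>
      s ^ 2 / 3 * fderiv ℝ g (x + s • (θ : R5)) (θ : R5)) sphMeasure := by
    refine integrable_sphere_of_continuous (continuous_const.mul ?_)
    have h1 : Continuous fun θ : sphere (0 : R5) 1 => fderiv ℝ g (x + s • (θ : R5)) :=
      hg'.comp (by fun_prop)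
    exact h1.clm_apply continuous_subtype_val
  rw [integral_add i1 i2, integral_const_mul, integral_const_mul, sinePropagator]
  have h2 : deriv (fun σ => σ ^ 3 * sphMean g x σ) s = _ := h1
  rw [h2, sphMean_eq]
  field_simp
  push_cast
  ring

end SphericalMeans

/-! ### The coordinate `x_ℓ` along light cones -/

section BoostedCoordinates

variable {l : ℝ}

/-- The linear part of `x ↦ x_ℓ`. -/
noncomputable def stretch (l : ℝ) : R5 →L[ℝ] R5 :=
  ContinuousLinearMap.id ℝ R5 +
    ((lorentzFactor l - 1) • (EuclideanSpace.proj (0 : Fin 5) : R5 →L[ℝ] ℝ)).smulRight (basisVec 0)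

lemma xl_eq (l t : ℝ) (x : R5) :
    xl l t x = stretch l x - (lorentzFactor l * l * t) • basisVec 0 := by
  ext i
  by_cases hi : i = 0
  · subst hi
    simp [xl, stretch, lorentzFactor]
    ring
  · simp [xl, stretch, hi]

lemma boostSpace_neg_eq (l : ℝ) (y : R5) :
    boostSpace (-l) y = stretch l y - (lorentzFactor l * l * ‖y‖) • basisVec 0 := by
  rw [boostSpace, lorentzFactor_neg, stretch]
  simp only [add_apply, ContinuousLinearMap.id_apply,
    ContinuousLinearMap.smulRight_apply, smul_apply, smul_eq_mul,
    PiLp.proj_apply, add_sub_assoc, ← sub_smul]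
  congr 2
  ring

/-- The map `(t, x) ↦ x_ℓ` is the space part of a linear boost, so adding the null vector `(|y|, y)`
adds its boosted space part. Functions of `x_ℓ` restricted to the cone therefore depend on `y` only
through that vector. -/
lemma xl_add (l t : ℝ) (x y : R5) : xl l (t + ‖y‖) (x + y) = xl l t x + boostSpace (-l) y := by
  rw [xl_eq, xl_eq, boostSpace_neg_eq, map_add, mul_add, add_smul]
  abel

lemma hasFDerivAt_xl (l t : ℝ) (x : R5) : HasFDerivAt (xl l t) (stretch l) x := by
  have : xl l t = fun x => stretch l x - (lorentzFactor l * l * t) • basisVec 0 :=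
    funext (xl_eq l t)
  rw [this]
  exact (stretch l).hasFDerivAt.sub_const _

lemma contDiff_xl (l : ℝ) : ContDiff ℝ ∞ fun p : ℝ × R5 => xl l p.1 p.2 := by
  simp only [xl_eq]
  exact ((stretch l).contDiff.comp contDiff_snd).sub
    ((contDiff_const.mul contDiff_fst).smul contDiff_const)

lemma boostSpace_smul (l : ℝ) {s : ℝ} (hs : 0 < s) (y : R5) :
    boostSpace l (s • y) = s • boostSpace l y := by
  rw [boostSpace, boostSpace, norm_smul, Real.norm_of_nonneg hs.le, smul_add, smul_smul]
  congr 2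
  simp
  ring

@[fun_prop]
lemma continuous_boostSpace (l : ℝ) : Continuous (boostSpace l) := by
  unfold boostSpace; fun_prop

lemma norm_boostSpace_le (hl : |l| < 1) (y : R5) :
    ‖boostSpace l y‖ ≤ lorentzFactor l * 2 * ‖y‖ := by
  rw [norm_boostSpace hl]; exact boostTime_upper hl y

/-- The directional derivative, written in coordinates. -/
noncomputable def dirDeriv (h : R5 → ℝ) (w v : R5) : ℝ := ∑ i, pd i h w * v i

lemma BrSym.fderiv_apply {b : ℕ} {h : R5 → ℝ} (H : BrSym b h) (w v : R5) :
    fderiv ℝ h w v = dirDeriv h w v := by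
  rw [(H.hasFDerivAt w).fderiv]
  simp [dirDeriv]

lemma BrSym.abs_dirDeriv_le {b : ℕ} {h : R5 → ℝ} (H : BrSym b h) : ∃ C, 0 ≤ C ∧ ∀ w v : R5,
    |dirDeriv h w v| ≤ C * (bracket w ^ (b + 1))⁻¹ * ‖v‖ := by
  choose C hC hle using fun i => (H.pd i).bound
  refine ⟨∑ i, C i, Finset.sum_nonneg fun i _ => hC i, fun w v => ?_⟩
  rw [dirDeriv, Finset.sum_mul, Finset.sum_mul]
  refine (Finset.abs_sum_le_sum_abs _ _).trans (Finset.sum_le_sum fun i _ => ?_)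
  rw [abs_mul]
  have := bracket_pos w
  exact mul_le_mul (hle i w) (abs_coord_le_norm v i) (abs_nonneg _) (mul_nonneg (hC i) (by positivity))

end BoostedCoordinates

/-! ### From the light cone integral to the boosted kernel -/

section Duhamel

variable {l : ℝ} {k b : ℕ} {h : R5 → ℝ}

/-- Integrability along the light cone. -/
lemma integrable_cone (hl : |l| < 1) {a : ℕ} (ha : 3 ≤ a) (ha' : a ≤ 4) (hab : 7 ≤ a + b)
    {t : ℝ} (ht : 0 < t) (z : R5) : Integrable fun y : R5 =>
      (‖y‖ ^ a)⁻¹ * (t + ‖y‖)⁻¹ * (bracket (z + boostSpace (-l) y) ^ b)⁻¹ := by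
  rw [integrable_boost_iff hl]
  obtain ⟨c, hc, hph⟩ := phase_lower hl
  have hγ := lorentzFactor_pos hl
  set κ := lorentzFactor l * (1 - |l|) with hκ
  have hκ0 : 0 < κ := mul_pos hγ (by linarith)
  refine ((integrable_convKernel ha ha' hab ht z).const_mul
    (lorentzFactor l * 2 * ((κ ^ a)⁻¹ * c⁻¹))).mono' ?_ ?_
  · refine Measurable.aestronglyMeasurable ?_
    have h1 : Measurable (boostTime l) := by unfold boostTime; fun_prop
    have h2 := (continuous_boostSpace l).measurable
    have h3 := (continuous_boostSpace (-l)).measurable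
    have h4 := continuous_bracket.measurable
    fun_prop
  · filter_upwards [ae_ne_zero] with y hy
    have hy0 : 0 < ‖y‖ := norm_pos_iff.2 hy
    have hρ := boostTime_pos hl hy
    have hbr := bracket_pos (z + y)
    rw [boostSpace_neg_boostSpace hl, norm_boostSpace hl, Real.norm_of_nonneg (by positivity)]
    have h1 : boostTime l y / ‖y‖ ≤ lorentzFactor l * 2 :=
      (div_le_iff₀ hy0).2 (boostTime_upper hl y)
    have h2 : (boostTime l y ^ a)⁻¹ ≤ (κ ^ a)⁻¹ * (‖y‖ ^ a)⁻¹ := by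
      rw [← mul_inv, ← mul_pow]
      have := boostTime_lower hl y
      gcongr
    have h3 : (t + boostTime l y)⁻¹ ≤ c⁻¹ * (t + ‖y‖)⁻¹ := by
      rw [← mul_inv]
      have := hph t ht.le y
      rw [phase] at this
      gcongr
    calc _ ≤ (lorentzFactor l * 2) * (((κ ^ a)⁻¹ * (‖y‖ ^ a)⁻¹) * (c⁻¹ * (t + ‖y‖)⁻¹) *
          (bracket (z + y) ^ b)⁻¹) := by gcongr
      _ = _ := by rw [convKernel]; ring

lemma integrable_cone_two (hl : |l| < 1) (hk : 2 ≤ k) (hb : 3 ≤ b) (hkb : 6 ≤ k + b) {t : ℝ}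
    (ht : 0 < t) (z : R5) {R : R5 → ℝ} (hR : Measurable R)
    (hle : ∃ C, ∀ y, |R y| ≤ C * (bracket (z + boostSpace (-l) y) ^ b)⁻¹) :
    Integrable fun y : R5 => (‖y‖ ^ 2)⁻¹ * ((t + ‖y‖) ^ k)⁻¹ * R y := by
  obtain ⟨m, j, hm, hj, hjb⟩ := exists_split (k := k - 1) (b := b) (by omega) hb (by omega)
  obtain ⟨C, hC⟩ := hle
  refine ((integrable_cone hl (a := 3 + j) (b := b) (by omega) (by omega) (by omega) ht
    z).const_mul ((t ^ m)⁻¹ * C)).mono' ?_ ?_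
  · exact Measurable.aestronglyMeasurable (by fun_prop)
  · filter_upwards [ae_ne_zero] with y hy
    have hy0 : 0 < ‖y‖ := norm_pos_iff.2 hy
    have h1 : ((t + ‖y‖) ^ k)⁻¹ ≤ (t ^ m)⁻¹ * ((‖y‖ ^ (j + 1))⁻¹ * (t + ‖y‖)⁻¹) := by
      have : k = m + (j + 1) + 1 := by omega
      rw [this, pow_succ, pow_add, mul_inv, mul_inv, mul_assoc]
      gcongr
      · linarith
      · linarith
    rw [norm_mul, Real.norm_eq_abs (R y), Real.norm_of_nonneg (by positivity)]
    calc _ ≤ (‖y‖ ^ 2)⁻¹ * ((t ^ m)⁻¹ * ((‖y‖ ^ (j + 1))⁻¹ * (t + ‖y‖)⁻¹)) *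
          (C * (bracket (z + boostSpace (-l) y) ^ b)⁻¹) := by
          gcongr
          exact hC y
      _ = _ := by
          have : 3 + j = 2 + (j + 1) := by ring
          rw [this, pow_add ‖y‖ 2 (j + 1), mul_inv]
          ring

lemma integrable_cone_three (hl : |l| < 1) (hk : 2 ≤ k) (hb : 3 ≤ b) (hkb : 6 ≤ k + b) {t : ℝ}
    (ht : 0 < t) (z : R5) {R : R5 → ℝ} (hR : Measurable R)
    (hle : ∃ C, ∀ y, |R y| ≤ C * (bracket (z + boostSpace (-l) y) ^ b)⁻¹) :
    Integrable fun y : R5 => (‖y‖ ^ 3)⁻¹ * ((t + ‖y‖) ^ k)⁻¹ * R y := by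
  obtain ⟨m, j, hm, hj, hjb⟩ := exists_split (k := k - 1) (b := b) (by omega) hb (by omega)
  obtain ⟨C, hC⟩ := hle
  refine ((integrable_cone hl (a := 3 + j) (b := b) (by omega) (by omega) (by omega) ht
    z).const_mul ((t ^ (m + 1))⁻¹ * C)).mono' ?_ ?_
  · exact Measurable.aestronglyMeasurable (by fun_prop)
  · filter_upwards [ae_ne_zero] with y hy
    have hy0 : 0 < ‖y‖ := norm_pos_iff.2 hy
    have h1 : ((t + ‖y‖) ^ k)⁻¹ ≤ (t ^ (m + 1))⁻¹ * ((‖y‖ ^ j)⁻¹ * (t + ‖y‖)⁻¹) := by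
      have : k = (m + 1) + j + 1 := by omega
      rw [this, pow_succ, pow_add, mul_inv, mul_inv, mul_assoc]
      gcongr
      · linarith
      · linarith
    rw [norm_mul, Real.norm_eq_abs (R y), Real.norm_of_nonneg (by positivity)]
    calc _ ≤ (‖y‖ ^ 3)⁻¹ * ((t ^ (m + 1))⁻¹ * ((‖y‖ ^ j)⁻¹ * (t + ‖y‖)⁻¹)) *
          (C * (bracket (z + boostSpace (-l) y) ^ b)⁻¹) := by
          gcongr
          exact hC y
      _ = _ := by
          rw [pow_add ‖y‖ 3 j, mul_inv]
          ring

/-- The radial part of the Kirchhoff formula integrated along the light cone. -/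
noncomputable def coneIntegrand (l : ℝ) (k : ℕ) (h : R5 → ℝ) (t : ℝ) (z y : R5) : ℝ :=
  (‖y‖ ^ 3)⁻¹ * ((t + ‖y‖) ^ k)⁻¹ * (h (z + boostSpace (-l) y) +
    1 / 3 * dirDeriv h (z + boostSpace (-l) y) (stretch l y))

/-- The light cone integrand after the radial integration by parts. -/
noncomputable def coneIntegrand' (l : ℝ) (k : ℕ) (h : R5 → ℝ) (t : ℝ) (z y : R5) : ℝ :=
  (‖y‖ ^ 3)⁻¹ * ((t + ‖y‖) ^ k)⁻¹ * h (z + boostSpace (-l) y) +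
    k * ((‖y‖ ^ 2)⁻¹ * ((t + ‖y‖) ^ (k + 1))⁻¹ * h (z + boostSpace (-l) y)) +
    lorentzFactor l * l *
      ((‖y‖ ^ 2)⁻¹ * ((t + ‖y‖) ^ k)⁻¹ * pd 0 h (z + boostSpace (-l) y))

lemma measurable_dirDeriv (H : BrSym b h) {w v : R5 → R5} (hw : Measurable w)
    (hv : Measurable v) : Measurable fun y => dirDeriv h (w y) (v y) := by
  unfold dirDeriv
  refine Finset.measurable_sum _ fun i _ => ?_
  have := (H.pd i).continuous.measurable
  fun_prop

/-- The direction `stretch l y` differs from `boostSpace (-l) y` by `γℓ|y| e₁`. Since the boosted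
vector is homogeneous of degree one in `y`, differentiating along it is the radial derivative of `y
↦ h(z + boostSpace (-l) y)` and can be integrated away; only the `e₁` derivative survives. -/
lemma integral_coneIntegrand (hl : |l| < 1) (H : BrSym b h) (hk : 2 ≤ k) (hb : 3 ≤ b)
    (hkb : 6 ≤ k + b) {t : ℝ} (ht : 0 < t) (z : R5) :
    Integrable (coneIntegrand l k h t z) ∧ Integrable (coneIntegrand' l k h t z) ∧
      ∫ y, coneIntegrand l k h t z y = 1 / 3 * ∫ y, coneIntegrand' l k h t z y := by
  have hl' : |-l| < 1 := by rwa [abs_neg]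
  obtain ⟨C₀, hC₀, H₀⟩ := H.bound
  obtain ⟨C₁, hC₁, H₁⟩ := (H.pd 0).bound
  obtain ⟨C₂, hC₂, H₂⟩ := H.abs_dirDeriv_le
  have hB : Measurable fun y => z + boostSpace (-l) y :=
    (continuous_const.add (continuous_boostSpace (-l))).measurable
  have hm0 : Measurable fun y => h (z + boostSpace (-l) y) := H.continuous.measurable.comp hB
  have hm1 : Measurable fun y => pd 0 h (z + boostSpace (-l) y) :=
    (H.pd 0).continuous.measurable.comp hB
  have hm2 : Measurable fun y => dirDeriv h (z + boostSpace (-l) y) (boostSpace (-l) y) :=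
    measurable_dirDeriv H hB (continuous_boostSpace _).measurable
  have iA := integrable_cone_three hl hk hb hkb ht z hm0 ⟨C₀, fun y => H₀ _⟩
  have iQ := integrable_cone_two hl hk hb hkb ht z hm0 ⟨C₀, fun y => H₀ _⟩
  have iB := integrable_cone_two hl (k := k + 1) (by omega) hb (by omega) ht z hm0
    ⟨C₀, fun y => H₀ _⟩
  have iC := integrable_cone_two hl hk (b := b + 1) (by omega) (by omega) ht z hm1
    ⟨C₁, fun y => H₁ _⟩
  -- The derivative is taken along a vector of size `O(|y|)`, which absorbs one power of the
  -- singularity, and differentiating `h` gains one power of the bracket.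
  have iD : Integrable fun y => (‖y‖ ^ 3)⁻¹ * ((t + ‖y‖) ^ k)⁻¹ *
      dirDeriv h (z + boostSpace (-l) y) (boostSpace (-l) y) := by
    have := integrable_cone_two hl hk (b := b + 1) (by omega) (by omega) ht z
      (R := fun y => ‖y‖⁻¹ * dirDeriv h (z + boostSpace (-l) y) (boostSpace (-l) y))
      (by fun_prop) ⟨C₂ * (lorentzFactor (-l) * 2), fun y => ?_⟩
    · refine this.congr (.of_forall fun y => ?_)
      simp only [pow_succ, mul_inv, pow_zero]
      ring
    · have hb := bracket_pos (z + boostSpace (-l) y)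
      rw [abs_mul, abs_inv, abs_norm]
      have h1 := H₂ (z + boostSpace (-l) y) (boostSpace (-l) y)
      have h2 := norm_boostSpace_le hl' y
      have hγ := lorentzFactor_pos hl'
      rcases eq_or_ne ‖y‖ 0 with h0 | h0
      · rw [h0, inv_zero, zero_mul]; positivity
      · have h0' : 0 < ‖y‖ := lt_of_le_of_ne (norm_nonneg _) h0.symm
        rw [inv_mul_le_iff₀ h0']
        calc _ ≤ _ := h1
          _ ≤ C₂ * (bracket (z + boostSpace (-l) y) ^ (b + 1))⁻¹ *
            (lorentzFactor (-l) * 2 * ‖y‖) := by gcongr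
          _ = _ := by ring
  -- `Q'` is the radial derivative `y·∇Q`, and the factor `1/3` is Kirchhoff's. As `Q 0 = 0`,
  -- `integral_euler` gives no boundary term.
  set Q : R5 → ℝ := fun y => 1 / 3 * (‖y‖ ^ 2 * ((t + ‖y‖) ^ k)⁻¹ * h (z + boostSpace (-l) y))
    with hQ
  set Q' : R5 → ℝ := fun y => 2 / 3 * (‖y‖ ^ 2 * ((t + ‖y‖) ^ k)⁻¹ * h (z + boostSpace (-l) y)) -
    k / 3 * (‖y‖ ^ 3 * ((t + ‖y‖) ^ (k + 1))⁻¹ * h (z + boostSpace (-l) y)) +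
    1 / 3 * (‖y‖ ^ 2 * ((t + ‖y‖) ^ k)⁻¹ *
      dirDeriv h (z + boostSpace (-l) y) (boostSpace (-l) y)) with hQ'
  have eQ : ∀ y : R5, y ≠ 0 → (‖y‖ ^ 4)⁻¹ * Q y =
      1 / 3 * ((‖y‖ ^ 2)⁻¹ * ((t + ‖y‖) ^ k)⁻¹ * h (z + boostSpace (-l) y)) := by
    intro y hy
    have hy0 : ‖y‖ ≠ 0 := norm_ne_zero_iff.2 hy
    simp only [hQ]
    field_simp
  have eQ' : ∀ y : R5, y ≠ 0 → (‖y‖ ^ 5)⁻¹ * Q' y =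
      2 / 3 * ((‖y‖ ^ 3)⁻¹ * ((t + ‖y‖) ^ k)⁻¹ * h (z + boostSpace (-l) y)) -
      k / 3 * ((‖y‖ ^ 2)⁻¹ * ((t + ‖y‖) ^ (k + 1))⁻¹ * h (z + boostSpace (-l) y)) +
      1 / 3 * ((‖y‖ ^ 3)⁻¹ * ((t + ‖y‖) ^ k)⁻¹ *
        dirDeriv h (z + boostSpace (-l) y) (boostSpace (-l) y)) := by
    intro y hy
    have hy0 : ‖y‖ ≠ 0 := norm_ne_zero_iff.2 hy
    have ht0 : t + ‖y‖ ≠ 0 := by positivity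
    simp only [hQ']
    field_simp
  have iQ1 : Integrable fun y => (‖y‖ ^ 4)⁻¹ * Q y := by
    refine (iQ.const_mul (1 / 3)).congr ?_
    filter_upwards [ae_ne_zero] with y hy using (eQ y hy).symm
  have iQ2 : Integrable fun y => (‖y‖ ^ 5)⁻¹ * Q' y := by
    refine (((iA.const_mul (2 / 3)).sub (iB.const_mul (k / 3))).add
      (iD.const_mul (1 / 3))).congr ?_
    filter_upwards [ae_ne_zero] with y hy using (eQ' y hy).symm
  have euler := integral_euler (Q := Q) (Q' := Q') (fun y hy => ?_) iQ1 iQ2 ?_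
  · have iE : Integrable (coneIntegrand' l k h t z) :=
      (iA.add (iB.const_mul k)).add (iC.const_mul (lorentzFactor l * l))
    have hsplit : ∀ y : R5, y ≠ 0 → coneIntegrand l k h t z y =
        1 / 3 * coneIntegrand' l k h t z y + (‖y‖ ^ 5)⁻¹ * Q' y := by
      intro y hy
      have hy0 : ‖y‖ ≠ 0 := norm_ne_zero_iff.2 hy
      have ht0 : t + ‖y‖ ≠ 0 := by positivity
      have e : dirDeriv h (z + boostSpace (-l) y) (boostSpace (-l) y) =
          dirDeriv h (z + boostSpace (-l) y) (stretch l y) -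
            lorentzFactor l * l * ‖y‖ * pd 0 h (z + boostSpace (-l) y) := by
        rw [← H.fderiv_apply, ← H.fderiv_apply, pd, ← smul_eq_mul, ← map_smul, ← map_sub,
          ← boostSpace_neg_eq]
      rw [eQ' y hy, e, coneIntegrand, coneIntegrand']
      field_simp
      ring
    have hsplit' : coneIntegrand l k h t z =ᵐ[volume]
        fun y => 1 / 3 * coneIntegrand' l k h t z y + (‖y‖ ^ 5)⁻¹ * Q' y := by
      filter_upwards [ae_ne_zero] with y hy using hsplit y hy
    refine ⟨((iE.const_mul (1 / 3)).add iQ2).congr hsplit'.symm, iE, ?_⟩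
    rw [integral_congr_ae hsplit', integral_add (iE.const_mul _) iQ2, euler, integral_const_mul]
    simp [hQ]
  · have hy0 : 0 < ‖y‖ := norm_pos_iff.2 hy
    have h1 : HasDerivAt (fun s : ℝ => z + s • boostSpace (-l) y) (boostSpace (-l) y) 1 := by
      simpa using ((hasDerivAt_id (1 : ℝ)).smul_const (boostSpace (-l) y)).const_add z
    have h2 : HasDerivAt (fun s : ℝ => h (z + s • boostSpace (-l) y))
        (dirDeriv h (z + boostSpace (-l) y) (boostSpace (-l) y)) 1 := by
      rw [← H.fderiv_apply]
      have h3 := (H.differentiable (z + (1 : ℝ) • boostSpace (-l) y)).hasFDerivAt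
      convert! h3.comp_hasDerivAt (1 : ℝ) h1 using 1
      simp
    have h3 : HasDerivAt (fun s : ℝ => t + s * ‖y‖) ‖y‖ 1 := by
      simpa using ((hasDerivAt_id (1 : ℝ)).mul_const ‖y‖).const_add t
    have h4 : HasDerivAt (fun s : ℝ => ((t + s * ‖y‖) ^ k)⁻¹)
        (-(k : ℝ) * ((t + ‖y‖) ^ (k + 1))⁻¹ * ‖y‖) 1 := by
      have ht0 : t + ‖y‖ ≠ 0 := by positivity
      convert! (h3.pow k).fun_inv (by simpa using pow_ne_zero k ht0) using 1
      obtain ⟨k, rfl⟩ : ∃ n, k = n + 1 := ⟨k - 1, by omega⟩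
      simp
      field_simp
      ring
    have h5 : HasDerivAt (fun s : ℝ => (s * ‖y‖) ^ 2) (2 * ‖y‖ ^ 2) 1 := by
      convert! ((hasDerivAt_id (1 : ℝ)).mul_const ‖y‖).fun_pow 2 using 1
      simp
      ring
    have h6 := ((h5.mul h4).mul h2).const_mul (1 / 3)
    have h7 : (fun s : ℝ => Q (s • y)) =ᶠ[𝓝 1] fun s => 1 / 3 * ((s * ‖y‖) ^ 2 *
        ((t + s * ‖y‖) ^ k)⁻¹ * h (z + s • boostSpace (-l) y)) := by
      filter_upwards [lt_mem_nhds (zero_lt_one : (0 : ℝ) < 1)] with s hs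
      simp only [hQ]
      rw [norm_smul, Real.norm_of_nonneg hs.le, boostSpace_smul _ hs]
    refine HasDerivAt.congr_of_eventuallyEq ?_ h7
    convert! h6 using 1
    simp [hQ']
    ring
  · refine Continuous.continuousAt ?_
    have h0 : Continuous fun y : R5 => ((t + ‖y‖) ^ k)⁻¹ :=
      Continuous.inv₀ (by fun_prop) fun y => by positivity
    have h1 := H.continuous
    have h2 : Continuous fun y => h (z + boostSpace (-l) y) :=
      h1.comp (continuous_const.add (continuous_boostSpace (-l)))
    fun_prop

/-- The Lorentz boost turns the light cone integral into the boosted Duhamel operator. -/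
lemma integral_coneIntegrand' (hl : |l| < 1) (H : BrSym b h) (hk : 2 ≤ k) (hb : 3 ≤ b)
    (hkb : 6 ≤ k + b) {t : ℝ} (ht : 0 < t) (z : R5) :
    ∫ y, coneIntegrand' l k h t z y = boostInt l k h t z := by
  have iE := (integral_coneIntegrand hl H hk hb hkb ht z).2.1
  rw [integral_boost hl]
  rw [integrable_boost_iff hl] at iE
  obtain ⟨C₀, hC₀, H₀⟩ := H.bound
  have hB : Measurable fun y => z + boostSpace (-l) y :=
    (continuous_const.add (continuous_boostSpace (-l))).measurable
  have hm0 : Measurable fun y => h (z + boostSpace (-l) y) := H.continuous.measurable.comp hB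
  have iQ := (integrable_cone_two hl hk hb hkb ht z hm0 ⟨C₀, fun y => H₀ _⟩).const_mul
    (lorentzFactor l * l)
  rw [integrable_boost_iff hl] at iQ
  have iK := integrable_boostKer_mul hl H (by omega) hb (by omega) ht z (k := k)
  -- After the boost, `∂₁h` is evaluated at `z + y`, so it is a true derivative in `y₁`. This is its
  -- coefficient, and the discrepancy `D` between the two integrands is the exact derivative `∂₁(N
  -- h(z + ·))`.
  set N : R5 → ℝ := fun y => lorentzFactor l * l *
    ((boostTime l y)⁻¹ * ‖y‖⁻¹ * (phase l t y ^ k)⁻¹) with hN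
  have iN : Integrable fun y => N y * h (z + y) := by
    refine iQ.congr ?_
    filter_upwards [ae_ne_zero] with y hy
    have hy0 : ‖y‖ ≠ 0 := norm_ne_zero_iff.2 hy
    have hρ := (boostTime_pos hl hy).ne'
    rw [boostSpace_neg_boostSpace hl, norm_boostSpace hl]
    simp only [hN, phase]
    field_simp
  set D : R5 → ℝ := fun y => boostTime l y / ‖y‖ * coneIntegrand' l k h t z (boostSpace l y) -
    boostKer l k t y * h (z + y) with hD
  have iD : Integrable D := iE.sub iK
  have hzero := integral_lineDeriv_eq_zero (v := basisVec 0) (by simp) (Q' := D)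
    (fun y hy => ?_) iN iD
  · rw [integral_sub iE iK] at hzero
    rw [boostInt]
    linarith
  · have hy0 : ‖y‖ ≠ 0 := norm_ne_zero_iff.2 hy
    have hρ := (boostTime_pos hl hy).ne'
    have hp := (phase_pos hl ht y).ne'
    have hγ := lorentzFactor_sq hl
    have hinv : ∀ s : ℝ, s ≠ 0 → HasDerivAt (fun s : ℝ => (s ^ k)⁻¹) (-(k : ℝ) * (s ^ (k + 1))⁻¹) s := by
      intro s hs
      convert! (hasDerivAt_pow k s).fun_inv (pow_ne_zero k hs) using 1
      obtain ⟨k, rfl⟩ : ∃ n, k = n + 1 := ⟨k - 1, by omega⟩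
      simp only [Nat.add_sub_cancel]
      field_simp
      ring
    have d1 := (hasDerivAt_inv hρ).comp_hasFDerivAt y (hasFDerivAt_boostTime (l := l) hy)
    have d2 := (hasDerivAt_inv hy0).comp_hasFDerivAt y (hasFDerivAt_norm hy)
    have hph : HasFDerivAt (phase l t) _ y := (hasFDerivAt_boostTime (l := l) hy).const_add t
    have d3 := (hinv _ hp).comp_hasFDerivAt y hph
    have d4 : HasFDerivAt (fun y => h (z + y)) (fderiv ℝ h (z + y)) y :=
      ((H.differentiable (z + y)).hasFDerivAt.comp y ((hasFDerivAt_id y).const_add z))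
    have d5 := ((((d1.mul d2).mul d3).const_mul (lorentzFactor l * l)).mul d4).hasLineDerivAt
      (basisVec 0)
    convert! d5 using 1
    simp only [hD, coneIntegrand', boostKer, blockKer]
    rw [boostSpace_neg_boostSpace hl, norm_boostSpace hl]
    have e1 : t + boostTime l y = phase l t y := rfl
    rw [e1]
    simp [EuclideanSpace.inner_single_right]
    rw [show fderiv ℝ h (z + y) (EuclideanSpace.single 0 1) = pd 0 h (z + y) from rfl]
    have hρe : boostTime l y = lorentzFactor l * (‖y‖ + l * y 0) := rfl
    set ρ := boostTime l y
    set γ := lorentzFactor l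
    set a := phase l t y
    set n := ‖y‖
    -- Comparison of the coefficients of `a⁻ᵏ h` and of `k a⁻ᵏ⁻¹ h`. Both identities reduce to `γ²(1
    -- - ℓ²) = 1` once `ρ = γ(n + ℓ y₁)` is inserted.
    have cA : ρ⁻¹ ^ 2 * n⁻¹ = n⁻¹ ^ 3 - γ * l * (γ * n⁻¹ * y 0 + γ * l) * ρ⁻¹ ^ 2 * n⁻¹ -
        γ * l * ρ⁻¹ * n⁻¹ ^ 3 * y 0 := by
      field_simp
      rw [hρe]
      linear_combination (-n ^ 2) * hγ
    have cB : ρ⁻¹ * n⁻¹ = γ * n⁻¹ ^ 2 - γ * l * ρ⁻¹ * n⁻¹ * (γ * n⁻¹ * y 0 + γ * l) := by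
      field_simp
      rw [hρe]
      linear_combination (-n) * hγ
    have f1 : ρ / n * ((ρ ^ 3)⁻¹ * (a ^ k)⁻¹ * h (z + y) +
        k * ((ρ ^ 2)⁻¹ * (a ^ (k + 1))⁻¹ * h (z + y)) +
        γ * l * ((ρ ^ 2)⁻¹ * (a ^ k)⁻¹ * pd 0 h (z + y))) =
        (ρ⁻¹ ^ 2 * n⁻¹) * ((a ^ k)⁻¹ * h (z + y)) + (ρ⁻¹ * n⁻¹) * (k * (a ^ (k + 1))⁻¹ * h (z + y)) +
        γ * l * (ρ⁻¹ * n⁻¹) * ((a ^ k)⁻¹ * pd 0 h (z + y)) := by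
      field_simp
    rw [f1]
    nth_rewrite 1 [cA]
    nth_rewrite 1 [cB]
    simp only [inv_pow]
    field_simp
    ring

end Duhamel



/-! ### The representation formula for the Duhamel integral -/

section Representation

variable {l : ℝ} {k b : ℕ} {h : R5 → ℝ}

/-- The static profile `⟨z⟩⁻³`. -/
noncomputable def profile : R5 → ℝ := fun z => (bracket z ^ 3)⁻¹

lemma brSym_profile : BrSym 3 profile := BrSym.pow 3

/-- The factor produced by `∂_{x_i}` on functions of `x_ℓ`. -/
noncomputable def stretchCoef (l : ℝ) (i : Fin 5) : ℝ := if i = 0 then lorentzFactor l else 1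

lemma stretch_basisVec (l : ℝ) (i : Fin 5) :
    stretch l (basisVec i) = stretchCoef l i • basisVec i := by
  by_cases hi : i = 0
  · subst hi
    simp [stretch, stretchCoef, sub_smul]
  · have : ¬ (0 : Fin 5) = i := fun h => hi h.symm
    simp [stretch, stretchCoef, hi, this]

lemma fderiv_comp_xl (H : BrSym b h) (t : ℝ) (x v : R5) :
    fderiv ℝ (fun y => h (xl l t y)) x v = dirDeriv h (xl l t x) (stretch l v) := by
  have h1 : HasFDerivAt (fun y => h (xl l t y)) _ x :=
    (H.differentiable (xl l t x)).hasFDerivAt.comp x (hasFDerivAt_xl l t x)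
  rw [h1.fderiv, ContinuousLinearMap.comp_apply, H.fderiv_apply]

lemma contDiff_comp_xl (H : BrSym b h) (t : ℝ) : ContDiff ℝ ∞ fun y => h (xl l t y) :=
  have h1 : ContDiff ℝ ∞ fun y : R5 => xl l t y :=
    (contDiff_xl l).comp (f := fun y : R5 => (t, y)) (contDiff_prodMk_right t)
  H.contDiff.comp h1

/-- The propagator at time `s` sees exactly the sphere `|y| = s` of the cone. The weight `s⁴` is the
polar Jacobian, so integrating in `s` gives an integral over `ℝ⁵`. -/
lemma sinePropagator_source (H : BrSym b h) {t s : ℝ} (hs : 0 < s) (x : R5) :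
    sinePropagator s (fun y => ((t + s) ^ k)⁻¹ * h (xl l (t + s) y)) x =
      sphArea⁻¹ * (s ^ 4 * ∫ θ, coneIntegrand l k h t (xl l t x) (s • (θ : R5)) ∂sphMeasure) := by
  have hc : ContDiff ℝ 1 fun y => ((t + s) ^ k)⁻¹ * h (xl l (t + s) y) :=
    contDiff_const.mul ((contDiff_comp_xl H _).of_le (by simp))
  rw [sinePropagator_eq hc x hs, ← integral_const_mul (s ^ 4)]
  congr 1
  refine integral_congr_ae (.of_forall fun θ => ?_)
  have e : xl l (t + s) (x + s • (θ : R5)) = xl l t x + boostSpace (-l) (s • (θ : R5)) := by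
    rw [← xl_add, norm_smul_sphere hs]
  have hd : dirDeriv h (xl l (t + s) (x + s • (θ : R5))) (stretch l (s • (θ : R5))) =
      s * dirDeriv h (xl l (t + s) (x + s • (θ : R5))) (stretch l θ) := by
    rw [← H.fderiv_apply, ← H.fderiv_apply, map_smul, map_smul, smul_eq_mul]
  simp only [coneIntegrand]
  rw [fderiv_const_mul ((contDiff_comp_xl H _).differentiable (by simp) _), ← e, hd,
    norm_smul_sphere hs, smul_apply, fderiv_comp_xl H, smul_eq_mul]
  field_simp

lemma duhamel_source (hl : |l| < 1) (H : BrSym b h) (hk : 2 ≤ k) (hb : 3 ≤ b)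
    (hkb : 6 ≤ k + b) {t : ℝ} (ht : 0 < t) (x : R5) :
    IntegrableOn (fun s => sinePropagator s
      (fun y => ((t + s) ^ k)⁻¹ * h (xl l (t + s) y)) x) (Ioi 0) ∧
    ∫ s in Ioi (0 : ℝ), sinePropagator s (fun y => ((t + s) ^ k)⁻¹ * h (xl l (t + s) y)) x =
      (3 * sphArea)⁻¹ * boostInt l k h t (xl l t x) := by
  obtain ⟨i1, -, e1⟩ := integral_coneIntegrand hl H hk hb hkb ht (xl l t x)
  have e2 := integral_coneIntegrand' hl H hk hb hkb ht (xl l t x)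
  have hcongr : ∀ s ∈ Ioi (0 : ℝ), sphArea⁻¹ * (s ^ 4 *
      ∫ θ, coneIntegrand l k h t (xl l t x) (s • (θ : R5)) ∂sphMeasure) =
      sinePropagator s (fun y => ((t + s) ^ k)⁻¹ * h (xl l (t + s) y)) x :=
    fun s hs => (sinePropagator_source H hs x).symm
  constructor
  · exact IntegrableOn.congr_fun ((integrable_polar' i1).const_mul _) hcongr measurableSet_Ioi
  · rw [← setIntegral_congr_fun measurableSet_Ioi hcongr, integral_const_mul,
      ← integral_polar' i1, e1, e2, mul_inv]
    ring

lemma gSharp_eq (l t : ℝ) (x : R5) :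
    gSharp l t x = l * lorentzFactor l * ((t ^ 2)⁻¹ * pd 0 profile (xl l t x)) := by
  have h1 : partialX 0 (fun τ y => (bracket (xl l τ y) ^ 3)⁻¹) t x =
      dirDeriv profile (xl l t x) (stretch l (basisVec 0)) := fderiv_comp_xl brSym_profile t x _
  rw [gSharp, h1, stretch_basisVec, ← brSym_profile.fderiv_apply, map_smul, stretchCoef, if_pos rfl,
    smul_eq_mul, pd]
  ring

lemma duhamelIntegrand_eq (l t : ℝ) (x : R5) (s : ℝ) :
    duhamelIntegrand l t x s =
      sinePropagator s (fun y => ((t + s) ^ 3)⁻¹ * profile (xl l (t + s) y)) x +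
      l * lorentzFactor l *
        sinePropagator s (fun y => ((t + s) ^ 2)⁻¹ * pd 0 profile (xl l (t + s) y)) x := by
  set f : R5 → ℝ := fun y => ((t + s) ^ 3)⁻¹ * profile (xl l (t + s) y)
  set g : R5 → ℝ := fun y => ((t + s) ^ 2)⁻¹ * pd 0 profile (xl l (t + s) y)
  have hf : ContDiff ℝ 1 f :=
    contDiff_const.mul ((contDiff_comp_xl brSym_profile _).of_le (by simp))
  have hg : ContDiff ℝ 1 g :=
    contDiff_const.mul ((contDiff_comp_xl (brSym_profile.pd 0) _).of_le (by simp))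
  have hsum : (fun y => fSharp l (t + s) y + gSharp l (t + s) y) =
      fun y => f y + l * lorentzFactor l * g y := by
    ext y
    rw [gSharp_eq]
    rfl
  have hmean : ∀ σ, sphMean (fun y => f y + l * lorentzFactor l * g y) x σ =
      sphMean f x σ + l * lorentzFactor l * sphMean g x σ := by
    intro σ
    have i1 : Integrable (fun θ : sphere (0 : R5) 1 => f (x + σ • (θ : R5))) sphMeasure :=
      integrable_sphere_of_continuous (hf.continuous.comp (by fun_prop))
    have i2 : Integrable (fun θ : sphere (0 : R5) 1 => g (x + σ • (θ : R5))) sphMeasure :=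
      integrable_sphere_of_continuous (hg.continuous.comp (by fun_prop))
    rw [sphMean_eq, sphMean_eq, sphMean_eq, integral_add i1 (i2.const_mul _),
      integral_const_mul (l * lorentzFactor l)]
    ring
  have d1 := (hasDerivAt_pow 3 s).fun_mul (hasDerivAt_sphMean hf x s)
  have d2 := (hasDerivAt_pow 3 s).fun_mul (hasDerivAt_sphMean hg x s)
  rw [duhamelIntegrand, hsum, sinePropagator, sinePropagator, sinePropagator]
  have e : (fun σ => σ ^ 3 * sphMean (fun y => f y + l * lorentzFactor l * g y) x σ) =
      fun σ => σ ^ 3 * sphMean f x σ + l * lorentzFactor l * (σ ^ 3 * sphMean g x σ) := by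
    ext σ
    rw [hmean]
    ring
  rw [e, (d1.fun_add (d2.const_mul (l * lorentzFactor l))).deriv, d1.deriv, d2.deriv]
  ring

lemma integrableOn_duhamelIntegrand (hl : |l| < 1) {t : ℝ} (ht : 0 < t) (x : R5) :
    IntegrableOn (duhamelIntegrand l t x) (Ioi 0) := by
  obtain ⟨i1, -⟩ := duhamel_source hl brSym_profile (k := 3) (by norm_num) le_rfl le_rfl ht x
  obtain ⟨i2, -⟩ := duhamel_source hl (brSym_profile.pd 0) (k := 2) le_rfl (by norm_num) le_rfl ht x
  exact (i1.add (i2.const_mul (l * lorentzFactor l))).congr_fun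
    (fun s _ => (duhamelIntegrand_eq l t x s).symm) measurableSet_Ioi

/-- The two sources correspond to `(k, b) = (3, 3)` and `(2, 4)`, both at the threshold `k + b = 6`.
The factor `γ` accompanying `ℓ` comes from `∂₁` acting through `x_ℓ`. -/
lemma vSharp_eq (hl : |l| < 1) {t : ℝ} (ht : 0 < t) (x : R5) :
    vSharp l t x = (3 * sphArea)⁻¹ * boostInt l 3 profile t (xl l t x) +
      (3 * sphArea)⁻¹ * (l * lorentzFactor l) * boostInt l 2 (pd 0 profile) t (xl l t x) := by
  obtain ⟨i1, e1⟩ := duhamel_source hl brSym_profile (k := 3) (by norm_num) le_rfl le_rfl ht x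
  obtain ⟨i2, e2⟩ :=
    duhamel_source hl (brSym_profile.pd 0) (k := 2) le_rfl (by norm_num) le_rfl ht x
  rw [vSharp, setIntegral_congr_fun measurableSet_Ioi
    (fun s _ => duhamelIntegrand_eq l t x s), integral_add i1 (i2.const_mul _),
    integral_const_mul, e1, e2]
  ring

end Representation

/-! ### Pointwise decay of the solution and its derivatives -/

section Bounds

variable {l : ℝ} {k b : ℕ} {h : R5 → ℝ}

/-- The parameter `j` exchanges a power of `t` for a power of `⟨z⟩`. The cap `b' ≤ 5` means that
symbol decay beyond order five is not exploited. -/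
lemma abs_boostInt_le (hl : |l| < 1) (H : BrSym b h) {m j b' : ℕ} (hk : k = m + j + 1)
    (hj : j ≤ 1) (hb : b' ≤ b) (hb' : b' ≤ 5) (hjb : 4 ≤ j + b') {δ : ℝ} (hδ : 0 < δ)
    (hδ' : δ < 1) : ∃ C, 0 ≤ C ∧ ∀ t : ℝ, 1 ≤ t → ∀ z : R5,
    |boostInt l k h t z| ≤
      C * ((t + bracket z)⁻¹ * (t ^ m)⁻¹ * bracket z ^ (2 - j - b' + δ : ℝ)) := by
  obtain ⟨C₁, hC₁, H₁⟩ := abs_boostKer_mul_le hl k H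
  obtain ⟨C₂, hC₂, H₂⟩ := integral_convKernel_le (a := 3 + j) (b := b') (by omega) hb'
    (by omega) hδ hδ'
  refine ⟨C₁ * C₂, by positivity, fun t ht z => ?_⟩
  have ht0 : 0 < t := by linarith
  obtain ⟨i1, e1⟩ := H₂ t ht z
  have hle := norm_integral_le_of_norm_le (f := fun y => boostKer l k t y * h (z + y))
    (i1.const_mul (C₁ * (t ^ m)⁻¹)) (by
      filter_upwards [ae_ne_zero] with y hy
      rw [mul_assoc]
      refine (H₁ m j hk t ht0 z y hy).trans ?_
      gcongr
      exact convKernel_anti hb ht0 z y)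
  rw [integral_const_mul, Real.norm_eq_abs] at hle
  have hx : (5 - ((3 + j : ℕ) : ℝ) - b' + δ) = 2 - j - b' + δ := by push_cast; ring
  rw [hx] at e1
  calc _ ≤ _ := hle
    _ ≤ C₁ * (t ^ m)⁻¹ * (C₂ * ((t + bracket z)⁻¹ * bracket z ^ (2 - j - b' + δ : ℝ))) := by
      gcongr
    _ = _ := by ring

/-- Putting the derivative on the kernel raises its singularity to `|y|⁻⁴`. This gains a power of
`⟨z⟩` out of reach of `abs_boostInt_le` with `j = 0`, without spending a power of `t`. -/
lemma abs_boostInt_pd_le (hl : |l| < 1) (H : BrSym b h) {m : ℕ} (hk : k = m + 1)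
    (hb : 5 ≤ b) (i : Fin 5) {δ : ℝ} (hδ : 0 < δ)
    (hδ' : δ < 1) : ∃ C, 0 ≤ C ∧ ∀ t : ℝ, 1 ≤ t → ∀ z : R5,
    |boostInt l k (pd i h) t z| ≤
      C * ((t + bracket z)⁻¹ * (t ^ m)⁻¹ * bracket z ^ (-4 + δ : ℝ)) := by
  obtain ⟨C₁, hC₁, H₁⟩ := abs_boostKerDeriv_mul_le hl k H
  obtain ⟨C₂, hC₂, H₂⟩ := integral_convKernel_le (a := 4) (b := 5) (by omega) (by omega)
    (by omega) hδ hδ'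
  refine ⟨C₁ * C₂, by positivity, fun t ht z => ?_⟩
  have ht0 : 0 < t := by linarith
  obtain ⟨i1, e1⟩ := H₂ t ht z
  rw [boostInt_pd hl H (by omega) (by omega) (by omega) ht0 z i, abs_neg]
  have hle := norm_integral_le_of_norm_le
    (f := fun y => boostKerDeriv l k t y (basisVec i) * h (z + y))
    (i1.const_mul (C₁ * (t ^ m)⁻¹)) (by
      filter_upwards [ae_ne_zero] with y hy
      rw [mul_assoc]
      refine (H₁ m 0 hk t ht0 z y hy i).trans ?_
      gcongr
      exact convKernel_anti hb ht0 z y)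
  rw [integral_const_mul, Real.norm_eq_abs] at hle
  have hx : (5 - ((4 : ℕ) : ℝ) - (5 : ℕ) + δ) = -4 + δ := by push_cast; ring
  rw [hx] at e1
  calc _ ≤ _ := hle
    _ ≤ C₁ * (t ^ m)⁻¹ * (C₂ * ((t + bracket z)⁻¹ * bracket z ^ (-4 + δ : ℝ))) := by
      gcongr
    _ = _ := by ring

/-- `F` coincides for positive times with a combination of two boosted Duhamel integrals. -/
def IsBoostComb (l : ℝ) (A : ℝ) (k : ℕ) (h : R5 → ℝ) (A' : ℝ) (k' : ℕ) (h' : R5 → ℝ)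
    (F : ℝ → R5 → ℝ) : Prop :=
  ∀ t, 0 < t → ∀ x, F t x =
    A * boostInt l k h t (xl l t x) + A' * boostInt l k' h' t (xl l t x)

lemma hasFDerivAt_boostInt_space (hl : |l| < 1) (H : BrSym b h) (hk : 1 ≤ k) (hb : 3 ≤ b)
    (hkb : 5 ≤ k + b) {t : ℝ} (ht : 0 < t) (z : R5) :
    HasFDerivAt (boostInt l k h t)
      (∑ i, boostInt l k (pd i h) t z • (EuclideanSpace.proj i : R5 →L[ℝ] ℝ)) z := by
  have h1 := (hasFDerivAt_boostInt hl H hk hb hkb (p := (t, z)) ht).comp z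
    ((hasFDerivAt_const t z).prodMk (hasFDerivAt_id z))
  convert! h1 using 1
  ext v
  simp

lemma hasFDerivAt_boostInt_xl (hl : |l| < 1) (H : BrSym b h) (hk : 1 ≤ k) (hb : 3 ≤ b)
    (hkb : 5 ≤ k + b) {t : ℝ} (ht : 0 < t) (x : R5) :
    HasFDerivAt (fun x => boostInt l k h t (xl l t x))
      ((∑ i, boostInt l k (pd i h) t (xl l t x) • (EuclideanSpace.proj i : R5 →L[ℝ] ℝ)) ∘L
        stretch l) x :=
  (hasFDerivAt_boostInt_space hl H hk hb hkb ht (xl l t x)).comp x (hasFDerivAt_xl l t x)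

lemma hasDerivAt_boostInt_xl (hl : |l| < 1) (H : BrSym b h) (hk : 1 ≤ k) (hb : 3 ≤ b)
    (hkb : 5 ≤ k + b) {t : ℝ} (ht : 0 < t) (x : R5) :
    HasDerivAt (fun t => boostInt l k h t (xl l t x))
      (-(k : ℝ) * boostInt l (k + 1) h t (xl l t x) -
        l * (lorentzFactor l * boostInt l k (pd 0 h) t (xl l t x))) t := by
  have h0 : HasDerivAt (fun t => xl l t x) (-(lorentzFactor l * l) • basisVec 0) t := by
    simp only [xl_eq]
    convert! ((((hasDerivAt_id t).const_mul (lorentzFactor l * l)).smul_const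
      (basisVec 0)).const_sub (stretch l x)) using 1
    simp
  have h1 := (hasFDerivAt_boostInt hl H hk hb hkb (p := (t, xl l t x)) ht).comp_hasDerivAt t
    ((hasDerivAt_id t).prodMk h0)
  convert! h1 using 1
  simp [mul_ite]
  ring

variable {k' b' : ℕ} {h' : R5 → ℝ} {A A' : ℝ} {F : ℝ → R5 → ℝ}

lemma IsBoostComb.partialX (hl : |l| < 1) (hF : IsBoostComb l A k h A' k' h' F)
    (H : BrSym b h) (hk : 1 ≤ k) (hb : 3 ≤ b) (hkb : 5 ≤ k + b)
    (H' : BrSym b' h') (hk' : 1 ≤ k') (hb' : 3 ≤ b') (hkb' : 5 ≤ k' + b') (i : Fin 5) :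
    IsBoostComb l (A * stretchCoef l i) k (pd i h) (A' * stretchCoef l i) k' (pd i h')
      (partialX i F) := by
  intro t ht x
  have h1 := ((hasFDerivAt_boostInt_xl hl H hk hb hkb ht x).const_mul A).fun_add
    ((hasFDerivAt_boostInt_xl hl H' hk' hb' hkb' ht x).const_mul A')
  have h2 : F t = fun x => A * boostInt l k h t (xl l t x) +
    A' * boostInt l k' h' t (xl l t x) := funext (hF t ht)
  rw [_root_.partialX, h2, h1.fderiv]
  simp only [add_apply, smul_apply, ContinuousLinearMap.comp_apply]
  rw [show EuclideanSpace.single i (1 : ℝ) = basisVec i from rfl, stretch_basisVec]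
  simp
  ring

/-- The operator `A_ℓ` annihilates `x_ℓ`: the transport part of `∂_t` cancels `ℓ∂₁`, and only the
explicit time derivative of the kernel remains. -/
lemma IsBoostComb.opA (hl : |l| < 1) (hF : IsBoostComb l A k h A' k' h' F)
    (H : BrSym b h) (hk : 1 ≤ k) (hb : 3 ≤ b) (hkb : 5 ≤ k + b)
    (H' : BrSym b' h') (hk' : 1 ≤ k') (hb' : 3 ≤ b') (hkb' : 5 ≤ k' + b') :
    IsBoostComb l (-(A * k)) (k + 1) h (-(A' * k')) (k' + 1) h' (opA l F) := by
  intro t ht x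
  have h1 := ((hasDerivAt_boostInt_xl hl H hk hb hkb ht x).const_mul A).fun_add
    ((hasDerivAt_boostInt_xl hl H' hk' hb' hkb' ht x).const_mul A')
  have h2 : (fun τ => F τ x) =ᶠ[𝓝 t] fun t => A * boostInt l k h t (xl l t x) +
      A' * boostInt l k' h' t (xl l t x) := by
    filter_upwards [lt_mem_nhds ht] with τ hτ using hF τ hτ x
  rw [_root_.opA, partialT, h2.deriv_eq, h1.deriv,
    hF.partialX hl H hk hb hkb H' hk' hb' hkb' 0 t ht x, stretchCoef, if_pos rfl]
  ring

lemma IsBoostComb.opA_iterate (hl : |l| < 1) (hF : IsBoostComb l A k h A' k' h' F)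
    (H : BrSym b h) (hk : 1 ≤ k) (hb : 3 ≤ b) (hkb : 5 ≤ k + b)
    (H' : BrSym b' h') (hk' : 1 ≤ k') (hb' : 3 ≤ b') (hkb' : 5 ≤ k' + b') (m : ℕ) :
    ∃ B B' : ℝ, IsBoostComb l B (k + m) h B' (k' + m) h' ((_root_.opA l)^[m] F) := by
  induction m with
  | zero => exact ⟨A, A', hF⟩
  | succ m ih =>
    obtain ⟨B, B', hB⟩ := ih
    rw [Function.iterate_succ_apply']
    exact ⟨_, _, hB.opA hl (k := k + m) (k' := k' + m) H (by omega) hb (by omega) H' (by omega) hb'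
      (by omega)⟩

/-- `F` has the structure of a space derivative of order `n` of `v♯`. -/
def IsDerivComb (l : ℝ) (n : ℕ) (F : ℝ → R5 → ℝ) : Prop :=
  ∃ A A' h h', BrSym (3 + n) h ∧ BrSym (4 + n) h' ∧
    (1 ≤ n → ∃ i g, BrSym (3 + n) g ∧ h' = pd i g) ∧ IsBoostComb l A 3 h A' 2 h' F

lemma IsDerivComb.partialX_iterate {n : ℕ} (hl : |l| < 1) (hF : IsDerivComb l n F) (i : Fin 5)
    (j : ℕ) : IsDerivComb l (n + j) ((partialX i)^[j] F) := by
  induction j with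
  | zero => exact hF
  | succ j ih =>
    rw [Function.iterate_succ_apply']
    obtain ⟨A, A', h, h', H, H', -, hF⟩ := ih
    refine ⟨_, _, _, _, H.pd i, H'.pd i, fun _ => ⟨i, h', ?_, rfl⟩,
      hF.partialX hl H (by omega) (by omega) (by omega) H' (by omega) (by omega) (by omega) i⟩
    convert! H' using 1
    ring

lemma isDerivComb_partialAlpha (hl : |l| < 1) (α : Fin 5 → ℕ) :
    IsDerivComb l (∑ i, α i) (partialAlpha α (vSharp l)) := by
  have h0 : IsDerivComb l 0 (vSharp l) :=
    ⟨_, _, _, _, brSym_profile, brSym_profile.pd 0, by omega, fun t ht x => vSharp_eq hl ht x⟩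
  have h1 := ((((h0.partialX_iterate hl 4 (α 4)).partialX_iterate hl 3 (α 3)).partialX_iterate
    hl 2 (α 2)).partialX_iterate hl 1 (α 1)).partialX_iterate hl 0 (α 0)
  convert! h1 using 1
  rw [Fin.sum_univ_five]
  ring

lemma abs_add_mul_le {a b A B u v R : ℝ} (h1 : |u| ≤ a * R) (h2 : |v| ≤ b * R) :
    |A * u + B * v| ≤ (|A| * a + |B| * b) * R := by
  refine (abs_add_le _ _).trans ?_
  rw [abs_mul, abs_mul, add_mul, mul_assoc, mul_assoc]
  gcongr

lemma decay_vSharp (hl : |l| < 1) {δ : ℝ} (hδ : 0 < δ) (hδ' : δ < 1) (m : ℕ) :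
    ∃ C : ℝ, ∀ t : ℝ, 1 < t → ∀ x : R5, |((opA l)^[m] (vSharp l)) t x| ≤
      C * ((t + bracket (xl l t x))⁻¹ * (t ^ (1 + m))⁻¹ * bracket (xl l t x) ^ (-2 + δ)) := by
  have h0 : IsBoostComb l _ 3 profile _ 2 (pd 0 profile) (vSharp l) :=
    fun t ht x => vSharp_eq hl ht x
  obtain ⟨B, B', hB⟩ := h0.opA_iterate hl brSym_profile (by omega) le_rfl (by omega)
    (brSym_profile.pd 0) (by omega) (by omega) (by omega) m
  -- The first source has one more power of `t⁻¹`, traded for `⟨z⟩⁻¹` by `j = 1`. The second has one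
  -- more power of the bracket and takes `j = 0`. Both end at `⟨z⟩^{-2+δ}`.
  obtain ⟨C₁, -, H₁⟩ := abs_boostInt_le hl brSym_profile (k := 3 + m) (m := 1 + m) (j := 1)
    (b' := 3) (by omega) le_rfl le_rfl (by omega) (by omega) hδ hδ'
  obtain ⟨C₂, -, H₂⟩ := abs_boostInt_le hl (brSym_profile.pd 0) (k := 2 + m) (m := 1 + m) (j := 0)
    (b' := 4) (by omega) (by omega) le_rfl (by omega) (by omega) hδ hδ'
  refine ⟨|B| * C₁ + |B'| * C₂, fun t ht x => ?_⟩
  rw [hB t (by linarith) x]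
  have e₁ := H₁ t ht.le (xl l t x)
  have e₂ := H₂ t ht.le (xl l t x)
  norm_num at e₁ e₂
  exact abs_add_mul_le e₁ e₂

lemma decay_vSharp_one (hl : |l| < 1) {δ : ℝ} (hδ : 0 < δ) (hδ' : δ < 1) (m : ℕ)
    {α : Fin 5 → ℕ} (hα : ∑ i, α i = 1) :
    ∃ C : ℝ, ∀ t : ℝ, 1 < t → ∀ x : R5, |((opA l)^[m] (partialAlpha α (vSharp l))) t x| ≤
      C * ((t + bracket (xl l t x))⁻¹ * (t ^ (1 + m))⁻¹ * bracket (xl l t x) ^ (-3 + δ)) := by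
  obtain ⟨A, A', h, h', H, H', -, h0⟩ := isDerivComb_partialAlpha hl α
  rw [hα] at H H'
  obtain ⟨B, B', hB⟩ := h0.opA_iterate hl H (by omega) (by omega) (by omega)
    H' (by omega) (by omega) (by omega) m
  obtain ⟨C₁, -, H₁⟩ := abs_boostInt_le hl H (k := 3 + m) (m := 1 + m) (j := 1)
    (b' := 4) (by omega) le_rfl le_rfl (by omega) (by omega) hδ hδ'
  obtain ⟨C₂, -, H₂⟩ := abs_boostInt_le hl H' (k := 2 + m) (m := 1 + m) (j := 0)
    (b' := 5) (by omega) (by omega) le_rfl (by omega) (by omega) hδ hδ'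
  refine ⟨|B| * C₁ + |B'| * C₂, fun t ht x => ?_⟩
  rw [hB t (by linarith) x]
  have e₁ := H₁ t ht.le (xl l t x)
  have e₂ := H₂ t ht.le (xl l t x)
  norm_num at e₁ e₂
  exact abs_add_mul_le e₁ e₂

lemma decay_vSharp_two (hl : |l| < 1) {δ : ℝ} (hδ : 0 < δ) (hδ' : δ < 1) (m : ℕ)
    {α : Fin 5 → ℕ} (hα : 2 ≤ ∑ i, α i) :
    ∃ C : ℝ, ∀ t : ℝ, 1 < t → ∀ x : R5, |((opA l)^[m] (partialAlpha α (vSharp l))) t x| ≤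
      C * ((t + bracket (xl l t x))⁻¹ * (t ^ (1 + m))⁻¹ * bracket (xl l t x) ^ (-4 + δ)) := by
  obtain ⟨A, A', h, h', H, H', hg, h0⟩ := isDerivComb_partialAlpha hl α
  obtain ⟨B, B', hB⟩ := h0.opA_iterate hl H (by omega) (by omega) (by omega)
    H' (by omega) (by omega) (by omega) m
  -- With `j = 0` the direct bound would stop at `⟨z⟩^{-3+δ}`. Writing the second function as a
  -- derivative of a symbol of order at least five allows integration by parts.
  obtain ⟨i, g, G, rfl⟩ := hg (by omega)
  obtain ⟨C₁, -, H₁⟩ := abs_boostInt_le hl H (k := 3 + m) (m := 1 + m) (j := 1)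
    (b' := 5) (by omega) le_rfl (by omega) (by omega) (by omega) hδ hδ'
  obtain ⟨C₂, -, H₂⟩ := abs_boostInt_pd_le hl G (k := 2 + m) (m := 1 + m) (by omega) (by omega)
    i hδ hδ'
  refine ⟨|B| * C₁ + |B'| * C₂, fun t ht x => ?_⟩
  rw [hB t (by linarith) x]
  have e₁ := H₁ t ht.le (xl l t x)
  have e₂ := H₂ t ht.le (xl l t x)
  norm_num at e₁ e₂
  exact abs_add_mul_le e₁ e₂

lemma contDiffOn_vSharp (hl : |l| < 1) :
    ContDiffOn ℝ ∞ (fun p : ℝ × R5 => vSharp l p.1 p.2) (Ioi (0 : ℝ) ×ˢ univ) := by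
  have hmaps : MapsTo (fun p : ℝ × R5 => (p.1, xl l p.1 p.2)) (Ioi (0 : ℝ) ×ˢ univ)
      (Ioi (0 : ℝ) ×ˢ univ) := fun p hp => ⟨hp.1, mem_univ _⟩
  have hc : ContDiffOn ℝ ∞ (fun p : ℝ × R5 => (p.1, xl l p.1 p.2)) (Ioi (0 : ℝ) ×ˢ univ) :=
    (contDiff_fst.prodMk (contDiff_xl l)).contDiffOn
  have h1 := (contDiffOn_boostInt hl brSym_profile (k := 3) (by omega) le_rfl
    (by omega)).comp hc hmaps
  have h2 := (contDiffOn_boostInt hl (brSym_profile.pd 0) (k := 2) (by omega) (by omega)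
    (by omega)).comp hc hmaps
  exact ((contDiffOn_const.mul h1).add (contDiffOn_const.mul h2)).congr
    fun p hp => vSharp_eq hl hp.1 p.2

end Bounds



/-! ### Green's identity and the concentrated density -/

section Green

variable {l : ℝ}

/-- The density `⟨z⟩⁻⁷`, proportional to the Laplacian of the profile. -/
noncomputable def density : R5 → ℝ := fun z => (bracket z ^ 7)⁻¹

lemma brSym_density : BrSym 7 density := BrSym.pow 7

lemma pd_profile (i : Fin 5) (z : R5) : pd i profile z = -3 * (z i * (bracket z ^ 5)⁻¹) := by
  rw [pd, show profile = fun z => (bracket z ^ 3)⁻¹ from rfl,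
    (hasFDerivAt_bracket_pow_inv 3 z).fderiv]
  simp [EuclideanSpace.inner_single_right]
  ring

lemma norm_sq_eq_sum (z : R5) : ‖z‖ ^ 2 = ∑ i, z i ^ 2 := by
  rw [EuclideanSpace.norm_sq_eq]
  simp

lemma laplacian_profile (z : R5) : ∑ i, pd i (pd i profile) z = -15 * density z := by
  have h : ∀ i : Fin 5, pd i (pd i profile) z =
      -3 * (bracket z ^ 5)⁻¹ + 15 * (z i ^ 2 * (bracket z ^ 7)⁻¹) := by
    intro i
    have h0 : HasFDerivAt (fun x : R5 => x i) (EuclideanSpace.proj i : R5 →L[ℝ] ℝ) z :=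
      (EuclideanSpace.proj i : R5 →L[ℝ] ℝ).hasFDerivAt
    have h1 : HasFDerivAt (fun x : R5 => -3 * (x i * (bracket x ^ 5)⁻¹)) _ z :=
      (h0.mul (hasFDerivAt_bracket_pow_inv 5 z)).const_mul (-3)
    rw [pd, show pd i profile = fun x : R5 => -3 * (x i * (bracket x ^ 5)⁻¹) from
      funext (pd_profile i), h1.fderiv]
    simp [EuclideanSpace.inner_single_right]
    ring
  simp only [h]
  rw [Finset.sum_add_distrib, ← Finset.mul_sum Finset.univ (fun x => z x ^ 2 * (bracket z ^ 7)⁻¹),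
    ← Finset.sum_mul Finset.univ (fun x => z x ^ 2), ← norm_sq_eq_sum]
  have hb := (bracket_pos z).ne'
  have h2 : ‖z‖ ^ 2 = bracket z ^ 2 - 1 := by rw [bracket_sq]; ring
  rw [h2, density]
  simp
  field_simp
  ring

lemma sum_boostKerDeriv_mul (k : ℕ) (t : ℝ) (y : R5) (h : R5 → ℝ) (w : R5) :
    ∑ i, boostKerDeriv l k t y (basisVec i) * pd i h w =
      -(3 * blockKer l 5 k t y + 3 * k * lorentzFactor l * blockKer l 4 (k + 1) t y +
        k * (k + 1) * lorentzFactor l ^ 2 * blockKer l 3 (k + 2) t y) * dirDeriv h w y -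
      k * lorentzFactor l * l * boostKer l (k + 1) t y * pd 0 h w := by
  have e : ∀ i, boostKerDeriv l k t y (basisVec i) * pd i h w =
      -(3 * blockKer l 5 k t y + 3 * k * lorentzFactor l * blockKer l 4 (k + 1) t y +
        k * (k + 1) * lorentzFactor l ^ 2 * blockKer l 3 (k + 2) t y) * (pd i h w * y i) -
      (k * lorentzFactor l * l * boostKer l (k + 1) t y) *
        ((if i = 0 then 1 else 0) * pd i h w) := by
    intro i
    have : boostKerDeriv l k t y (basisVec i) = blockDeriv l 3 k t y (basisVec i) +
      k * lorentzFactor l * blockDeriv l 2 (k + 1) t y (basisVec i) := rfl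
    rw [this, blockDeriv_basisVec, blockDeriv_basisVec, boostKer]
    push_cast
    ring
  simp only [e]
  rw [Finset.sum_sub_distrib, ← Finset.mul_sum, ← Finset.mul_sum]
  simp [dirDeriv]

lemma boostTime_smul (l : ℝ) {s : ℝ} (hs : 0 < s) (y : R5) :
    boostTime l (s • y) = s * boostTime l y := by
  rw [boostTime, boostTime, norm_smul, Real.norm_of_nonneg hs.le]
  simp
  ring

/-- The bracket on the left is the radial derivative of the weight `g` in `green_identity`. Through
`γ²(1 - ℓ²) = 1` it recombines into the kernel of the first source and the `y₁`-derivative of the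
kernel of the second. -/
lemma green_kernel_identity (hl : |l| < 1) {t : ℝ} (ht : 0 < t) {y : R5} (hy : y ≠ 0) :
    (‖y‖ ^ 5)⁻¹ * (-3 * boostTime l y * (phase l t y ^ 2)⁻¹ +
      3 * lorentzFactor l * ‖y‖ * (phase l t y ^ 2)⁻¹ -
      6 * lorentzFactor l * ‖y‖ * boostTime l y * (phase l t y ^ 3)⁻¹ +
      4 * lorentzFactor l ^ 2 * ‖y‖ ^ 2 * (phase l t y ^ 3)⁻¹ -
      6 * lorentzFactor l ^ 2 * ‖y‖ ^ 2 * boostTime l y * (phase l t y ^ 4)⁻¹) =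
    -2 * boostKer l 3 t y + l * lorentzFactor l * boostKerDeriv l 2 t y (basisVec 0) := by
  have : boostKerDeriv l 2 t y (basisVec 0) = blockDeriv l 3 2 t y (basisVec 0) +
    (2 : ℕ) * lorentzFactor l * blockDeriv l 2 (2 + 1) t y (basisVec 0) := rfl
  have hy0 : ‖y‖ ≠ 0 := norm_ne_zero_iff.2 hy
  have hp := (phase_pos hl ht y).ne'
  have hγ := lorentzFactor_sq hl
  rw [this, blockDeriv_basisVec, blockDeriv_basisVec, boostKer]
  simp only [blockKer]
  rw [show boostTime l y = lorentzFactor l * (‖y‖ + l * y 0) from rfl]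
  set γ := lorentzFactor l
  set a := phase l t y
  set n := ‖y‖
  have e1 : (n ^ 5)⁻¹ * n ^ 2 = (n ^ 3)⁻¹ := by field_simp
  have e2 : (n ^ 5)⁻¹ * n ^ 3 = (n ^ 2)⁻¹ := by field_simp
  have e3 : (n ^ 5)⁻¹ * n = (n ^ 4)⁻¹ := by field_simp
  push_cast
  norm_num
  rw [← e1, ← e2, ← e3]
  linear_combination (-2 * ((n ^ 5)⁻¹ * n ^ 2) * (a ^ 3)⁻¹ -
    6 * γ * ((n ^ 5)⁻¹ * n ^ 3) * (a ^ 4)⁻¹) * hγ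

/-- Green's identity for the boosted kernel. -/
lemma green_identity (hl : |l| < 1) {t : ℝ} (ht : 0 < t) (z : R5) :
    -15 * boostInt l 1 density t z = 2 * boostInt l 3 profile t z +
      2 * (l * lorentzFactor l) * boostInt l 2 (pd 0 profile) t z -
      3 * sphArea * t⁻¹ * profile z := by
  set γ := lorentzFactor l with hγ
  set P : R5 → ℝ := fun y => 3 * blockKer l 5 1 t y + 3 * γ * blockKer l 4 2 t y +
    2 * γ ^ 2 * blockKer l 3 3 t y with hP
  have U := brSym_profile
  have i1 : ∀ i, Integrable fun y => boostKer l 1 t y * pd i (pd i profile) (z + y) :=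
    fun i => integrable_boostKer_mul hl ((U.pd i).pd i) le_rfl (by omega) (by omega) ht z
  have i2 : ∀ i, Integrable fun y => boostKerDeriv l 1 t y (basisVec i) * pd i profile (z + y) :=
    fun i => integrable_boostKerDeriv_mul hl (U.pd i) le_rfl (by omega) ht z i
  have i3 := integrable_boostKer_mul hl (U.pd 0) (k := 2) (by omega) (by omega) (by omega) ht z
  have hsum : (fun y => P y * dirDeriv profile (z + y) y) = fun y =>
      -(∑ i, boostKerDeriv l 1 t y (basisVec i) * pd i profile (z + y)) -
        γ * l * (boostKer l 2 t y * pd 0 profile (z + y)) := by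
    ext y
    rw [sum_boostKerDeriv_mul]
    simp only [hP]
    push_cast
    ring
  have i2s : Integrable fun y => ∑ i, boostKerDeriv l 1 t y (basisVec i) * pd i profile (z + y) :=
    integrable_finsetSum _ fun i _ => i2 i
  have iP : Integrable fun y => P y * dirDeriv profile (z + y) y := by
    rw [hsum]
    exact i2s.neg.sub (i3.const_mul _)
  have hlhs : -15 * boostInt l 1 density t z = γ * l * boostInt l 2 (pd 0 profile) t z +
      ∫ y, P y * dirDeriv profile (z + y) y := by
    have e1 : -15 * boostInt l 1 density t z = ∑ i, boostInt l 1 (pd i (pd i profile)) t z := by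
      simp only [boostInt]
      rw [← integral_finsetSum _ fun i _ => i1 i, ← integral_const_mul]
      refine integral_congr_ae (.of_forall fun y => ?_)
      simp only
      rw [← Finset.mul_sum, laplacian_profile]
      ring
    have e2 : ∀ i, boostInt l 1 (pd i (pd i profile)) t z =
        -∫ y, boostKerDeriv l 1 t y (basisVec i) * pd i profile (z + y) := fun i =>
      boostInt_pd hl (U.pd i) le_rfl (by omega) (by omega) ht z i
    have i2n : Integrable fun y =>
        -∑ i, boostKerDeriv l 1 t y (basisVec i) * pd i profile (z + y) := i2s.neg
    rw [e1, hsum, integral_sub i2n (i3.const_mul _), integral_neg, integral_const_mul,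
      integral_finsetSum _ fun i _ => i2 i, ← Finset.sum_neg_distrib,
      Finset.sum_congr rfl fun i _ => e2 i, boostInt]
    ring
  have i4 := integrable_boostKer_mul hl U (k := 3) (by omega) le_rfl (by omega) ht z
  have i5 := integrable_boostKerDeriv_mul hl U (k := 2) (by omega) le_rfl ht z 0
  -- The radial part of `-∇K₁·∇⟨·⟩⁻³` is `|y|⁻⁵ g (y·∇)⟨·⟩⁻³`. Integrating it by parts along rays
  -- leaves the boundary value `g 0 = 3/t`, the source of the explicit term.
  set g : R5 → ℝ := fun y => 3 * (phase l t y)⁻¹ + 3 * γ * ‖y‖ * (phase l t y ^ 2)⁻¹ +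
    2 * γ ^ 2 * ‖y‖ ^ 2 * (phase l t y ^ 3)⁻¹ with hg
  set g' : R5 → ℝ := fun y => -3 * boostTime l y * (phase l t y ^ 2)⁻¹ +
      3 * γ * ‖y‖ * (phase l t y ^ 2)⁻¹ -
      6 * γ * ‖y‖ * boostTime l y * (phase l t y ^ 3)⁻¹ +
      4 * γ ^ 2 * ‖y‖ ^ 2 * (phase l t y ^ 3)⁻¹ -
      6 * γ ^ 2 * ‖y‖ ^ 2 * boostTime l y * (phase l t y ^ 4)⁻¹ with hg'
  have eP : ∀ y : R5, y ≠ 0 → P y = (‖y‖ ^ 5)⁻¹ * g y := by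
    intro y hy
    have hy0 : ‖y‖ ≠ 0 := norm_ne_zero_iff.2 hy
    simp only [hP, hg, blockKer]
    field_simp
  have eQ' : ∀ y : R5, y ≠ 0 → (‖y‖ ^ 5)⁻¹ *
      (g' y * profile (z + y) + g y * dirDeriv profile (z + y) y) =
      P y * dirDeriv profile (z + y) y + (-2 * (boostKer l 3 t y * profile (z + y)) +
        l * γ * (boostKerDeriv l 2 t y (basisVec 0) * profile (z + y))) := by
    intro y hy
    rw [eP y hy]
    linear_combination profile (z + y) * green_kernel_identity hl ht hy
  have i45 : Integrable fun y => -2 * (boostKer l 3 t y * profile (z + y)) +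
        l * γ * (boostKerDeriv l 2 t y (basisVec 0) * profile (z + y)) :=
    (i4.const_mul (-2)).add (i5.const_mul (l * γ))
  have ae' : (fun y => (‖y‖ ^ 5)⁻¹ *
      (g' y * profile (z + y) + g y * dirDeriv profile (z + y) y)) =ᵐ[volume] fun y =>
      P y * dirDeriv profile (z + y) y + (-2 * (boostKer l 3 t y * profile (z + y)) +
        l * γ * (boostKerDeriv l 2 t y (basisVec 0) * profile (z + y))) := by
    filter_upwards [ae_ne_zero] with y hy using eQ' y hy
  have hγ0 : 0 < γ := lorentzFactor_pos hl
  have hphc : Continuous (phase l t) := by unfold phase boostTime; fun_prop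
  have hgc : Continuous g := by
    have h1 : Continuous fun y => (phase l t y)⁻¹ :=
      hphc.inv₀ fun y => (phase_pos hl ht y).ne'
    have h2 : Continuous fun y => (phase l t y ^ 2)⁻¹ :=
      (hphc.pow 2).inv₀ fun y => pow_ne_zero 2 (phase_pos hl ht y).ne'
    have h3 : Continuous fun y => (phase l t y ^ 3)⁻¹ :=
      (hphc.pow 3).inv₀ fun y => pow_ne_zero 3 (phase_pos hl ht y).ne'
    fun_prop
  have huc := U.continuous
  have iQ : Integrable fun y => (‖y‖ ^ 4)⁻¹ * (g y * profile (z + y)) := by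
    obtain ⟨C₁, hC₁, H₁⟩ := blockKer_le hl 1
    obtain ⟨C₂, hC₂, H₂⟩ := blockKer_le hl 2
    obtain ⟨C₃, hC₃, H₃⟩ := blockKer_le hl 3
    refine ((integrable_convKernel (a := 4) (b := 3) (by omega) le_rfl (by omega) ht z).const_mul
      (3 * C₁ + 3 * γ * C₂ + 2 * γ ^ 2 * C₃)).mono' ?_ ?_
    · have := hgc.measurable
      have := huc.measurable
      exact Measurable.aestronglyMeasurable (by fun_prop)
    · filter_upwards [ae_ne_zero] with y hy
      have hy0 : ‖y‖ ≠ 0 := norm_ne_zero_iff.2 hy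
      have b1 := H₁ 4 0 0 rfl t ht y hy
      have b2 := H₂ 3 0 1 rfl t ht y hy
      have b3 := H₃ 2 0 2 rfl t ht y hy
      have e : (‖y‖ ^ 4)⁻¹ * (g y * profile (z + y)) = (3 * blockKer l 4 1 t y +
          3 * γ * blockKer l 3 2 t y + 2 * γ ^ 2 * blockKer l 2 3 t y) * profile (z + y) := by
        simp only [hg, blockKer]
        field_simp
      have hu : 0 < profile (z + y) := by
        have := bracket_pos (z + y)
        unfold profile; positivity
      have n1 := blockKer_nonneg hl 4 1 ht y
      have n2 := blockKer_nonneg hl 3 2 ht y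
      have n3 := blockKer_nonneg hl 2 3 ht y
      rw [e, Real.norm_of_nonneg (by positivity)]
      simp only [pow_zero, inv_one, one_mul, Nat.reduceAdd] at b1 b2 b3
      set R := (‖y‖ ^ 4)⁻¹ * (t + ‖y‖)⁻¹
      calc _ ≤ (3 * (C₁ * R) + 3 * γ * (C₂ * R) + 2 * γ ^ 2 * (C₃ * R)) * profile (z + y) := by
            gcongr
        _ = _ := by rw [convKernel, profile]; ring
  have euler := integral_euler (Q := fun y => g y * profile (z + y))
    (Q' := fun y => g' y * profile (z + y) + g y * dirDeriv profile (z + y) y)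
    (fun y hy => ?_) iQ ((iP.add i45).congr ae'.symm) (by fun_prop)
  · rw [integral_congr_ae ae', integral_add iP i45, integral_add (i4.const_mul _) (i5.const_mul _),
      integral_const_mul, integral_const_mul] at euler
    have e5 := boostInt_pd hl U (k := 2) (by omega) le_rfl le_rfl ht z 0
    have e0 : g 0 = 3 * t⁻¹ := by simp [hg, phase, boostTime]
    simp only [add_zero, e0] at euler
    have e4 : ∫ y, boostKer l 3 t y * profile (z + y) = boostInt l 3 profile t z := rfl
    rw [e4] at euler
    linear_combination hlhs + euler - l * γ * e5
  · have hp := (phase_pos hl ht y).ne'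
    have h1 : HasDerivAt (fun s : ℝ => z + s • y) y 1 := by
      simpa using ((hasDerivAt_id (1 : ℝ)).smul_const y).const_add z
    have h2 : HasDerivAt (fun s : ℝ => profile (z + s • y)) (dirDeriv profile (z + y) y) 1 := by
      rw [← U.fderiv_apply]
      have h3 := (U.differentiable (z + (1 : ℝ) • y)).hasFDerivAt
      convert! h3.comp_hasDerivAt (1 : ℝ) h1 using 1
      simp
    have h3 : HasDerivAt (fun s : ℝ => t + s * boostTime l y) (boostTime l y) 1 := by
      simpa using ((hasDerivAt_id (1 : ℝ)).mul_const (boostTime l y)).const_add t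
    have hne : t + 1 * boostTime l y ≠ 0 := by rw [one_mul]; exact hp
    have hn : HasDerivAt (fun s : ℝ => s * ‖y‖) ‖y‖ 1 := by
      simpa using (hasDerivAt_id (1 : ℝ)).mul_const ‖y‖
    have p1 := (h3.fun_inv hne).const_mul 3
    have p2 := (hn.fun_mul ((h3.fun_pow 2).fun_inv (pow_ne_zero 2 hne))).const_mul (3 * γ)
    have p3 := ((hn.fun_pow 2).fun_mul ((h3.fun_pow 3).fun_inv (pow_ne_zero 3 hne))).const_mul
      (2 * γ ^ 2)
    have h6 := ((p1.fun_add p2).fun_add p3).fun_mul h2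
    have h7 : (fun s : ℝ => g (s • y) * profile (z + s • y)) =ᶠ[𝓝 1] fun s =>
        (3 * (t + s * boostTime l y)⁻¹ + 3 * γ * (s * ‖y‖ * ((t + s * boostTime l y) ^ 2)⁻¹) +
          2 * γ ^ 2 * ((s * ‖y‖) ^ 2 * ((t + s * boostTime l y) ^ 3)⁻¹)) *
          profile (z + s • y) := by
      filter_upwards [lt_mem_nhds (zero_lt_one : (0 : ℝ) < 1)] with s hs
      simp only [hg, phase]
      rw [norm_smul, Real.norm_of_nonneg hs.le, boostTime_smul _ hs]
      ring
    refine HasDerivAt.congr_of_eventuallyEq ?_ h7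
    convert! h6 using 1
    simp only [hg, hg', one_mul, one_smul]
    rw [show t + boostTime l y = phase l t y from rfl]
    push_cast
    field_simp
    ring

/-- `v♯` as the sum of an explicit term and a potential of a concentrated density. -/
lemma vSharp_eq_profile (hl : |l| < 1) {t : ℝ} (ht : 0 < t) (x : R5) :
    vSharp l t x = 1 / 2 * t⁻¹ * profile (xl l t x) -
      5 / 2 * sphArea⁻¹ * boostInt l 1 density t (xl l t x) := by
  have hS := sphArea_pos.ne'
  have h := green_identity hl ht (xl l t x)
  have h2 : boostInt l 3 profile t (xl l t x) = -(15 / 2) * boostInt l 1 density t (xl l t x) -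
      l * lorentzFactor l * boostInt l 2 (pd 0 profile) t (xl l t x) +
      3 / 2 * sphArea * t⁻¹ * profile (xl l t x) := by linarith
  rw [vSharp_eq hl ht, h2]
  field_simp
  ring

lemma integral_density : ∫ y, density y = sphArea / 5 := by
  have h1 := integral_fun_norm_addHaar (volume : Measure R5)
    (fun r => (Real.sqrt (1 + r ^ 2) ^ 7)⁻¹)
  have h2 : ∫ r in Ioi (0 : ℝ), r ^ 4 * (Real.sqrt (1 + r ^ 2) ^ 7)⁻¹ = 1 / 5 - 0 := by
    -- The antiderivative of `r⁴(1 + r²)^{-7/2}` is `(r/√(1 + r²))⁵/5`, increasing from `0` to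
    -- `1/5`.
    have hd : ∀ r ∈ Ici (0 : ℝ), HasDerivAt (fun r : ℝ => 1 / 5 * (r / Real.sqrt (1 + r ^ 2)) ^ 5)
        (r ^ 4 * (Real.sqrt (1 + r ^ 2) ^ 7)⁻¹) r := by
      intro r _
      have hpos : 0 < 1 + r ^ 2 := by positivity
      have hs : 0 < Real.sqrt (1 + r ^ 2) := Real.sqrt_pos.2 hpos
      have hsq : Real.sqrt (1 + r ^ 2) ^ 2 = 1 + r ^ 2 := Real.sq_sqrt hpos.le
      have d1 : HasDerivAt (fun r : ℝ => 1 + r ^ 2) (2 * r) r := by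
        simpa using (hasDerivAt_pow 2 r).const_add 1
      have d2 := (((hasDerivAt_id r).div (d1.sqrt hpos.ne') hs.ne').fun_pow 5).const_mul (1 / 5)
      convert! d2 using 1
      simp
      field_simp
      rw [hsq]
      ring
    have hlim : Tendsto (fun r : ℝ => 1 / 5 * (r / Real.sqrt (1 + r ^ 2)) ^ 5) atTop
        (𝓝 (1 / 5)) := by
      have h3 : Tendsto (fun r : ℝ => r / Real.sqrt (1 + r ^ 2)) atTop (𝓝 1) := by
        have h4 : Tendsto (fun r : ℝ => 1 - (1 + r)⁻¹) atTop (𝓝 (1 - 0)) :=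
          tendsto_const_nhds.sub (tendsto_inv_atTop_zero.comp (tendsto_atTop_add_const_left _ _
            tendsto_id))
        rw [sub_zero] at h4
        refine tendsto_of_tendsto_of_tendsto_of_le_of_le' h4 tendsto_const_nhds ?_ ?_
        · filter_upwards [eventually_gt_atTop 0] with r hr
          have hs : 0 < Real.sqrt (1 + r ^ 2) := Real.sqrt_pos.2 (by positivity)
          have h5 : Real.sqrt (1 + r ^ 2) ≤ 1 + r :=
            Real.sqrt_le_iff.2 ⟨by positivity, by nlinarith⟩
          have h6 : 1 - (1 + r)⁻¹ = r / (1 + r) := by field_simp; ring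
          rw [h6]
          gcongr
        · filter_upwards [eventually_gt_atTop 0] with r hr
          have hs : 0 < Real.sqrt (1 + r ^ 2) := Real.sqrt_pos.2 (by positivity)
          rw [div_le_one hs]
          exact Real.le_sqrt_of_sq_le (by linarith)
      have h7 := (h3.pow 5).const_mul (1 / 5 : ℝ)
      rwa [one_pow, mul_one] at h7
    have := integral_Ioi_of_hasDerivAt_of_nonneg' hd (fun r hr => by positivity) hlim
    rw [this]
    simp
  have h3 : sphArea = 5 * (volume : Measure R5).real (ball 0 1) := by
    rw [sphArea, Measure.toSphere_real_apply_univ, finrank_R5]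
    norm_num
  have h4 : ∫ y, density y = ∫ y : R5, (Real.sqrt (1 + ‖y‖ ^ 2) ^ 7)⁻¹ := rfl
  rw [h4, h1, finrank_R5, h3]
  simp only [smul_eq_mul, Nat.reduceSub, h2]
  simp
  ring

end Green



/-! ### The antipodal map on the sphere -/

section SphereSymmetry

lemma measurePreserving_neg_sphere :
    MeasurePreserving (fun θ : sphere (0 : R5) 1 => -θ) sphMeasure sphMeasure := by
  refine ⟨continuous_neg.measurable, Measure.ext fun s hs => ?_⟩
  rw [Measure.map_apply continuous_neg.measurable hs,
    Measure.toSphere_apply' _ (continuous_neg.measurable hs), Measure.toSphere_apply' _ hs]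
  congr 1
  rw [← Measure.measure_neg]
  congr 1
  ext x
  simp only [Set.mem_neg, Set.mem_smul, Set.mem_image]
  constructor
  · rintro ⟨a, ha, _, ⟨θ, hθ, rfl⟩, h⟩
    exact ⟨a, ha, _, ⟨-θ, hθ, rfl⟩, by simp [h]⟩
  · rintro ⟨a, ha, _, ⟨θ, hθ, rfl⟩, h⟩
    exact ⟨a, ha, _, ⟨-θ, by simpa using hθ, rfl⟩, by simp [h]⟩

lemma integral_sphere_neg (f : sphere (0 : R5) 1 → ℝ) :
    ∫ θ, f (-θ) ∂sphMeasure = ∫ θ, f θ ∂sphMeasure :=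
  measurePreserving_neg_sphere.integral_comp (Homeomorph.neg _).measurableEmbedding f

/-- A function with constant even part has that constant as spherical average. -/
lemma integral_sphere_of_even_part {f : sphere (0 : R5) 1 → ℝ} (hf : Integrable f sphMeasure)
    {c : ℝ} (hc : ∀ θ, f θ + f (-θ) = 2 * c) : ∫ θ, f θ ∂sphMeasure = sphArea * c := by
  have hf' : Integrable (fun θ => f (-θ)) sphMeasure :=
    measurePreserving_neg_sphere.integrable_comp_of_integrable hf
  have h := integral_add hf hf'
  rw [integral_sphere_neg] at h
  simp only [hc, integral_const, smul_eq_mul] at h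
  rw [sphArea]
  linarith

end SphereSymmetry

/-! ### The combination `3v + x·∇v` -/

section Scaling

variable {l : ℝ}

/-- The kernel of `3v + x·∇v` for the potential part of `v♯`. -/
noncomputable def scalingKer (l t : ℝ) (v y : R5) : ℝ :=
  3 * boostKer l 1 t y - boostKerDeriv l 1 t y v

lemma contDiff_vSharp (hl : |l| < 1) {t : ℝ} (ht : 0 < t) : ContDiff ℝ ∞ (vSharp l t) := by
  have h1 : ContDiff ℝ ∞ fun x : R5 => (t, x) := contDiff_prodMk_right t
  have h2 := (contDiffOn_vSharp hl).comp (s := univ) h1.contDiffOn fun x _ => ⟨ht, mem_univ x⟩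
  exact contDiffOn_univ.1 h2

lemma boostKerDeriv_eq_sum (k : ℕ) (t : ℝ) (y v : R5) :
    boostKerDeriv l k t y v = ∑ i, v i * boostKerDeriv l k t y (basisVec i) := by
  conv_lhs => rw [← (EuclideanSpace.basisFun (Fin 5) ℝ).sum_repr v]
  simp [map_sum, EuclideanSpace.basisFun_apply]

lemma integrable_scalingKer_mul (hl : |l| < 1) {t : ℝ} (ht : 0 < t) (z v : R5) :
    Integrable fun y => scalingKer l t v y * density (z + y) := by
  have i1 := integrable_boostKer_mul hl brSym_density le_rfl (by omega) (by omega) ht z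
  have i2 : ∀ i, Integrable fun y =>
      boostKerDeriv l 1 t y (basisVec i) * density (z + y) := fun i =>
    integrable_boostKerDeriv_mul hl brSym_density le_rfl (by omega) ht z i
  have i3 := integrable_finsetSum Finset.univ fun i _ => (i2 i).const_mul (v i)
  refine ((i1.const_mul 3).sub i3).congr (.of_forall fun y => ?_)
  simp only [Pi.sub_apply, scalingKer]
  rw [boostKerDeriv_eq_sum, sub_mul, Finset.sum_mul]
  congr 1
  · ring
  · exact Finset.sum_congr rfl fun i _ => by ring

/-- Integration by parts moves the derivatives from the density to the kernel, where homogeneity can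
be used. -/
lemma integral_scalingKer_mul (hl : |l| < 1) {t : ℝ} (ht : 0 < t) (z v : R5) :
    ∫ y, scalingKer l t v y * density (z + y) =
      3 * boostInt l 1 density t z + ∑ i, boostInt l 1 (pd i density) t z * v i := by
  have i1 := integrable_boostKer_mul hl brSym_density le_rfl (by omega) (by omega) ht z
  have i2 : ∀ i, Integrable fun y =>
      boostKerDeriv l 1 t y (basisVec i) * density (z + y) := fun i =>
    integrable_boostKerDeriv_mul hl brSym_density le_rfl (by omega) ht z i
  have i3 := integrable_finsetSum Finset.univ fun i _ => (i2 i).const_mul (v i)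
  have e : ∀ y, scalingKer l t v y * density (z + y) =
      3 * (boostKer l 1 t y * density (z + y)) -
      ∑ i, v i * (boostKerDeriv l 1 t y (basisVec i) * density (z + y)) := by
    intro y
    rw [scalingKer, boostKerDeriv_eq_sum, sub_mul, Finset.sum_mul]
    congr 1
    · ring
    · exact Finset.sum_congr rfl fun i _ => by ring
  simp only [e]
  rw [integral_sub (i1.const_mul 3) i3, integral_const_mul, integral_finsetSum _
    fun i _ => (i2 i).const_mul (v i), sub_eq_add_neg, ← Finset.sum_neg_distrib]
  congr 1
  refine Finset.sum_congr rfl fun i _ => ?_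
  rw [integral_const_mul, boostInt_pd hl brSym_density le_rfl (by omega) (by omega) ht z i]
  ring

lemma dirDeriv_profile (z v : R5) :
    dirDeriv profile z v = -3 * (bracket z ^ 5)⁻¹ * ∑ i, z i * v i := by
  rw [dirDeriv, Finset.mul_sum]
  refine Finset.sum_congr rfl fun i _ => ?_
  rw [pd_profile]
  ring

/-- In `3u + x·∇u` for `u = ½t⁻¹⟨x_ℓ⟩⁻³` the coefficient `3` cancels the slowly decaying part. As
`stretch l x = x_ℓ + γℓt e₁`, the shift contributes a term in which `t` cancels `t⁻¹`; it survives
in the limit. -/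
lemma three_mul_vSharp_add_fderiv (hl : |l| < 1) {t : ℝ} (ht : 0 < t) (x : R5) :
    3 * vSharp l t x + fderiv ℝ (vSharp l t) x x =
      3 / 2 * t⁻¹ * (bracket (xl l t x) ^ 5)⁻¹ -
      3 / 2 * (lorentzFactor l * l) * (xl l t x 0 * (bracket (xl l t x) ^ 5)⁻¹) -
      5 / 2 * sphArea⁻¹ * ∫ y, scalingKer l t (stretch l x) y * density (xl l t x + y) := by
  have e : vSharp l t = fun x => 1 / 2 * t⁻¹ * profile (xl l t x) -
      5 / 2 * sphArea⁻¹ * boostInt l 1 density t (xl l t x) :=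
    funext fun x => vSharp_eq_profile hl ht x
  have h1 : HasFDerivAt (fun y => profile (xl l t y)) _ x :=
    (brSym_profile.differentiable (xl l t x)).hasFDerivAt.comp x (hasFDerivAt_xl l t x)
  have h2 := hasFDerivAt_boostInt_xl hl brSym_density (k := 1) le_rfl (by omega) (by omega) ht x
  have h3 := (h1.const_mul (1 / 2 * t⁻¹)).fun_sub (h2.const_mul (5 / 2 * sphArea⁻¹))
  have h4 : fderiv ℝ (vSharp l t) x x = 1 / 2 * t⁻¹ * dirDeriv profile (xl l t x) (stretch l x) -
      5 / 2 * sphArea⁻¹ * ∑ i, boostInt l 1 (pd i density) t (xl l t x) * stretch l x i := by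
    rw [e, HasFDerivAt.fderiv h3]
    simp [brSym_profile.fderiv_apply]
  rw [h4, vSharp_eq_profile hl ht, integral_scalingKer_mul hl ht, dirDeriv_profile]
  set z := xl l t x with hz
  have h5 : stretch l x = z + (lorentzFactor l * l * t) • basisVec 0 := by
    rw [hz, xl_eq]; simp
  have h6 : ∑ i, z i * stretch l x i = bracket z ^ 2 - 1 + lorentzFactor l * l * t * z 0 := by
    rw [bracket_sq, norm_sq_eq_sum, h5]
    simp only [PiLp.add_apply, PiLp.smul_apply, smul_eq_mul, mul_add, Finset.sum_add_distrib]
    congr 1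
    · simp [sq]
    · simp [mul_comm]
  have hb := (bracket_pos z).ne'
  rw [h6, profile]
  field_simp
  ring

/-- Euler's relation: `K₁` is jointly homogeneous of degree `-4` in `(t, y)`, and `∂_t K₁ = -K₂`. -/
lemma scaling_boostKer (hl : |l| < 1) {t : ℝ} (ht : 0 < t) {y : R5} (hy : y ≠ 0) :
    3 * boostKer l 1 t y + boostKerDeriv l 1 t y y =
      -boostKer l 1 t y + t * boostKer l 2 t y := by
  have hy0 : ‖y‖ ≠ 0 := norm_ne_zero_iff.2 hy
  have hp := (phase_pos hl ht y).ne'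
  have ha : lorentzFactor l * l * y 0 = phase l t y - t - lorentzFactor l * ‖y‖ := by
    rw [phase, boostTime]; ring
  have e : boostKerDeriv l 1 t y y = blockDeriv l 3 1 t y y +
    (1 : ℕ) * lorentzFactor l * blockDeriv l 2 (1 + 1) t y y := rfl
  have hb : ∀ p n : ℕ, blockDeriv l p n t y y = (-(p : ℝ) * blockKer l (p + 2) n t y -
      n * lorentzFactor l * blockKer l (p + 1) (n + 1) t y) * ‖y‖ ^ 2 -
      n * (lorentzFactor l * l * y 0) * blockKer l p (n + 1) t y := by
    intro p n
    simp [blockDeriv]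
    ring
  rw [e, hb, hb, ha]
  simp only [boostKer, blockKer]
  push_cast
  field_simp
  ring

lemma abs_boostKerDeriv_apply_le (hl : |l| < 1) : ∃ C, 0 ≤ C ∧ ∀ t, 0 < t → ∀ y : R5, y ≠ 0 →
    ∀ v, |boostKerDeriv l 1 t y v| ≤ C * ((‖y‖ ^ 4)⁻¹ * (t + ‖y‖)⁻¹) * ‖v‖ := by
  obtain ⟨C, hC, H⟩ := abs_boostKerDeriv_le hl 1
  refine ⟨5 * C, by positivity, fun t ht y hy v => ?_⟩
  rw [boostKerDeriv_eq_sum]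
  refine (Finset.abs_sum_le_sum_abs _ _).trans ?_
  have : ∀ i ∈ Finset.univ, |v i * boostKerDeriv l 1 t y (basisVec i)| ≤
      ‖v‖ * (C * ((‖y‖ ^ 4)⁻¹ * (t + ‖y‖)⁻¹)) := by
    intro i _
    rw [abs_mul]
    have h := H 0 0 rfl t ht y hy i
    simp only [pow_zero, inv_one, one_mul, add_zero] at h
    gcongr
    exact abs_coord_le_norm v i
  refine (Finset.sum_le_sum this).trans (le_of_eq ?_)
  simp
  ring

lemma norm_stretch_sq (hl : |l| < 1) (x : R5) :
    ‖stretch l x‖ ^ 2 = ‖x‖ ^ 2 + (lorentzFactor l * l * x 0) ^ 2 := by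
  have e : stretch l x = x + ((lorentzFactor l - 1) * x 0) • basisVec 0 := by
    simp [stretch]
  rw [e, norm_sq_add_smul_basisVec]
  linear_combination (x 0 ^ 2) * lorentzFactor_sq hl

lemma norm_le_norm_stretch (hl : |l| < 1) (x : R5) : ‖x‖ ≤ ‖stretch l x‖ := by
  refine abs_le_of_sq_le_sq' ?_ (norm_nonneg _) |>.2
  rw [norm_stretch_sq hl]
  linarith [sq_nonneg (lorentzFactor l * l * x 0)]

lemma stretch_zero_coord (l : ℝ) (x : R5) : stretch l x 0 = lorentzFactor l * x 0 := by
  simp [stretch]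
  ring

/-- The even part of the leading term of `3v + x·∇v`. -/
lemma boostKer_zero_even_part (hl : |l| < 1) {x : R5} (hx : x ≠ 0) :
    boostKer l 1 0 (-stretch l x) + boostKer l 1 0 (stretch l x) =
      4 * (lorentzFactor l)⁻¹ * (‖x‖ ^ 4)⁻¹ := by
  have hr : 0 < ‖x‖ := norm_pos_iff.2 hx
  have hN : 0 < ‖stretch l x‖ := hr.trans_le (norm_le_norm_stretch hl x)
  have hs : stretch l x ≠ 0 := norm_pos_iff.1 hN
  have a1 := boostTime_pos hl hs
  have a2 := boostTime_pos hl (neg_ne_zero.2 hs)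
  have hγ := lorentzFactor_pos hl
  have hsq := norm_stretch_sq hl x
  simp only [boostKer, blockKer, phase, zero_add, norm_neg]
  rw [boostTime] at a1 a2 ⊢
  rw [boostTime]
  rw [norm_neg] at a2 ⊢
  simp only [PiLp.neg_apply, stretch_zero_coord] at a1 a2 ⊢
  set N := ‖stretch l x‖
  set r := ‖x‖
  set γ := lorentzFactor l
  set b := γ * l * x 0 with hb
  have e1 : N + l * -(γ * x 0) = N - b := by rw [hb]; ring
  have e2 : N + l * (γ * x 0) = N + b := by rw [hb]; ring
  rw [e1] at a2 ⊢
  rw [e2] at a1 ⊢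
  have b1 : 0 < N + b := (mul_pos_iff_of_pos_left hγ).1 a1
  have b2 : 0 < N - b := (mul_pos_iff_of_pos_left hγ).1 a2
  -- With `N = |stretch l x|` and `b = γℓx₁`, the relation `N² - b² = |x|²` makes the sum over the
  -- two antipodal points independent of direction.
  have hr2 : r ^ 2 = (N + b) * (N - b) := by linear_combination -hsq
  have hr4 : r ^ 4 = ((N + b) * (N - b)) ^ 2 := by rw [← hr2]; ring
  rw [hr4]
  push_cast
  field_simp
  ring

end Scaling



/-! ### Comparison of the scaling kernel with its value at the concentration point -/

section Asymptotics

variable {l : ℝ}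

lemma abs_cube_mul_sub_le {u v α β s : ℝ} (hu : 0 ≤ u) (hus : u ≤ s) (hv : 0 ≤ v) (hvs : v ≤ s)
    (hα : 0 ≤ α) (hαs : α ≤ s) :
    |u ^ 3 * α - v ^ 3 * β| ≤ s ^ 3 * (3 * |u - v| + |α - β|) := by
  have hs : 0 ≤ s := hu.trans hus
  have e : u ^ 3 * α - v ^ 3 * β = (u ^ 2 + u * v + v ^ 2) * α * (u - v) + v ^ 3 * (α - β) := by
    ring
  rw [e]
  refine (abs_add_le _ _).trans ?_
  rw [abs_mul, abs_mul (v ^ 3), abs_of_nonneg (by positivity : 0 ≤ (u ^ 2 + u * v + v ^ 2) * α),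
    abs_of_nonneg (by positivity : 0 ≤ v ^ 3)]
  calc _ ≤ (s ^ 2 + s * s + s ^ 2) * s * |u - v| + s ^ 3 * |α - β| := by gcongr
    _ = _ := by ring

lemma abs_sq_mul_sq_sub_le {u v α β s : ℝ} (hu : 0 ≤ u) (hus : u ≤ s) (hv : 0 ≤ v) (hvs : v ≤ s)
    (hα : 0 ≤ α) (hαs : α ≤ s) (hβ : 0 ≤ β) (hβs : β ≤ s) :
    |u ^ 2 * α ^ 2 - v ^ 2 * β ^ 2| ≤ s ^ 3 * (2 * |u - v| + 2 * |α - β|) := by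
  have hs : 0 ≤ s := hu.trans hus
  have e : u ^ 2 * α ^ 2 - v ^ 2 * β ^ 2 =
      (u + v) * α ^ 2 * (u - v) + v ^ 2 * (α + β) * (α - β) := by ring
  rw [e]
  refine (abs_add_le _ _).trans ?_
  rw [abs_mul, abs_mul (v ^ 2 * (α + β)), abs_of_nonneg (by positivity : 0 ≤ (u + v) * α ^ 2),
    abs_of_nonneg (by positivity : 0 ≤ v ^ 2 * (α + β))]
  calc _ ≤ (s + s) * s ^ 2 * |u - v| + s ^ 2 * (s + s) * |α - β| := by gcongr
    _ = _ := by ring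

lemma abs_inv_sub_inv_le {n N s : ℝ} (hn : 0 < n) (hN : 0 < N) (hns : n⁻¹ ≤ s) (hNs : N⁻¹ ≤ s) :
    |n⁻¹ - N⁻¹| ≤ s ^ 2 * |n - N| := by
  have hs : 0 ≤ s := (inv_nonneg.2 hn.le).trans hns
  have e : n⁻¹ - N⁻¹ = n⁻¹ * N⁻¹ * (N - n) := by field_simp
  rw [e, abs_mul, abs_of_nonneg (by positivity : 0 ≤ n⁻¹ * N⁻¹), abs_sub_comm N n, sq]
  gcongr

lemma abs_boostKer_sub_le (hl : |l| < 1) {t s d : ℝ} (ht : 0 < t) {y w : R5} (hy : y ≠ 0)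
    (hw : w ≠ 0) (hys : ‖y‖⁻¹ ≤ s) (hws : ‖w‖⁻¹ ≤ s) (has : (phase l t y)⁻¹ ≤ s)
    (hbs : (boostTime l w)⁻¹ ≤ s) (hd : ‖y - w‖ ≤ d) :
    |boostKer l 1 t y - boostKer l 1 0 w| ≤
      (3 + 4 * lorentzFactor l + 4 * lorentzFactor l ^ 2) * s ^ 5 * (t + d) := by
  have hγ := lorentzFactor_pos hl
  have hn : 0 < ‖y‖ := norm_pos_iff.2 hy
  have hN : 0 < ‖w‖ := norm_pos_iff.2 hw
  have ha := phase_pos hl ht y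
  have hb := boostTime_pos hl hw
  have hd0 : 0 ≤ d := (norm_nonneg _).trans hd
  have hs : 0 ≤ s := (by positivity : (0 : ℝ) ≤ ‖y‖⁻¹).trans hys
  have d1 : |‖y‖ - ‖w‖| ≤ d := (abs_norm_sub_norm_le y w).trans hd
  have d2 : |phase l t y - boostTime l w| ≤ t + 2 * lorentzFactor l * d := by
    have e : phase l t y - boostTime l w =
        t + lorentzFactor l * (‖y‖ - ‖w‖) + lorentzFactor l * (l * (y - w) 0) := by
      simp [phase, boostTime]; ring
    have h1 : |l * (y - w) 0| ≤ 1 * d := by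
      rw [abs_mul]
      exact mul_le_mul hl.le ((abs_coord_le_norm _ 0).trans hd) (abs_nonneg _) zero_le_one
    rw [e]
    refine (abs_add_three _ _ _).trans ?_
    rw [abs_of_pos ht, abs_mul, abs_mul, abs_of_pos hγ]
    nlinarith
  have i1 := (abs_inv_sub_inv_le hn hN hys hws).trans (mul_le_mul_of_nonneg_left d1 (sq_nonneg s))
  have i2 := (abs_inv_sub_inv_le ha hb has hbs).trans (mul_le_mul_of_nonneg_left d2 (sq_nonneg s))
  have j1 := abs_cube_mul_sub_le (β := (boostTime l w)⁻¹) (by positivity) hys (by positivity) hws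
    (inv_nonneg.2 ha.le) has
  have j2 := abs_sq_mul_sq_sub_le (by positivity) hys (by positivity) hws
    (inv_nonneg.2 ha.le) has (inv_nonneg.2 hb.le) hbs
  have e : boostKer l 1 t y - boostKer l 1 0 w =
      (‖y‖⁻¹ ^ 3 * (phase l t y)⁻¹ - ‖w‖⁻¹ ^ 3 * (boostTime l w)⁻¹) + lorentzFactor l *
      (‖y‖⁻¹ ^ 2 * (phase l t y)⁻¹ ^ 2 - ‖w‖⁻¹ ^ 2 * (boostTime l w)⁻¹ ^ 2) := by
    simp [boostKer, blockKer, phase]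
    ring
  rw [e]
  refine (abs_add_le _ _).trans ?_
  rw [abs_mul, abs_of_pos hγ]
  calc _ ≤ s ^ 3 * (3 * (s ^ 2 * d) + s ^ 2 * (t + 2 * lorentzFactor l * d)) +
        lorentzFactor l * (s ^ 3 * (2 * (s ^ 2 * d) +
          2 * (s ^ 2 * (t + 2 * lorentzFactor l * d)))) := by
        gcongr
        · exact j1.trans (by gcongr)
        · exact j2.trans (by gcongr)
    _ = s ^ 5 * ((1 + 2 * lorentzFactor l) * t +
          (3 + 4 * lorentzFactor l + 4 * lorentzFactor l ^ 2) * d) := by ring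
    _ ≤ s ^ 5 * ((3 + 4 * lorentzFactor l + 4 * lorentzFactor l ^ 2) * t +
          (3 + 4 * lorentzFactor l + 4 * lorentzFactor l ^ 2) * d) := by
        have hc : 1 + 2 * lorentzFactor l ≤ 3 + 4 * lorentzFactor l + 4 * lorentzFactor l ^ 2 := by
          nlinarith
        exact mul_le_mul_of_nonneg_left
          (add_le_add_left (mul_le_mul_of_nonneg_right hc ht.le) _) (by positivity)
    _ = _ := by ring

/-- The region of large `|x|` in which the asymptotics hold. -/
structure FarRegion (l t : ℝ) (x : R5) : Prop where
  one_le_time : 1 ≤ t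
  one_le_norm : 1 ≤ ‖x‖
  time_le_norm : 4 * lorentzFactor l * t ≤ ‖x‖

lemma FarRegion.norm_shift_le (hl : |l| < 1) {t : ℝ} {x : R5} (h : FarRegion l t x) :
    ‖(lorentzFactor l * l * t) • basisVec 0‖ ≤ lorentzFactor l * t := by
  have hγ := lorentzFactor_pos hl
  have ht : 0 < t := zero_lt_one.trans_le h.one_le_time
  rw [norm_smul, Real.norm_eq_abs, abs_mul, abs_mul, abs_of_pos hγ, abs_of_pos ht]
  simp only [PiLp.norm_single, norm_one, mul_one]
  nlinarith [mul_pos hγ ht]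

lemma FarRegion.norm_xl_lower (hl : |l| < 1) {t : ℝ} {x : R5} (h : FarRegion l t x) :
    ‖x‖ / 2 ≤ ‖xl l t x‖ := by
  have h1 := h.norm_shift_le hl
  have h2 := norm_le_norm_stretch hl x
  have h3 := norm_sub_norm_le (stretch l x) ((lorentzFactor l * l * t) • basisVec 0)
  rw [xl_eq]
  have := h.time_le_norm
  have := norm_nonneg x
  linarith

lemma norm_stretch_le (hl : |l| < 1) (x : R5) : ‖stretch l x‖ ≤ (1 + lorentzFactor l) * ‖x‖ := by
  have hγ := lorentzFactor_pos hl
  refine abs_le_of_sq_le_sq' ?_ (by positivity) |>.2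
  rw [norm_stretch_sq hl, mul_pow]
  have h1 : (lorentzFactor l * l * x 0) ^ 2 ≤ lorentzFactor l ^ 2 * ‖x‖ ^ 2 := by
    have a1 : (x 0) ^ 2 ≤ ‖x‖ ^ 2 := sq_le_sq' (by
      have := (abs_le.1 (abs_coord_le_norm x 0)).1; linarith) ((le_abs_self _).trans
      (abs_coord_le_norm x 0))
    have a2 := one_sub_sq_pos hl
    calc (lorentzFactor l * l * x 0) ^ 2 = lorentzFactor l ^ 2 * (l ^ 2 * (x 0) ^ 2) := by ring
      _ ≤ lorentzFactor l ^ 2 * (1 * ‖x‖ ^ 2) := by gcongr; linarith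
      _ = _ := by ring
  nlinarith [mul_nonneg hγ.le (sq_nonneg ‖x‖)]

/-- Approximation of the scaling kernel near the concentration point. -/
lemma abs_scalingKer_add_le_near (hl : |l| < 1) : ∃ C, 0 ≤ C ∧ ∀ t x, FarRegion l t x →
    ∀ y : R5, ‖xl l t x + y‖ ≤ ‖x‖ / 4 →
    |scalingKer l t (stretch l x) y + boostKer l 1 0 (-stretch l x)| ≤
      C * (t * (‖x‖ ^ 5)⁻¹ * bracket (xl l t x + y)) := by
  obtain ⟨c, hc, Hc⟩ := phase_lower hl
  obtain ⟨C₁, hC₁, H₁⟩ := abs_boostKer_le hl 2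
  obtain ⟨C₂, hC₂, H₂⟩ := abs_boostKerDeriv_apply_le hl
  have hγ := lorentzFactor_pos hl
  set γ := lorentzFactor l with hγdef
  -- One constant bounding by `M/|x|` the inverses of both norms and both retarded times entering
  -- `abs_boostKer_sub_le`.
  set M := 2 * (1 + c⁻¹) with hM
  refine ⟨(3 + 4 * γ + 4 * γ ^ 2) * M ^ 5 * (2 + γ) + C₁ * 2 ^ 5 + C₂ * 2 ^ 5 * (1 + γ),
    by positivity, fun t x h y hy => ?_⟩
  have ht : 0 < t := zero_lt_one.trans_le h.one_le_time
  have hr : 0 < ‖x‖ := zero_lt_one.trans_le h.one_le_norm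
  have hshift := h.norm_shift_le hl
  have hN := norm_le_norm_stretch hl x
  have hN0 : 0 < ‖stretch l x‖ := hr.trans_le hN
  set w := xl l t x + y with hw
  set X := stretch l x with hX
  have hb1 := one_le_bracket w
  have hXy : X + y = w + (γ * l * t) • basisVec 0 := by
    rw [hw, xl_eq]; abel
  have hd0 : ‖X + y‖ ≤ ‖w‖ + γ * t := by
    rw [hXy]
    exact (norm_add_le _ _).trans (by gcongr)
  have hd : ‖X + y‖ ≤ (1 + γ) * (t * bracket w) := by
    have a1 := norm_le_bracket w
    have a2 : bracket w ≤ t * bracket w := le_mul_of_one_le_left (by linarith) h.one_le_time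
    have a3 : t ≤ t * bracket w := le_mul_of_one_le_right ht.le hb1
    nlinarith
  have htime := h.time_le_norm
  have hyn : ‖x‖ / 2 ≤ ‖y‖ := by
    have a1 : ‖X‖ ≤ ‖X + y‖ + ‖y‖ := by
      simpa using norm_sub_le (X + y) y
    linarith
  have hy0 : 0 < ‖y‖ := by linarith
  have hy' : y ≠ 0 := norm_pos_iff.1 hy0
  have hXne : -X ≠ 0 := neg_ne_zero.2 (norm_pos_iff.1 hN0)
  have hs : ∀ q : ℝ, ‖x‖ / 2 ≤ q → q⁻¹ ≤ M * ‖x‖⁻¹ := by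
    intro q hq
    have a1 : q⁻¹ ≤ (‖x‖ / 2)⁻¹ := by gcongr
    refine a1.trans ?_
    rw [inv_div, div_eq_mul_inv]
    gcongr
    rw [hM]
    have := inv_pos.2 hc
    linarith
  have hs' : ∀ q p : ℝ, ‖x‖ / 2 ≤ q → c * q ≤ p → p⁻¹ ≤ M * ‖x‖⁻¹ := by
    intro q p hq hp
    have hq0 : 0 < q := by linarith
    have a1 : p⁻¹ ≤ (c * (‖x‖ / 2))⁻¹ := by
      gcongr
      exact (mul_le_mul_of_nonneg_left hq hc.le).trans hp
    refine a1.trans ?_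
    rw [mul_inv, inv_div, div_eq_mul_inv, ← mul_assoc]
    gcongr
    rw [hM]
    linarith
  have b1 := abs_boostKer_sub_le hl ht hy' hXne (hs _ hyn) (s := M * ‖x‖⁻¹)
    (by rw [norm_neg]; exact hs _ (by linarith))
    (hs' (t + ‖y‖) _ (by linarith) (Hc t ht.le y))
    (hs' (0 + ‖-X‖) _ (by rw [norm_neg]; linarith) (by simpa [phase] using Hc 0 le_rfl (-X)))
    (d := (1 + γ) * (t * bracket w)) (by rwa [sub_neg_eq_add, add_comm])
  have hR : (‖y‖ ^ 4)⁻¹ * (t + ‖y‖)⁻¹ ≤ 2 ^ 5 * (‖x‖ ^ 5)⁻¹ := by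
    have a1 : (‖y‖ ^ 4)⁻¹ * (t + ‖y‖)⁻¹ ≤ ((‖x‖ / 2) ^ 4)⁻¹ * (‖x‖ / 2)⁻¹ := by
      gcongr
      linarith
    refine a1.trans (le_of_eq ?_)
    field_simp
  have b2 : |t * boostKer l 2 t y| ≤ C₁ * 2 ^ 5 * (t * (‖x‖ ^ 5)⁻¹) := by
    rw [abs_mul, abs_of_pos ht]
    have a1 := H₁ 0 1 rfl t ht y hy'
    simp only [pow_zero, inv_one, one_mul, Nat.reduceAdd] at a1
    calc _ ≤ t * (C₁ * (2 ^ 5 * (‖x‖ ^ 5)⁻¹)) := by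
          gcongr
          exact a1.trans (by gcongr)
      _ = _ := by ring
  have b3 : |boostKerDeriv l 1 t y (X + y)| ≤
      C₂ * (2 ^ 5 * (‖x‖ ^ 5)⁻¹) * ((1 + γ) * (t * bracket w)) :=
    (H₂ t ht y hy' _).trans (by gcongr)
  -- Writing `X = (X + y) - y` and using the homogeneity relation leaves three errors: displacement
  -- of the kernel from `(0, -X)`, an explicit factor `t`, and the gradient applied to the small
  -- vector `X + y`.
  have e : scalingKer l t X y + boostKer l 1 0 (-X) =
      -(boostKer l 1 t y - boostKer l 1 0 (-X)) + t * boostKer l 2 t y -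
        boostKerDeriv l 1 t y (X + y) := by
    have := scaling_boostKer hl ht hy'
    rw [scalingKer, map_add]
    linarith
  have htb : t ≤ t * bracket w := le_mul_of_one_le_right ht.le hb1
  rw [e]
  refine (abs_sub _ _).trans ((add_le_add_left (abs_add_le _ _) _).trans ?_)
  rw [abs_neg]
  calc _ ≤ (3 + 4 * γ + 4 * γ ^ 2) * (M * ‖x‖⁻¹) ^ 5 *
          (t * bracket w + (1 + γ) * (t * bracket w)) +
        C₁ * 2 ^ 5 * (t * bracket w * (‖x‖ ^ 5)⁻¹) +
        C₂ * (2 ^ 5 * (‖x‖ ^ 5)⁻¹) * ((1 + γ) * (t * bracket w)) := by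
        refine add_le_add (add_le_add (b1.trans ?_) (b2.trans ?_)) b3
        · gcongr
        · gcongr
    _ = _ := by
        rw [mul_pow, inv_pow]
        ring

lemma abs_boostKer_zero_le (hl : |l| < 1) : ∃ C, 0 ≤ C ∧ ∀ x : R5, x ≠ 0 →
    |boostKer l 1 0 (-stretch l x)| ≤ C * (‖x‖ ^ 4)⁻¹ := by
  obtain ⟨c, hc, Hc⟩ := phase_lower hl
  have hγ := lorentzFactor_pos hl
  refine ⟨c⁻¹ + lorentzFactor l * (c ^ 2)⁻¹, by positivity, fun x hx => ?_⟩
  have hr : 0 < ‖x‖ := norm_pos_iff.2 hx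
  have hN := norm_le_norm_stretch hl x
  have hN0 : 0 < ‖stretch l x‖ := hr.trans_le hN
  have ha : c * ‖x‖ ≤ phase l 0 (-stretch l x) := by
    have := Hc 0 le_rfl (-stretch l x)
    rw [zero_add, norm_neg] at this
    exact (by gcongr : c * ‖x‖ ≤ c * ‖stretch l x‖).trans this
  have ha0 : 0 < phase l 0 (-stretch l x) := (by positivity : 0 < c * ‖x‖).trans_le ha
  simp only [boostKer, blockKer, norm_neg]
  rw [abs_of_nonneg (by positivity)]
  simp only [Nat.cast_one, Nat.reduceAdd]
  calc _ ≤ (‖x‖ ^ 3)⁻¹ * ((c * ‖x‖) ^ 1)⁻¹ +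
        1 * lorentzFactor l * ((‖x‖ ^ 2)⁻¹ * ((c * ‖x‖) ^ 2)⁻¹) := by gcongr
    _ = _ := by field_simp

/-- Bound for the scaling kernel away from the concentration point. -/
lemma abs_scalingKer_add_le_far (hl : |l| < 1) : ∃ C, 0 ≤ C ∧ ∀ t x, FarRegion l t x →
    ∀ y : R5, y ≠ 0 →
    |scalingKer l t (stretch l x) y + boostKer l 1 0 (-stretch l x)| ≤
      C * ((‖y‖ ^ 3)⁻¹ * (t + ‖y‖)⁻¹ + ‖x‖ * ((‖y‖ ^ 4)⁻¹ * (t + ‖y‖)⁻¹) + (‖x‖ ^ 4)⁻¹) := by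
  obtain ⟨C₀, hC₀, H₀⟩ := abs_boostKer_zero_le hl
  obtain ⟨C₁, hC₁, H₁⟩ := abs_boostKer_le hl 1
  obtain ⟨C₂, hC₂, H₂⟩ := abs_boostKerDeriv_apply_le hl
  have hγ := lorentzFactor_pos hl
  refine ⟨3 * C₁ + C₂ * (1 + lorentzFactor l) + C₀, by positivity, fun t x h y hy => ?_⟩
  have ht : 0 < t := zero_lt_one.trans_le h.one_le_time
  have hr : 0 < ‖x‖ := zero_lt_one.trans_le h.one_le_norm
  have b0 := H₀ x (norm_pos_iff.1 hr)
  have b1 := H₁ 0 0 rfl t ht y hy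
  simp only [pow_zero, inv_one, one_mul, add_zero] at b1
  have b2 := H₂ t ht y hy (stretch l x)
  have b3 := norm_stretch_le hl x
  rw [scalingKer]
  refine (abs_add_le _ _).trans ((add_le_add_left (abs_sub _ _) _).trans ?_)
  rw [abs_mul, abs_of_pos (by norm_num : (0 : ℝ) < 3)]
  set P := (‖y‖ ^ 3)⁻¹ * (t + ‖y‖)⁻¹
  set Q := (‖y‖ ^ 4)⁻¹ * (t + ‖y‖)⁻¹
  have hP : 0 ≤ P := by positivity
  have hQ : 0 ≤ Q := by positivity
  calc _ ≤ 3 * (C₁ * P) + C₂ * Q * ((1 + lorentzFactor l) * ‖x‖) + C₀ * (‖x‖ ^ 4)⁻¹ := by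
        gcongr
        exact b2.trans (by gcongr)
    _ ≤ _ := by
        have e1 : 0 ≤ ‖x‖ * Q := by positivity
        have e2 : 0 ≤ (‖x‖ ^ 4)⁻¹ := by positivity
        have e3 : 0 ≤ C₂ * (1 + lorentzFactor l) := by positivity
        nlinarith [mul_nonneg hC₁ e1, mul_nonneg hC₁ e2, mul_nonneg e3 hP, mul_nonneg e3 e2,
          mul_nonneg hC₀ hP, mul_nonneg hC₀ e1]

end Asymptotics



/-! ### Leading term, spherical averages and the final asymptotics -/

section SphericalAsymptotics

variable {l : ℝ}

/-- Near the concentration point the kernel error loses one bracket, leaving the integrable `⟨z +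
y⟩⁻⁶`. Away from it `⟨z + y⟩ ≥ |x|/4`, so two brackets of the density become `|x|⁻²` and the other
five feed the convolution estimate. -/
lemma abs_scalingKer_add_mul_density_le (hl : |l| < 1) : ∃ C, 0 ≤ C ∧ ∀ t x, FarRegion l t x →
    ∀ y : R5, y ≠ 0 →
    |(scalingKer l t (stretch l x) y + boostKer l 1 0 (-stretch l x)) *
        density (xl l t x + y)| ≤
      C * (t * (‖x‖ ^ 5)⁻¹ * (bracket (xl l t x + y) ^ 6)⁻¹ +
        (‖x‖ ^ 2)⁻¹ * (convKernel 3 5 t (xl l t x) y + ‖x‖ * convKernel 4 5 t (xl l t x) y)) := by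
  obtain ⟨C₁, hC₁, H₁⟩ := abs_scalingKer_add_le_near hl
  obtain ⟨C₂, hC₂, H₂⟩ := abs_scalingKer_add_le_far hl
  refine ⟨C₁ + 16 * C₂, by positivity, fun t x h y hy => ?_⟩
  have ht : 0 < t := zero_lt_one.trans_le h.one_le_time
  have hr : 0 < ‖x‖ := zero_lt_one.trans_le h.one_le_norm
  set z := xl l t x
  have hb := bracket_pos (z + y)
  have n1 := convKernel_nonneg 3 5 ht z y
  have n2 := convKernel_nonneg 4 5 ht z y
  have hy0 : 0 < ‖y‖ := norm_pos_iff.2 hy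
  set A := t * (‖x‖ ^ 5)⁻¹ * (bracket (z + y) ^ 6)⁻¹ with hA
  set B := (‖x‖ ^ 2)⁻¹ * (convKernel 3 5 t z y + ‖x‖ * convKernel 4 5 t z y) with hB
  have hA0 : 0 ≤ A := by positivity
  have hB0 : 0 ≤ B := by positivity
  have hD : 0 ≤ density (z + y) := by unfold density; positivity
  rw [abs_mul, abs_of_nonneg hD]
  rcases le_or_gt ‖z + y‖ (‖x‖ / 4) with hw | hw
  · calc _ ≤ C₁ * (t * (‖x‖ ^ 5)⁻¹ * bracket (z + y)) * density (z + y) := by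
          gcongr
          exact H₁ t x h y hw
      _ = C₁ * A := by
          rw [hA, density]
          field_simp
      _ ≤ (C₁ + 16 * C₂) * (A + B) := by gcongr <;> linarith
  · have hbr : ‖x‖ ≤ 4 * bracket (z + y) := by
      have := norm_le_bracket (z + y)
      linarith
    have d1 : density (z + y) ≤ 16 * ((‖x‖ ^ 2)⁻¹ * (bracket (z + y) ^ 5)⁻¹) := by
      have a1 : (bracket (z + y) ^ 2)⁻¹ ≤ 16 * (‖x‖ ^ 2)⁻¹ := by
        rw [← div_eq_mul_inv, ← one_div, div_le_div_iff₀ (by positivity) (by positivity)]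
        nlinarith
      calc density (z + y) = (bracket (z + y) ^ 2)⁻¹ * (bracket (z + y) ^ 5)⁻¹ := by
            rw [density, ← mul_inv]; ring
        _ ≤ 16 * (‖x‖ ^ 2)⁻¹ * (bracket (z + y) ^ 5)⁻¹ := by gcongr
        _ = _ := by ring
    have d2 : (‖x‖ ^ 4)⁻¹ * density (z + y) ≤ 16 * A := by
      have a1 : (bracket (z + y))⁻¹ ≤ 4 * (t * ‖x‖⁻¹) := by
        have a2 : (bracket (z + y))⁻¹ ≤ 4 * ‖x‖⁻¹ := by
          rw [← div_eq_mul_inv, ← one_div, div_le_div_iff₀ (by positivity) (by positivity)]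
          linarith
        have a3 : ‖x‖⁻¹ ≤ t * ‖x‖⁻¹ := le_mul_of_one_le_left (by positivity) h.one_le_time
        linarith
      calc (‖x‖ ^ 4)⁻¹ * density (z + y) =
            (‖x‖ ^ 4)⁻¹ * (bracket (z + y) ^ 6)⁻¹ * (bracket (z + y))⁻¹ := by
            rw [density]; field_simp
        _ ≤ (‖x‖ ^ 4)⁻¹ * (bracket (z + y) ^ 6)⁻¹ * (4 * (t * ‖x‖⁻¹)) := by gcongr
        _ = 4 * A := by rw [hA]; field_simp
        _ ≤ 16 * A := by linarith
    set P := (‖y‖ ^ 3)⁻¹ * (t + ‖y‖)⁻¹ with hP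
    set Q := (‖y‖ ^ 4)⁻¹ * (t + ‖y‖)⁻¹ with hQ
    have hP0 : 0 ≤ P := by positivity
    have hQ0 : 0 ≤ Q := by positivity
    calc _ ≤ C₂ * (P + ‖x‖ * Q + (‖x‖ ^ 4)⁻¹) * density (z + y) := by
          gcongr
          exact H₂ t x h y hy
      _ = C₂ * ((P + ‖x‖ * Q) * density (z + y) + (‖x‖ ^ 4)⁻¹ * density (z + y)) := by ring
      _ ≤ C₂ * ((P + ‖x‖ * Q) * (16 * ((‖x‖ ^ 2)⁻¹ * (bracket (z + y) ^ 5)⁻¹)) + 16 * A) := by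
          gcongr
      _ = 16 * C₂ * (A + B) := by
          rw [hB, hP, hQ, convKernel, convKernel]; ring
      _ ≤ (C₁ + 16 * C₂) * (A + B) := by gcongr; linarith

lemma integrable_bracket_six : Integrable fun y : R5 => (bracket y ^ 6)⁻¹ := by
  have h := (integrable_bracket_rpow (δ := 1) one_pos).const_mul (2 ^ 6)
  refine h.mono' ?_ (.of_forall fun y => ?_)
  · have := continuous_bracket.measurable
    exact Measurable.aestronglyMeasurable (by fun_prop)
  · have hb := bracket_pos y
    have h1 : (0 : ℝ) < 1 + ‖y‖ := by positivity
    rw [Real.norm_of_nonneg (by positivity), show (-(5 + 1) : ℝ) = -((6 : ℕ) : ℝ) by norm_num,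
      Real.rpow_neg h1.le, Real.rpow_natCast, ← div_eq_mul_inv, ← one_div,
      div_le_div_iff₀ (by positivity) (by positivity), one_mul, ← mul_pow]
    gcongr
    exact one_add_norm_le_bracket y

/-- The potential part of `3v + x·∇v` up to an error `O(t |x|⁻⁵)`. -/
lemma abs_integral_scalingKer_add_le (hl : |l| < 1) : ∃ C, 0 ≤ C ∧ ∀ t x, FarRegion l t x →
    |(∫ y, scalingKer l t (stretch l x) y * density (xl l t x + y)) +
      sphArea / 5 * boostKer l 1 0 (-stretch l x)| ≤ C * (t * (‖x‖ ^ 5)⁻¹) := by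
  obtain ⟨C, hC, H⟩ := abs_scalingKer_add_mul_density_le hl
  obtain ⟨C₁, hC₁, H₁⟩ := integral_convKernel_le (a := 3) (b := 5) (δ := 1 / 2) (by omega) le_rfl
    (by omega) (by norm_num) (by norm_num)
  obtain ⟨C₂, hC₂, H₂⟩ := integral_convKernel_le (a := 4) (b := 5) (δ := 1 / 2) (by omega) le_rfl
    (by omega) (by norm_num) (by norm_num)
  set I := ∫ y : R5, (bracket y ^ 6)⁻¹ with hI
  have hI0 : 0 ≤ I := integral_nonneg fun y => by have := bracket_pos y; positivity
  refine ⟨C * (I + 8 * C₁ + 16 * C₂), by positivity, fun t x h => ?_⟩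
  have ht : 0 < t := zero_lt_one.trans_le h.one_le_time
  have hr : 0 < ‖x‖ := zero_lt_one.trans_le h.one_le_norm
  have hz := h.norm_xl_lower hl
  obtain ⟨i1, e1⟩ := H₁ t h.one_le_time (xl l t x)
  obtain ⟨i2, e2⟩ := H₂ t h.one_le_time (xl l t x)
  set z := xl l t x with hzdef
  set X := bracket z with hX
  have hX1 : 1 ≤ X := one_le_bracket z
  have hXr : ‖x‖ / 2 ≤ X := hz.trans (norm_le_bracket z)
  have hX0 : 0 < X := by linarith
  have i3 : Integrable fun y => (bracket (z + y) ^ 6)⁻¹ := integrable_bracket_six.comp_add_left z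
  have e3 : ∫ y, (bracket (z + y) ^ 6)⁻¹ = I :=
    integral_add_left_eq_self (fun y : R5 => (bracket y ^ 6)⁻¹) z
  have id : Integrable density := by
    refine integrable_bracket_six.mono' brSym_density.continuous.aestronglyMeasurable
      (.of_forall fun y => ?_)
    have := bracket_pos y
    rw [density, Real.norm_of_nonneg (by positivity)]
    gcongr
    · exact one_le_bracket y
    · norm_num
  have id' : Integrable fun y => density (z + y) := id.comp_add_left z
  have ed : ∫ y, density (z + y) = sphArea / 5 :=
    (integral_add_left_eq_self density z).trans integral_density
  have hs := integrable_scalingKer_mul hl ht z (stretch l x)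
  -- The density has total mass `|S⁴|/5`, so the point mass approximation can be put under the
  -- integral sign.
  have hsum : (∫ y, scalingKer l t (stretch l x) y * density (z + y)) +
      sphArea / 5 * boostKer l 1 0 (-stretch l x) =
      ∫ y, (scalingKer l t (stretch l x) y + boostKer l 1 0 (-stretch l x)) *
        density (z + y) := by
    simp only [add_mul]
    rw [integral_add hs (id'.const_mul _), integral_const_mul, ed]
    ring
  have f1 : (t + X)⁻¹ * X ^ (5 - (3 : ℕ) - (5 : ℕ) + 1 / 2 : ℝ) ≤ 8 * (‖x‖ ^ 3)⁻¹ := by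
    have a1 : X ^ (5 - (3 : ℕ) - (5 : ℕ) + 1 / 2 : ℝ) ≤ X ^ (-(2 : ℕ) : ℝ) :=
      Real.rpow_le_rpow_of_exponent_le hX1 (by norm_num)
    rw [Real.rpow_neg hX0.le, Real.rpow_natCast] at a1
    calc _ ≤ (‖x‖ / 2)⁻¹ * ((‖x‖ / 2) ^ 2)⁻¹ := by
          gcongr
          · linarith
          · exact a1.trans (by gcongr)
      _ = _ := by field_simp; norm_num
  have f2 : (t + X)⁻¹ * X ^ (5 - (4 : ℕ) - (5 : ℕ) + 1 / 2 : ℝ) ≤ 16 * (‖x‖ ^ 4)⁻¹ := by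
    have a1 : X ^ (5 - (4 : ℕ) - (5 : ℕ) + 1 / 2 : ℝ) ≤ X ^ (-(3 : ℕ) : ℝ) :=
      Real.rpow_le_rpow_of_exponent_le hX1 (by norm_num)
    rw [Real.rpow_neg hX0.le, Real.rpow_natCast] at a1
    calc _ ≤ (‖x‖ / 2)⁻¹ * ((‖x‖ / 2) ^ 3)⁻¹ := by
          gcongr
          · linarith
          · exact a1.trans (by gcongr)
      _ = _ := by field_simp; norm_num
  have g1 := e1.trans (mul_le_mul_of_nonneg_left f1 hC₁)
  have g2 := e2.trans (mul_le_mul_of_nonneg_left f2 hC₂)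
  have hdom : Integrable fun y => C * (t * (‖x‖ ^ 5)⁻¹ * (bracket (z + y) ^ 6)⁻¹ +
      (‖x‖ ^ 2)⁻¹ * (convKernel 3 5 t z y + ‖x‖ * convKernel 4 5 t z y)) :=
    ((i3.const_mul _).add ((i1.add (i2.const_mul _)).const_mul _)).const_mul C
  rw [hsum, ← Real.norm_eq_abs]
  refine (norm_integral_le_of_norm_le hdom ?_).trans ?_
  · filter_upwards [ae_ne_zero] with y hy using H t x h y hy
  · have e4 : ∫ y, C * (t * (‖x‖ ^ 5)⁻¹ * (bracket (z + y) ^ 6)⁻¹ +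
        (‖x‖ ^ 2)⁻¹ * (convKernel 3 5 t z y + ‖x‖ * convKernel 4 5 t z y)) =
        C * (t * (‖x‖ ^ 5)⁻¹ * I + (‖x‖ ^ 2)⁻¹ *
          ((∫ y, convKernel 3 5 t z y) + ‖x‖ * ∫ y, convKernel 4 5 t z y)) := by
      have j1 : Integrable fun y => t * (‖x‖ ^ 5)⁻¹ * (bracket (z + y) ^ 6)⁻¹ := i3.const_mul _
      have j2 : Integrable fun y => ‖x‖ * convKernel 4 5 t z y := i2.const_mul _
      have j3 : Integrable fun y => convKernel 3 5 t z y + ‖x‖ * convKernel 4 5 t z y :=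
        i1.add j2
      rw [integral_const_mul, integral_add j1 (j3.const_mul _), integral_const_mul, e3,
        integral_const_mul, integral_add i1 j2, integral_const_mul]
    rw [e4]
    have hR : (‖x‖ ^ 5)⁻¹ ≤ t * (‖x‖ ^ 5)⁻¹ :=
      le_mul_of_one_le_left (by positivity) h.one_le_time
    calc _ ≤ C * (t * (‖x‖ ^ 5)⁻¹ * I + (‖x‖ ^ 2)⁻¹ *
          (C₁ * (8 * (‖x‖ ^ 3)⁻¹) + ‖x‖ * (C₂ * (16 * (‖x‖ ^ 4)⁻¹)))) := by gcongr
      _ = C * (t * (‖x‖ ^ 5)⁻¹ * I + (8 * C₁ + 16 * C₂) * (‖x‖ ^ 5)⁻¹) := by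
          field_simp
      _ ≤ C * (t * (‖x‖ ^ 5)⁻¹ * I + (8 * C₁ + 16 * C₂) * (t * (‖x‖ ^ 5)⁻¹)) := by gcongr
      _ = _ := by ring

lemma abs_mul_pow_five_sub_le {p q u v s : ℝ} (hu : 0 ≤ u) (hus : u ≤ s) (hv : 0 ≤ v)
    (hvs : v ≤ s) (hq : |q| * v ≤ 1) {d e : ℝ} (hd : |p - q| ≤ d) (he : |u - v| ≤ u * v * e)
    (he0 : 0 ≤ e) :
    |p * u ^ 5 - q * v ^ 5| ≤ s ^ 5 * (d + 5 * e) := by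
  have hs : 0 ≤ s := hu.trans hus
  have hd0 : 0 ≤ d := (abs_nonneg _).trans hd
  have e1 : p * u ^ 5 - q * v ^ 5 = (p - q) * u ^ 5 +
      q * (u - v) * (u ^ 4 + u ^ 3 * v + u ^ 2 * v ^ 2 + u * v ^ 3 + v ^ 4) := by ring
  rw [e1]
  refine (abs_add_le _ _).trans ?_
  rw [abs_mul, abs_mul _ (u ^ 4 + _ + _ + _ + _), abs_mul, abs_of_nonneg (by positivity : 0 ≤ u ^ 5),
    abs_of_nonneg (by positivity : 0 ≤ u ^ 4 + u ^ 3 * v + u ^ 2 * v ^ 2 + u * v ^ 3 + v ^ 4)]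
  have h1 : |q| * |u - v| ≤ s * e := by
    calc |q| * |u - v| ≤ |q| * (u * v * e) := by gcongr
      _ = (|q| * v) * (u * e) := by ring
      _ ≤ 1 * (s * e) := by gcongr
      _ = s * e := one_mul _
  calc _ ≤ d * s ^ 5 + s * e * (s ^ 4 + s ^ 3 * s + s ^ 2 * s ^ 2 + s * s ^ 3 + s ^ 4) := by
        gcongr
    _ = _ := by ring

/-- The leading term of `3v + x·∇v` at large distance. -/
noncomputable def leadingTerm (l : ℝ) (x : R5) : ℝ :=
  1 / 2 * boostKer l 1 0 (-stretch l x) -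
    3 / 2 * (lorentzFactor l * l) * (stretch l x 0 * (‖stretch l x‖ ^ 5)⁻¹)

/-- The term proportional to the first coordinate is odd and cancels; the kernel contributes half of
its even sum `4γ⁻¹|x|⁻⁴`. -/
lemma leadingTerm_add_neg (hl : |l| < 1) {x : R5} (hx : x ≠ 0) :
    leadingTerm l x + leadingTerm l (-x) = 2 * ((lorentzFactor l)⁻¹ * (‖x‖ ^ 4)⁻¹) := by
  have h := boostKer_zero_even_part hl hx
  simp only [leadingTerm, map_neg, neg_neg, norm_neg, PiLp.neg_apply]
  linarith

lemma continuousOn_leadingTerm (hl : |l| < 1) : ContinuousOn (leadingTerm l) {0}ᶜ := by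
  have hst : Continuous fun x => stretch l x := (stretch l).continuous
  have hne : ∀ x ∈ ({0}ᶜ : Set R5), stretch l x ≠ 0 := fun x hx => norm_pos_iff.1
    ((norm_pos_iff.2 hx).trans_le (norm_le_norm_stretch hl x))
  have hn : ∀ n : ℕ, ContinuousOn (fun x => (‖stretch l x‖ ^ n)⁻¹) {0}ᶜ := fun n =>
    (hst.norm.pow n).continuousOn.inv₀ fun x hx => pow_ne_zero n (norm_ne_zero_iff.2 (hne x hx))
  have hp : Continuous fun x => boostTime l (-stretch l x) := by
    unfold boostTime; fun_prop
  have hb : ∀ n : ℕ, ContinuousOn (fun x => (boostTime l (-stretch l x) ^ n)⁻¹) {0}ᶜ := fun n =>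
    (hp.pow n).continuousOn.inv₀ fun x hx => pow_ne_zero n
      (boostTime_pos hl (neg_ne_zero.2 (hne x hx))).ne'
  have h0 : Continuous fun x => stretch l x 0 := by fun_prop
  change ContinuousOn (fun x => leadingTerm l x) _
  simp only [leadingTerm, boostKer, blockKer, phase, zero_add, norm_neg]
  exact (continuousOn_const.mul (((hn 3).mul (hb 1)).add
    (continuousOn_const.mul ((hn 2).mul (hb 2))))).sub
    (continuousOn_const.mul (h0.continuousOn.mul (hn 5)))

/-- Two comparisons, each of relative accuracy `t/|x|`: the potential is replaced by a point mass of
weight `|S⁴|/5`, and `x_ℓ` by its linear part, `⟨x_ℓ⟩` becoming a norm. The remaining `t⁻¹⟨x_ℓ⟩⁻⁵`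
is already of the size of the error. -/
lemma abs_three_mul_vSharp_add_fderiv_sub_le (hl : |l| < 1) : ∃ C, 0 ≤ C ∧ ∀ t x,
    FarRegion l t x →
    |3 * vSharp l t x + fderiv ℝ (vSharp l t) x x - leadingTerm l x| ≤
      C * (t * (‖x‖ ^ 5)⁻¹) := by
  obtain ⟨C, hC, H⟩ := abs_integral_scalingKer_add_le hl
  have hγ := lorentzFactor_pos hl
  set γ := lorentzFactor l with hγdef
  have hS := sphArea_pos
  refine ⟨3 / 2 * 2 ^ 5 + 3 / 2 * γ * (2 ^ 5 * (γ + 5 * (1 + γ))) + 5 / 2 * sphArea⁻¹ * C,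
    by positivity, fun t x h => ?_⟩
  have ht : 0 < t := zero_lt_one.trans_le h.one_le_time
  have hr : 0 < ‖x‖ := zero_lt_one.trans_le h.one_le_norm
  have hz := h.norm_xl_lower hl
  have hN := norm_le_norm_stretch hl x
  have hN0 : 0 < ‖stretch l x‖ := hr.trans_le hN
  have hshift := h.norm_shift_le hl
  have hI := H t x h
  rw [three_mul_vSharp_add_fderiv hl ht, leadingTerm]
  set z := xl l t x with hzdef
  have hzX : z = stretch l x - (γ * l * t) • basisVec 0 := xl_eq l t x
  have hb := bracket_pos z
  have hbr : ‖x‖ / 2 ≤ bracket z := hz.trans (norm_le_bracket z)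
  have hu : (bracket z)⁻¹ ≤ 2 * ‖x‖⁻¹ := by
    rw [← div_eq_mul_inv, ← one_div, div_le_div_iff₀ hb hr]
    linarith
  have hv : ‖stretch l x‖⁻¹ ≤ 2 * ‖x‖⁻¹ := by
    rw [← div_eq_mul_inv, ← one_div, div_le_div_iff₀ hN0 hr]
    linarith
  have hdiff : |bracket z - ‖stretch l x‖| ≤ (1 + γ) * t := by
    have a1 : |‖z‖ - ‖stretch l x‖| ≤ γ * t := by
      refine (abs_norm_sub_norm_le z _).trans ?_
      rw [hzX]
      simpa using hshift
    have a2 := abs_le.1 a1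
    have a3 := norm_le_bracket z
    have a4 := bracket_le z
    have := h.one_le_time
    rw [abs_le]
    constructor <;> linarith [a2.1, a2.2]
  have key : |z 0 * (bracket z)⁻¹ ^ 5 - stretch l x 0 * ‖stretch l x‖⁻¹ ^ 5| ≤
      (2 * ‖x‖⁻¹) ^ 5 * (γ * t + 5 * ((1 + γ) * t)) := by
    refine abs_mul_pow_five_sub_le (by positivity) hu (by positivity) hv ?_ ?_ ?_ (by positivity)
    · rw [← div_eq_mul_inv, div_le_one hN0]
      exact abs_coord_le_norm _ 0
    · refine le_trans ?_ hshift
      have := abs_coord_le_norm (-((γ * l * t) • basisVec 0)) 0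
      rw [norm_neg] at this
      refine le_trans (le_of_eq ?_) this
      rw [hzX]
      simp
    · have e : (bracket z)⁻¹ - ‖stretch l x‖⁻¹ =
          (bracket z)⁻¹ * ‖stretch l x‖⁻¹ * (‖stretch l x‖ - bracket z) := by field_simp
      rw [e, abs_mul, abs_of_nonneg (by positivity : 0 ≤ (bracket z)⁻¹ * ‖stretch l x‖⁻¹),
        abs_sub_comm]
      gcongr
  have hA : |3 / 2 * t⁻¹ * (bracket z ^ 5)⁻¹| ≤ 3 / 2 * 2 ^ 5 * (t * (‖x‖ ^ 5)⁻¹) := by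
    rw [abs_of_nonneg (by positivity), ← inv_pow]
    have a1 : t⁻¹ ≤ t := (inv_le_one_of_one_le₀ h.one_le_time).trans h.one_le_time
    calc _ ≤ 3 / 2 * t * (2 * ‖x‖⁻¹) ^ 5 := by gcongr
      _ = _ := by rw [mul_pow, inv_pow]; ring
  set J := ∫ y, scalingKer l t (stretch l x) y * density (z + y)
  set K := boostKer l 1 0 (-stretch l x)
  have e : 3 / 2 * t⁻¹ * (bracket z ^ 5)⁻¹ - 3 / 2 * (γ * l) * (z 0 * (bracket z ^ 5)⁻¹) -
      5 / 2 * sphArea⁻¹ * J - (1 / 2 * K -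
      3 / 2 * (γ * l) * (stretch l x 0 * (‖stretch l x‖ ^ 5)⁻¹)) =
      3 / 2 * t⁻¹ * (bracket z ^ 5)⁻¹ - 3 / 2 * (γ * l) *
        (z 0 * (bracket z)⁻¹ ^ 5 - stretch l x 0 * ‖stretch l x‖⁻¹ ^ 5) -
      5 / 2 * sphArea⁻¹ * (J + sphArea / 5 * K) := by
    rw [inv_pow, inv_pow]
    field_simp
    ring
  rw [e]
  refine (abs_sub _ _).trans ((add_le_add_left (abs_sub _ _) _).trans ?_)
  have hB : |3 / 2 * (γ * l) * (z 0 * (bracket z)⁻¹ ^ 5 - stretch l x 0 * ‖stretch l x‖⁻¹ ^ 5)| ≤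
      3 / 2 * γ * ((2 * ‖x‖⁻¹) ^ 5 * (γ * t + 5 * ((1 + γ) * t))) := by
    rw [abs_mul, abs_mul, abs_mul, abs_of_pos hγ, abs_of_pos (by norm_num : (0 : ℝ) < 3 / 2)]
    gcongr
    nlinarith
  have hD : |5 / 2 * sphArea⁻¹ * (J + sphArea / 5 * K)| ≤
      5 / 2 * sphArea⁻¹ * (C * (t * (‖x‖ ^ 5)⁻¹)) := by
    rw [abs_mul, abs_of_pos (by positivity : 0 < 5 / 2 * sphArea⁻¹)]
    gcongr
  refine (add_le_add (add_le_add hA hB) hD).trans (le_of_eq ?_)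
  rw [mul_pow, inv_pow]
  ring

lemma differentiableAt_VSharp (hl : |l| < 1) {t : ℝ} (ht : 0 < t) (r : ℝ) :
    DifferentiableAt ℝ (fun σ => VSharp l t σ) r :=
  (hasDerivAt_sphMean ((contDiff_vSharp hl ht).of_le (by simp)) 0 r).differentiableAt

/-- The radial derivative passes under the spherical mean, and `r∂_r` becomes `x·∇` on the sphere of
radius `r`. -/
lemma phiSharp_eq (hl : |l| < 1) {t r : ℝ} (ht : 0 < t) :
    phiSharp l t r = r * (sphArea⁻¹ * ∫ θ, (3 * vSharp l t (r • (θ : R5)) +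
      fderiv ℝ (vSharp l t) (r • (θ : R5)) (r • (θ : R5))) ∂sphMeasure) := by
  have hv := contDiff_vSharp hl ht
  have h1 := (hasDerivAt_sphMean (hv.of_le (by simp)) 0 r).deriv
  have hf : Continuous (fderiv ℝ (vSharp l t)) := hv.continuous_fderiv (by simp)
  have hc := hv.continuous
  have i1 : Integrable (fun θ : sphere (0 : R5) 1 => 3 * vSharp l t (r • (θ : R5))) sphMeasure :=
    integrable_sphere_of_continuous (by fun_prop)
  have i2 : Integrable (fun θ : sphere (0 : R5) 1 =>
      fderiv ℝ (vSharp l t) (r • (θ : R5)) (r • (θ : R5))) sphMeasure := by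
    refine integrable_sphere_of_continuous ?_
    have h2 : Continuous fun θ : sphere (0 : R5) 1 => fderiv ℝ (vSharp l t) (r • (θ : R5)) :=
      hf.comp (by fun_prop)
    exact h2.clm_apply (by fun_prop)
  have h3 : deriv (fun σ => VSharp l t σ) r = _ := h1
  rw [phiSharp, h3, VSharp, sphMean_eq, integral_add i1 i2, integral_const_mul]
  simp only [zero_add, map_smul, smul_eq_mul]
  rw [integral_const_mul]
  ring

/-- The odd part of the leading term averages to zero and its even part is constant on each sphere,
so averaging costs nothing beyond the pointwise error. -/
lemma abs_phiSharp_sub_le (hl : |l| < 1) : ∃ C, 0 ≤ C ∧ ∀ t r : ℝ, 1 ≤ t → 1 ≤ r →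
    4 * lorentzFactor l * t ≤ r →
    |phiSharp l t r - (lorentzFactor l)⁻¹ * (r ^ 3)⁻¹| ≤ C * (t * (r ^ 4)⁻¹) := by
  obtain ⟨C, hC, H⟩ := abs_three_mul_vSharp_add_fderiv_sub_le hl
  refine ⟨C, hC, fun t r ht hr htr => ?_⟩
  have ht0 : 0 < t := by linarith
  have hr0 : 0 < r := by linarith
  have hS := sphArea_pos
  have hv := contDiff_vSharp hl ht0
  have hf : Continuous (fderiv ℝ (vSharp l t)) := hv.continuous_fderiv (by simp)
  have hc := hv.continuous
  have hne : ∀ θ : sphere (0 : R5) 1, r • (θ : R5) ≠ 0 := fun θ =>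
    norm_pos_iff.1 (by rw [norm_smul_sphere hr0]; exact hr0)
  set F : sphere (0 : R5) 1 → ℝ := fun θ => 3 * vSharp l t (r • (θ : R5)) +
      fderiv ℝ (vSharp l t) (r • (θ : R5)) (r • (θ : R5)) with hF
  set G : sphere (0 : R5) 1 → ℝ := fun θ => leadingTerm l (r • (θ : R5)) with hG
  have iF : Integrable F sphMeasure := by
    refine integrable_sphere_of_continuous ?_
    have h2 : Continuous fun θ : sphere (0 : R5) 1 => fderiv ℝ (vSharp l t) (r • (θ : R5)) :=
      hf.comp (by fun_prop)
    have h3 : Continuous fun θ : sphere (0 : R5) 1 =>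
        fderiv ℝ (vSharp l t) (r • (θ : R5)) (r • (θ : R5)) := h2.clm_apply (by fun_prop)
    exact (by fun_prop : Continuous fun θ : sphere (0 : R5) 1 =>
      3 * vSharp l t (r • (θ : R5))).add h3
  have iG : Integrable G sphMeasure := by
    refine integrable_sphere_of_continuous ?_
    exact (continuousOn_leadingTerm hl).comp_continuous (by fun_prop) hne
  have eG : ∫ θ, G θ ∂sphMeasure = sphArea * ((lorentzFactor l)⁻¹ * (r ^ 4)⁻¹) := by
    refine integral_sphere_of_even_part iG fun θ => ?_
    have := leadingTerm_add_neg hl (hne θ)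
    rw [norm_smul_sphere hr0] at this
    simpa [hG] using this
  have hFG : |∫ θ, (F θ - G θ) ∂sphMeasure| ≤ C * (t * (r ^ 5)⁻¹) * sphArea := by
    rw [← Real.norm_eq_abs, sphArea]
    refine norm_integral_le_of_norm_le_const (.of_forall fun θ => ?_)
    have := H t (r • (θ : R5)) ⟨ht, by rwa [norm_smul_sphere hr0], by rwa [norm_smul_sphere hr0]⟩
    rwa [norm_smul_sphere hr0] at this
  rw [integral_sub iF iG, eG] at hFG
  have hF' : ∫ θ, F θ ∂sphMeasure = ∫ θ, (3 * vSharp l t (r • (θ : R5)) +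
      fderiv ℝ (vSharp l t) (r • (θ : R5)) (r • (θ : R5))) ∂sphMeasure := rfl
  have e : phiSharp l t r - (lorentzFactor l)⁻¹ * (r ^ 3)⁻¹ = r * sphArea⁻¹ *
      ((∫ θ, F θ ∂sphMeasure) - sphArea * ((lorentzFactor l)⁻¹ * (r ^ 4)⁻¹)) := by
    rw [phiSharp_eq hl ht0, ← hF']
    field_simp
  rw [e, abs_mul, abs_of_pos (by positivity : 0 < r * sphArea⁻¹)]
  calc _ ≤ r * sphArea⁻¹ * (C * (t * (r ^ 5)⁻¹) * sphArea) := by gcongr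
    _ = _ := by field_simp

/-- Asymptotics of the spherical means in the region `t < r^{11/12}`. -/
lemma asymptotics_phiSharp (hl : |l| < 1) : ∃ T : ℝ, 1 < T ∧ ∃ C : ℝ, ∀ t : ℝ, T ≤ t →
    ∀ r : ℝ, 0 < r → t < r ^ ((11 : ℝ) / 12) →
      |phiSharp l t r - Real.sqrt (1 - l ^ 2) * (r ^ 3)⁻¹| ≤
        C * (r⁻¹ * t ^ (-(9 : ℝ) / 4)) := by
  obtain ⟨C, hC, H⟩ := abs_phiSharp_sub_le hl
  have hγ := lorentzFactor_pos hl
  -- With this `T`, `t < r^{11/12} ≤ r` forces `r^{1/12} ≥ 4γ`. Multiplying by `r^{11/12} > t` gives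
  -- the far region condition `4γt ≤ r`.
  refine ⟨(4 * lorentzFactor l) ^ 12 + 2, by linarith [pow_pos (mul_pos four_pos hγ) 12],
    C, fun t ht r hr htr => ?_⟩
  have hp : 0 < (4 * lorentzFactor l) ^ 12 := by positivity
  have ht1 : 1 < t := by linarith
  have ht0 : 0 < t := by linarith
  have hr1 : 1 ≤ r := by
    by_contra! hlt
    have := Real.rpow_le_one hr.le hlt.le (by norm_num : (0 : ℝ) ≤ 11 / 12)
    linarith
  have hr2 : r ^ ((11 : ℝ) / 12) ≤ r := by
    simpa using Real.rpow_le_rpow_of_exponent_le hr1 (by norm_num : (11 : ℝ) / 12 ≤ 1)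
  have hr3 : 4 * lorentzFactor l ≤ r ^ ((1 : ℝ) / 12) := by
    have h1 : (4 * lorentzFactor l) ^ 12 ≤ r := by linarith
    have h2 := Real.rpow_le_rpow hp.le h1 (by norm_num : (0 : ℝ) ≤ 1 / 12)
    rwa [← Real.rpow_natCast, ← Real.rpow_mul (by positivity),
      show ((12 : ℕ) : ℝ) * (1 / 12) = 1 by norm_num, Real.rpow_one] at h2
  have hr4 : 4 * lorentzFactor l * t ≤ r := by
    calc _ ≤ r ^ ((1 : ℝ) / 12) * r ^ ((11 : ℝ) / 12) := by gcongr
      _ = r := by rw [← Real.rpow_add hr]; norm_num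
  have h := H t r ht1.le hr1 hr4
  rw [show Real.sqrt (1 - l ^ 2) = (lorentzFactor l)⁻¹ by rw [lorentzFactor, inv_inv]]
  refine h.trans (mul_le_mul_of_nonneg_left ?_ hC)
  -- The exponent `13/4 = 1 + 9/4` is what turns `t r⁻⁴` into `r⁻¹ t^{-9/4}`; the room is narrow,
  -- since `11/12 · 13/4 = 143/48 < 144/48 = 3`.
  have h5 : t ^ ((13 : ℝ) / 4) ≤ r ^ 3 := by
    calc t ^ ((13 : ℝ) / 4) ≤ (r ^ ((11 : ℝ) / 12)) ^ ((13 : ℝ) / 4) := by gcongr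
      _ = r ^ ((143 : ℝ) / 48) := by rw [← Real.rpow_mul hr.le]; norm_num
      _ ≤ r ^ ((3 : ℕ) : ℝ) := Real.rpow_le_rpow_of_exponent_le hr1 (by norm_num)
      _ = r ^ 3 := Real.rpow_natCast _ _
  have h6 : t = t ^ ((13 : ℝ) / 4) * t ^ (-(9 : ℝ) / 4) := by
    rw [← Real.rpow_add ht0]; norm_num
  calc t * (r ^ 4)⁻¹ = t ^ ((13 : ℝ) / 4) * t ^ (-(9 : ℝ) / 4) * (r ^ 4)⁻¹ := by rw [← h6]
    _ ≤ r ^ 3 * t ^ (-(9 : ℝ) / 4) * (r ^ 4)⁻¹ := by gcongr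
    _ = _ := by field_simp

end SphericalAsymptotics

theorem mainTheorem3 (l : ℝ) (hl₁ : -1 < l) (hl₂ : l < 1) :
    -- the Duhamel integral converges absolutely and defines a smooth function
    (∀ t : ℝ, 0 < t → ∀ x : R5, IntegrableOn (duhamelIntegrand l t x) (Ioi 0)) ∧
    ContDiffOn ℝ ∞ (fun p : ℝ × R5 => vSharp l p.1 p.2) (Ioi (0 : ℝ) ×ˢ univ) ∧
    -- pointwise space-time decay
    (∀ δ : ℝ, 0 < δ → δ < 1 → ∀ m : ℕ,
      (∃ C : ℝ, ∀ t : ℝ, 1 < t → ∀ x : R5,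
        |((opA l)^[m] (vSharp l)) t x| ≤
          C * ((t + bracket (xl l t x))⁻¹ * (t ^ (1 + m))⁻¹ *
            bracket (xl l t x) ^ (-2 + δ))) ∧
      (∀ α : Fin 5 → ℕ, ∑ i, α i = 1 → ∃ C : ℝ, ∀ t : ℝ, 1 < t → ∀ x : R5,
        |((opA l)^[m] (partialAlpha α (vSharp l))) t x| ≤
          C * ((t + bracket (xl l t x))⁻¹ * (t ^ (1 + m))⁻¹ *
            bracket (xl l t x) ^ (-3 + δ))) ∧
      (∀ α : Fin 5 → ℕ, 2 ≤ ∑ i, α i → ∃ C : ℝ, ∀ t : ℝ, 1 < t → ∀ x : R5,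
        |((opA l)^[m] (partialAlpha α (vSharp l))) t x| ≤
          C * ((t + bracket (xl l t x))⁻¹ * (t ^ (1 + m))⁻¹ *
            bracket (xl l t x) ^ (-4 + δ)))) ∧
    -- asymptotics of the spherical means
    (∀ t : ℝ, 1 < t → ∀ r : ℝ, 0 < r → DifferentiableAt ℝ (fun ρ => VSharp l t ρ) r) ∧
    (∃ T : ℝ, 1 < T ∧ ∃ C : ℝ, ∀ t : ℝ, T ≤ t → ∀ r : ℝ, 0 < r →
      t < r ^ ((11 : ℝ) / 12) →
        |phiSharp l t r - Real.sqrt (1 - l ^ 2) * (r ^ 3)⁻¹| ≤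
          C * (r⁻¹ * t ^ (-(9 : ℝ) / 4))) := by
  have hl : |l| < 1 := abs_lt.2 ⟨hl₁, hl₂⟩
  exact ⟨fun t ht x => integrableOn_duhamelIntegrand hl ht x, contDiffOn_vSharp hl,
    fun δ hδ hδ' m => ⟨decay_vSharp hl hδ hδ' m, fun α hα => decay_vSharp_one hl hδ hδ' m hα,
      fun α hα => decay_vSharp_two hl hδ hδ' m hα⟩,
    fun t ht r _ => differentiableAt_VSharp hl (zero_lt_one.trans ht) r,
    asymptotics_phiSharp hl⟩
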